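/- Let $p$ be an odd prime, let $R=\widehat{\mathbb Z_p^{ur}}$ be the $p$-adic completion of the maximal unramified extension of $\mathbb Z_p$ (i.e. the Witt ring $W(\overline{\mathbb F}_p)$), and let $\phi:R\to R$ be its Frobenius lift. Let $G=GL_n$ over $R$, let $\widehat G$ be its $p$-adic completion, so that $\mathcal O(\widehat G)=R[x,\det(x)^{-1}]\hat{\ }$ with $x=(x_{ij})$, and let $T,W\subset G$ be the subgroup schemes of diagonal matrices and of permutation matrices. A lift of Frobenius on $\widehat G$ is a ring endomorphism $\phi_G$ of $\mathcal O(\widehat G)$ that reduces mod $p$ to the $p$-power Frobenius; we also write $\phi_G:\widehat G\to\widehat G$ for the induced morphism. Let $\phi_{G,0}$ be the lift of Frobenius given by $\phi$ on $R$ and by $\phi_{G,0}(x)=x^{(p)}:=(x_{ij}^p)$. A closed subscheme $H\subset G$ is $\phi_G$-horizontal if $\phi_G$ maps the ideal of $\mathcal O(\widehat G)$ generated by the ideal of $H$ into itself; then $\phi_G$ induces $\phi_H$ on $\widehat H$. One says that $\phi_G$ is left (resp. right) compatible with $H$ if $H$ is $\phi_G$-horizontal and the multiplication $\widehat H\times\widehat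 G\to\widehat G$ (resp. $\widehat G\times\widehat H\to\widehat G$) intertwines $\phi_H\times\phi_G$ (resp. $\phi_G\times\phi_H$) with $\phi_G$. Let $S$ be one of $GL_n$, $Sp_{2r}$, $SO_{2r}$, $SO_{2r+1}$ (with $n=2r,2r,2r+1$ in the last three cases), with canonical quadratic map ${\mathcal H}:G\to G$, ${\mathcal H}(x)=x^\dagger q x$: for $GL_n$, $x^\dagger=x^{-1}$ and $q=1$, so ${\mathcal H}(x)=1$; in the other cases $x^\dagger=x^t$ and $q$ is respectively $$\begin{pmatrix}0&1_r\\-1_r&0\end{pmatrix},\quad \begin{pmatrix}0&1_r\\1_r&0\end{pmatrix},\quad \begin{pmatrix}1&0&0\\0&0&1_r\\0&1_r&0\end{pmatrix}.$$ Then $S={\mathcal H}^{-1}(q)^\circ$ is the connected component of the identity of ${\mathcal H}^{-1}(q)$. Put ${\mathcal H}_2(x,y)={\mathcal H}(x)x^{-1}y=x^\dagger q y$. One says that ${\mathcal H}$ is horizontal (with respect to $\phi_G,\phi_{G,0}$) if ${\mathcal H}\circ\phi_G=\phi_{G,0}\circ{\mathcal H}$ on $\widehat G$, and symmetric if ${\mathcal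 H}_2\circ(\phi_{G,0},\phi_G)={\mathcal H}_2\circ(\phi_G,\phi_{G,0})$ as morphisms $\widehat G\to\widehat G$. Then: 1) There exists a unique lift of Frobenius $\phi_G$ on $\widehat G$ such that ${\mathcal H}$ is horizontal and symmetric with respect to $\phi_G,\phi_{G,0}$. 2) This $\phi_G$ is right compatible with $T$ and with $W$, and left compatible with $T_S:=T\cap S$ and with $W_S:=W\cap S$. Moreover, let $\Phi(x)=(\phi_G(x_{ij}))$ and let $l\delta:GL_n(R)\to \mathfrak{gl}_n(R)$, $l\delta a=\frac1p\left(\phi(a)\Phi(a)^{-1}-1\right)$, be the arithmetic logarithmic derivative associated with $\phi_G$; put $a\star_\delta b=\phi(a)\,b\,\phi(a)^{-1}$ and $a+_\delta b=a+b+pab$. Then $$l\delta(ab)=a\star_\delta l\delta(b)+_\delta l\delta(a)$$ for all $a\in T_S(R)W_S(R)$ and $b\in GL_n(R)$, and also for all $a\in GL_n(R)$ and $b\in T(R)W(R)$. 3) If $\chi$ is a root of $S$ with respect to $T_S$, and $\chi$ is not a shortest root of $SO_n$ with $n$ odd, then the corresponding root group $U_\chi\simeq\mathbb G_a$ is $\phi_G$-horizontal.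 -/

import Mathlib

open scoped TensorProduct Matrix Polynomial

namespace DeltaFlow

noncomputable section

/-! ### The base ring and `p`-adic completions -/

/-- `R`, the `p`-adic completion of the maximal unramified extension of `ℤ_p`, in its standard form
as the ring of `p`-typical Witt vectors of an algebraic closure of `𝔽_p`. -/
abbrev ZpUr (p : ℕ) [Fact p.Prime] : Type := WittVector p (AlgebraicClosure (ZMod p))

/-- The Frobenius lift `φ` of `R`. -/
abbrev frob (p : ℕ) [Fact p.Prime] : ZpUr p →+* ZpUr p := WittVector.frobenius

/-- The ideal `pA`. -/
abbrev pIdeal (p : ℕ) (A : Type*) [CommRing A] : Ideal A := Ideal.span {(p : A)}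

/-- The `p`-adic completion of a ring. -/
abbrev Hat (p : ℕ) (A : Type*) [CommRing A] : Type _ := AdicCompletion (pIdeal p A) A

theorem pIdeal_map (p : ℕ) {A B : Type*} [CommRing A] [CommRing B] (f : A →+* B) :
    (pIdeal p A).map f = pIdeal p B := by
  simp [pIdeal, Ideal.map_span]

instance hatComplete (p : ℕ) (A : Type*) [CommRing A] :
    IsAdicComplete (pIdeal p (Hat p A)) (Hat p A) := by
  have h : IsAdicComplete (pIdeal p A) (Hat p A) :=
    AdicCompletion.isAdicComplete ⟨{(p : A)}, by simp⟩
  rw [← pIdeal_map p (algebraMap A (Hat p A))]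
  exact (IsAdicComplete.map_algebraMap_iff _ _).mpr h

theorem pIdeal_pow_le_comap (p : ℕ) {A C : Type*} [CommRing A] [CommRing C] (f : A →+* C) (n : ℕ) :
    pIdeal p A ^ n ≤ (pIdeal p C ^ n).comap f := by
  rw [← pIdeal_map p f, ← Ideal.map_pow]
  exact Ideal.le_comap_map

theorem extendHat_compat (p : ℕ) {A C : Type*} [CommRing A] [CommRing C] (f : A →+* C) {m n : ℕ}
    (hle : m ≤ n) :
    (Ideal.Quotient.factorPow (pIdeal p C) hle).comp
      ((Ideal.quotientMap (pIdeal p C ^ n) f (pIdeal_pow_le_comap p f n)).comp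
        (AdicCompletion.evalₐ (pIdeal p A) n : Hat p A →+* A ⧸ pIdeal p A ^ n)) =
      (Ideal.quotientMap (pIdeal p C ^ m) f (pIdeal_pow_le_comap p f m)).comp
        (AdicCompletion.evalₐ (pIdeal p A) m : Hat p A →+* A ⧸ pIdeal p A ^ m) := by
  ext x
  obtain ⟨a, rfl⟩ := AdicCompletion.mk_surjective (pIdeal p A) A x
  simp only [RingHom.comp_apply, RingHom.coe_coe, AdicCompletion.evalₐ_mk, Ideal.quotientMap_mk]
  change Ideal.Quotient.mk _ (f (a.val n)) = Ideal.Quotient.mk _ (f (a.val m))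
  rw [Ideal.Quotient.mk_eq_mk_iff_sub_mem, ← map_sub]
  apply pIdeal_pow_le_comap p f m
  rw [← Ideal.Quotient.mk_eq_mk_iff_sub_mem]
  exact (AdicCompletion.Ideal.mk_eq_mk (pIdeal p A) hle a)

/-- The extension by continuity of a ring homomorphism `A → C` with `p`-adically complete target to
the `p`-adic completion of `A`. -/
def extendHat (p : ℕ) {A C : Type*} [CommRing A] [CommRing C] [IsAdicComplete (pIdeal p C) C]
    (f : A →+* C) : Hat p A →+* C :=
  IsAdicComplete.liftRingHom (pIdeal p C)
    (fun n => (Ideal.quotientMap (pIdeal p C ^ n) f (pIdeal_pow_le_comap p f n)).comp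
      (AdicCompletion.evalₐ (pIdeal p A) n : Hat p A →+* A ⧸ pIdeal p A ^ n))
    (extendHat_compat p f)

theorem extendHat_algebraMap (p : ℕ) {A C : Type*} [CommRing A] [CommRing C]
    [IsAdicComplete (pIdeal p C) C] (f : A →+* C) (a : A) :
    extendHat p f (algebraMap A (Hat p A) a) = f a := by
  rw [← sub_eq_zero]
  refine IsHausdorff.haus (I := pIdeal p C) inferInstance _ fun n => ?_
  rw [SModEq.zero, smul_eq_mul, Ideal.mul_top, ← Ideal.Quotient.mk_eq_mk_iff_sub_mem]
  exact IsAdicComplete.mk_liftRingHom (pIdeal p C) _ (extendHat_compat p f) n _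

/-- Two ring homomorphisms out of `Â` into a ring in which `p = 0` agree if they agree on `A`. -/
theorem hat_hom_ext (p : ℕ) {A Q : Type*} [CommRing A] [CommRing Q] (hQ : (p : Q) = 0)
    {f g : Hat p A →+* Q}
    (h : f.comp (algebraMap A (Hat p A)) = g.comp (algebraMap A (Hat p A))) : f = g := by
  ext x
  obtain ⟨a, ha⟩ := Ideal.Quotient.mk_surjective (AdicCompletion.evalOneₐ (pIdeal p A) x)
  have hx : x - algebraMap A (Hat p A) a ∈ pIdeal p (Hat p A) := by
    rw [← pIdeal_map p (algebraMap A (Hat p A)),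
      ← AdicCompletion.ker_evalOneₐ_eq_map (pIdeal p A) ⟨{(p : A)}, by simp⟩]
    change AdicCompletion.evalOneₐ (pIdeal p A) (x - algebraMap A (Hat p A) a) = 0
    rw [map_sub, ← ha, sub_eq_zero]
    rfl
  obtain ⟨y, hy⟩ := Ideal.mem_span_singleton'.mp hx
  have hxy : x = algebraMap A (Hat p A) a + y * (p : Hat p A) := by rw [hy]; ring
  have := RingHom.congr_fun h a
  simp only [RingHom.comp_apply] at this
  rw [hxy, map_add, map_add, map_mul, map_mul, map_natCast, map_natCast, hQ, this]
  simp

/-! ### The coordinate ring of `GL_ι` and its points -/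

/-- `R[x, det(x)⁻¹]`, the coordinate ring of `G = GL_ι` over `R`. -/
abbrev OGL (p : ℕ) [Fact p.Prime] (ι : Type) [Fintype ι] [DecidableEq ι] : Type :=
  Localization.Away (Matrix.mvPolynomialX ι ι (ZpUr p)).det

section GLn

variable (p : ℕ) [Fact p.Prime] (ι : Type) [Fintype ι] [DecidableEq ι]

/-- `R[x, det(x)⁻¹]^`, the ring of functions on `Ĝ`. -/
abbrev OGLhat : Type := Hat p (OGL p ι)

/-- The generic matrix `x`, over `R[x, det(x)⁻¹]`. -/
def genX : GL ι (OGL p ι) :=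
  Matrix.GeneralLinearGroup.mk''
    ((Matrix.mvPolynomialX ι ι (ZpUr p)).map (algebraMap _ (OGL p ι))) (by
      rw [← RingHom.mapMatrix_apply, ← RingHom.map_det]
      exact IsLocalization.Away.algebraMap_isUnit _)

/-- The generic matrix `x`, over `R[x, det(x)⁻¹]^`. -/
def genXhat : GL ι (OGLhat p ι) :=
  Matrix.GeneralLinearGroup.map (algebraMap (OGL p ι) (OGLhat p ι)) (genX p ι)

variable {ι}

/-- The ring homomorphism `R[x, det(x)⁻¹] → C` given by `h` on `R` and sending `x` to `g`. -/
def evalGL {C : Type*} [CommRing C] (h : ZpUr p →+* C) (g : GL ι C) : OGL p ι →+* C :=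
  IsLocalization.Away.lift (Matrix.mvPolynomialX ι ι (ZpUr p)).det
    (g := MvPolynomial.eval₂Hom h (fun ij : ι × ι => (g : Matrix ι ι C) ij.1 ij.2)) (by
      have hg : (Matrix.mvPolynomialX ι ι (ZpUr p)).map
          (MvPolynomial.eval₂Hom h (fun ij : ι × ι => (g : Matrix ι ι C) ij.1 ij.2)) = g := by
        ext i j
        simp [Matrix.mvPolynomialX]
      rw [RingHom.map_det, RingHom.mapMatrix_apply, hg]
      exact (Matrix.GeneralLinearGroup.det g).isUnit)

theorem evalGL_algebraMap {C : Type*} [CommRing C] (h : ZpUr p →+* C) (g : GL ι C) (r : ZpUr p) :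
    evalGL p h g (algebraMap (ZpUr p) (OGL p ι) r) = h r := by
  rw [IsScalarTower.algebraMap_apply (ZpUr p) (MvPolynomial (ι × ι) (ZpUr p)) (OGL p ι), evalGL,
    IsLocalization.Away.lift_eq, MvPolynomial.algebraMap_eq]
  simp

theorem evalGL_genX {C : Type*} [CommRing C] (h : ZpUr p →+* C) (g : GL ι C) (i j : ι) :
    evalGL p h g ((genX p ι : Matrix ι ι (OGL p ι)) i j) = (g : Matrix ι ι C) i j := by
  change evalGL p h g (algebraMap _ (OGL p ι) (Matrix.mvPolynomialX ι ι (ZpUr p) i j)) = _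
  rw [evalGL, IsLocalization.Away.lift_eq]
  simp [Matrix.mvPolynomialX]

/-- The ring homomorphism `R[x, det(x)⁻¹]^ → C`, for `C` `p`-adically complete, given by `h` on `R`
and sending `x` to `g`. -/
def evalHat {C : Type*} [CommRing C] [IsAdicComplete (pIdeal p C) C] (h : ZpUr p →+* C)
    (g : GL ι C) : OGLhat p ι →+* C :=
  extendHat p (evalGL p h g)

theorem evalHat_algebraMap {C : Type*} [CommRing C] [IsAdicComplete (pIdeal p C) C]
    (h : ZpUr p →+* C) (g : GL ι C) (r : ZpUr p) :
    evalHat p h g (algebraMap (ZpUr p) (OGLhat p ι) r) = h r := by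
  rw [IsScalarTower.algebraMap_apply (ZpUr p) (OGL p ι) (OGLhat p ι), evalHat,
    extendHat_algebraMap, evalGL_algebraMap]

theorem evalHat_genXhat {C : Type*} [CommRing C] [IsAdicComplete (pIdeal p C) C]
    (h : ZpUr p →+* C) (g : GL ι C) (i j : ι) :
    evalHat p h g ((genXhat p ι : Matrix ι ι (OGLhat p ι)) i j) = (g : Matrix ι ι C) i j := by
  change evalHat p h g (algebraMap _ (OGLhat p ι) ((genX p ι : Matrix ι ι (OGL p ι)) i j)) = _
  rw [evalHat, extendHat_algebraMap, evalGL_genX]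

/-- For a closed subscheme of `G` given by an ideal, its set of `C`-points inside `GL_ι(C)`. -/
def points (I : Ideal (OGL p ι)) (C : Type) [CommRing C] [Algebra (ZpUr p) C] : Set (GL ι C) :=
  {g | ∀ f ∈ I, evalGL p (algebraMap (ZpUr p) C) g f = 0}

theorem isUnit_det_powP {C : Type*} [CommRing C] [IsAdicComplete (pIdeal p C) C] (g : GL ι C) :
    IsUnit ((g : Matrix ι ι C).map (· ^ p)).det := by
  have h1 : ((g : Matrix ι ι C).map (· ^ p)).det - (g : Matrix ι ι C).det ^ p ∈ pIdeal p C := by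
    rw [← Ideal.Quotient.mk_eq_mk_iff_sub_mem]
    rcases subsingleton_or_nontrivial (C ⧸ pIdeal p C) with hs | hn
    · exact Subsingleton.elim _ _
    · have hp0 : (p : C ⧸ pIdeal p C) = 0 := by
        rw [← map_natCast (Ideal.Quotient.mk (pIdeal p C)), Ideal.Quotient.eq_zero_iff_mem]
        exact Ideal.mem_span_singleton_self _
      have : CharP (C ⧸ pIdeal p C) p :=
        (CharP.charP_iff_prime_eq_zero Fact.out).mpr hp0
      rw [map_pow, ← frobenius_def, RingHom.map_det, RingHom.map_det, RingHom.map_det]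
      congr 1
  have h2 : ((g : Matrix ι ι C).map (· ^ p)).det - (g : Matrix ι ι C).det ^ p
      ∈ Ideal.jacobson (⊥ : Ideal C) := IsAdicComplete.le_jacobson_bot (pIdeal p C) h1
  have hu : IsUnit ((g : Matrix ι ι C).det ^ p) :=
    (Matrix.GeneralLinearGroup.det g).isUnit.pow p
  obtain ⟨u, hu⟩ := hu
  rw [Ideal.mem_jacobson_bot] at h2
  have h3 := h2 (↑u⁻¹ : C)
  rw [← hu, sub_mul, Units.mul_inv, sub_add_cancel] at h3
  exact isUnit_of_mul_isUnit_left h3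

/-- The matrix `g^{(p)} = (g_{ij}^p)`. It is again invertible since `C` is `p`-adically complete. -/
def powP {C : Type*} [CommRing C] [IsAdicComplete (pIdeal p C) C] (g : GL ι C) : GL ι C :=
  Matrix.GeneralLinearGroup.mk'' ((g : Matrix ι ι C).map (· ^ p)) (isUnit_det_powP p g)

/-! ### Lifts of Frobenius (`δ`-flows) -/

/-- A lift of Frobenius on `Ĝ`: a ring endomorphism of `O(Ĝ)` reducing mod `p` to the `p`-power
Frobenius. -/
structure FrobLift (ι : Type) [Fintype ι] [DecidableEq ι] where
  toHom : OGLhat p ι →+* OGLhat p ι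
  lift : ∀ f, toHom f - f ^ p ∈ pIdeal p (OGLhat p ι)

theorem frob_sub_pow_mem (r : ZpUr p) : frob p r - r ^ p ∈ pIdeal p (ZpUr p) := by
  rw [WittVector.mem_span_p_iff_coeff_zero_eq_zero]
  have h := map_sub (WittVector.constantCoeff (p := p) (R := AlgebraicClosure (ZMod p)))
    (frob p r) (r ^ p)
  rw [map_pow] at h
  simpa [WittVector.coeff_frobenius_charP] using h

theorem charP_quotient (C : Type*) [CommRing C] [Nontrivial (C ⧸ pIdeal p C)] :
    CharP (C ⧸ pIdeal p C) p := by
  refine (CharP.charP_iff_prime_eq_zero Fact.out).mpr ?_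
  rw [← map_natCast (Ideal.Quotient.mk (pIdeal p C)), Ideal.Quotient.eq_zero_iff_mem]
  exact Ideal.mem_span_singleton_self _

variable (ι) in
/-- The underlying endomorphism of `φ_{G,0}`: it is `φ` on `R` and sends `x` to `x^{(p)}`. -/
def phiZeroHom : OGLhat p ι →+* OGLhat p ι :=
  evalHat p ((algebraMap (ZpUr p) (OGLhat p ι)).comp (frob p)) (powP p (genXhat p ι))

variable (ι) in
/-- The lift of Frobenius `φ_{G,0}(x) = x^{(p)}`. -/
def phiZero : FrobLift p ι where
  toHom := phiZeroHom p ι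
  lift := by
    rcases subsingleton_or_nontrivial (OGLhat p ι ⧸ pIdeal p (OGLhat p ι)) with hs | hn
    · intro f
      rw [← Ideal.Quotient.eq_zero_iff_mem]
      exact Subsingleton.elim _ _
    have := charP_quotient p (OGLhat p ι)
    have key : (Ideal.Quotient.mk (pIdeal p (OGLhat p ι))).comp (phiZeroHom p ι) =
        (frobenius _ p).comp (Ideal.Quotient.mk (pIdeal p (OGLhat p ι))) := by
      apply hat_hom_ext p (CharP.cast_eq_zero _ p)
      apply IsLocalization.ringHom_ext (Submonoid.powers (Matrix.mvPolynomialX ι ι (ZpUr p)).det)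
      apply MvPolynomial.ringHom_ext
      · intro r
        have h1 : algebraMap (OGL p ι) (OGLhat p ι) (algebraMap (MvPolynomial (ι × ι) (ZpUr p))
            (OGL p ι) (MvPolynomial.C r)) = algebraMap (ZpUr p) (OGLhat p ι) r := by
          rw [IsScalarTower.algebraMap_apply (ZpUr p) (OGL p ι) (OGLhat p ι),
            IsScalarTower.algebraMap_apply (ZpUr p) (MvPolynomial (ι × ι) (ZpUr p)) (OGL p ι)]
          rfl
        simp only [RingHom.comp_apply, h1, phiZeroHom, evalHat_algebraMap]
        rw [frobenius_def, ← map_pow, Ideal.Quotient.mk_eq_mk_iff_sub_mem, ← map_pow, ← map_sub,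
          ← pIdeal_map p (algebraMap (ZpUr p) (OGLhat p ι))]
        exact Ideal.mem_map_of_mem _ (frob_sub_pow_mem p r)
      · intro ij
        have h1 : algebraMap (OGL p ι) (OGLhat p ι) (algebraMap (MvPolynomial (ι × ι) (ZpUr p))
            (OGL p ι) (MvPolynomial.X ij)) =
            (genXhat p ι : Matrix ι ι (OGLhat p ι)) ij.1 ij.2 := rfl
        simp only [RingHom.comp_apply, h1, phiZeroHom, evalHat_genXhat]
        rw [frobenius_def, ← map_pow]
        rfl
    intro f
    rw [← Ideal.Quotient.mk_eq_mk_iff_sub_mem, map_pow]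
    exact RingHom.congr_fun key f

/-- A closed subscheme of `G`, given by an ideal `I` of `O(G)`, is `φ_G`-horizontal if `φ_G` maps
the ideal generated by `I` in `O(Ĝ)` into itself. -/
def Horizontal (φ : FrobLift p ι) (I : Ideal (OGL p ι)) : Prop :=
  I.map (algebraMap (OGL p ι) (OGLhat p ι)) ≤
    (I.map (algebraMap (OGL p ι) (OGLhat p ι))).comap φ.toHom

/-- The ring of functions `O(Ĥ)` for the closed subscheme `H` of `G` with ideal `I`. -/
abbrev OSubHat (I : Ideal (OGL p ι)) : Type :=
  OGLhat p ι ⧸ I.map (algebraMap (OGL p ι) (OGLhat p ι))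

/-- The lift of Frobenius `φ_H` on `Ĥ` induced by `φ_G`, for a horizontal `H`. -/
def inducedHom (φ : FrobLift p ι) (I : Ideal (OGL p ι)) (h : Horizontal p φ I) :
    OSubHat p I →+* OSubHat p I :=
  Ideal.quotientMap _ φ.toHom h

/-! ### Products of `p`-adic formal schemes, compatibility with subgroups -/

/-- The ring of functions on the product over `R` of two affine `p`-adic formal schemes: the
completed tensor product. -/
abbrev CTensor (B C : Type) [CommRing B] [CommRing C] [Algebra (ZpUr p) B] [Algebra (ZpUr p) C] :
    Type :=
  Hat p (B ⊗[ZpUr p] C)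

section Products

variable (B C : Type) [CommRing B] [CommRing C] [Algebra (ZpUr p) B] [Algebra (ZpUr p) C]

/-- Pullback of functions along the first projection. -/
def inFst : B →+* CTensor p B C :=
  (algebraMap (B ⊗[ZpUr p] C) (CTensor p B C)).comp Algebra.TensorProduct.includeLeftRingHom

/-- Pullback of functions along the second projection. -/
def inSnd : C →+* CTensor p B C :=
  (algebraMap (B ⊗[ZpUr p] C) (CTensor p B C)).comp
    (Algebra.TensorProduct.includeRight : C →ₐ[ZpUr p] B ⊗[ZpUr p] C).toRingHom

end Products

/-- Pullback of functions along the multiplication `Ĥ × Ĝ → Ĝ`. -/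
def mulLeftPull (I : Ideal (OGL p ι)) : OGLhat p ι →+* CTensor p (OSubHat p I) (OGLhat p ι) :=
  evalHat p (algebraMap (ZpUr p) _)
    (Matrix.GeneralLinearGroup.map
        ((inFst p (OSubHat p I) (OGLhat p ι)).comp (Ideal.Quotient.mk _)) (genXhat p ι) *
      Matrix.GeneralLinearGroup.map (inSnd p (OSubHat p I) (OGLhat p ι)) (genXhat p ι))

/-- Pullback of functions along the multiplication `Ĝ × Ĥ → Ĝ`. -/
def mulRightPull (I : Ideal (OGL p ι)) : OGLhat p ι →+* CTensor p (OGLhat p ι) (OSubHat p I) :=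
  evalHat p (algebraMap (ZpUr p) _)
    (Matrix.GeneralLinearGroup.map (inFst p (OGLhat p ι) (OSubHat p I)) (genXhat p ι) *
      Matrix.GeneralLinearGroup.map
        ((inSnd p (OGLhat p ι) (OSubHat p I)).comp (Ideal.Quotient.mk _)) (genXhat p ι))

/-- `φ_G` is left compatible with `H`: `H` is horizontal and multiplication `Ĥ × Ĝ → Ĝ` intertwines
`φ_H × φ_G` and `φ_G`. The ring homomorphism `F` is the pullback along `φ_H × φ_G`, which is
determined by its compatibility with the projections. -/
def LeftCompatible (φ : FrobLift p ι) (I : Ideal (OGL p ι)) : Prop :=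
  ∃ h : Horizontal p φ I,
    ∃ F : CTensor p (OSubHat p I) (OGLhat p ι) →+* CTensor p (OSubHat p I) (OGLhat p ι),
      F.comp (inFst p _ _) = (inFst p _ _).comp (inducedHom p φ I h) ∧
      F.comp (inSnd p _ _) = (inSnd p _ _).comp φ.toHom ∧
      F.comp (mulLeftPull p I) = (mulLeftPull p I).comp φ.toHom

/-- `φ_G` is right compatible with `H`: `H` is horizontal and multiplication `Ĝ × Ĥ → Ĝ`
intertwines `φ_G × φ_H` and `φ_G`. -/
def RightCompatible (φ : FrobLift p ι) (I : Ideal (OGL p ι)) : Prop :=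
  ∃ h : Horizontal p φ I,
    ∃ F : CTensor p (OGLhat p ι) (OSubHat p I) →+* CTensor p (OGLhat p ι) (OSubHat p I),
      F.comp (inFst p _ _) = (inFst p _ _).comp φ.toHom ∧
      F.comp (inSnd p _ _) = (inSnd p _ _).comp (inducedHom p φ I h) ∧
      F.comp (mulRightPull p I) = (mulRightPull p I).comp φ.toHom

/-! ### The arithmetic logarithmic derivative -/

/-- `φ(a)`: the Frobenius of `R` applied to the entries of `a`. -/
def frobGL (a : GL ι (ZpUr p)) : GL ι (ZpUr p) := Matrix.GeneralLinearGroup.map (frob p) a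

/-- `Φ(a)`: the value at `a ∈ GL_ι(R)` of the matrix `Φ(x) = φ_G(x)`. -/
def PhiAt (φ : FrobLift p ι) (a : GL ι (ZpUr p)) : GL ι (ZpUr p) :=
  Matrix.GeneralLinearGroup.map ((evalHat p (RingHom.id (ZpUr p)) a).comp φ.toHom) (genXhat p ι)

theorem exists_logDeriv (φ : FrobLift p ι) (a : GL ι (ZpUr p)) :
    ∃ α : Matrix ι ι (ZpUr p),
      (p : ZpUr p) • α = ((frobGL p a * (PhiAt p φ a)⁻¹ : GL ι (ZpUr p)) : Matrix ι ι (ZpUr p)) - 1 := by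
  have h : ∀ i j, ∃ c, (p : ZpUr p) * c = (frobGL p a : Matrix ι ι (ZpUr p)) i j -
      (PhiAt p φ a : Matrix ι ι (ZpUr p)) i j := by
    intro i j
    have h1 : (frobGL p a : Matrix ι ι (ZpUr p)) i j - (a : Matrix ι ι (ZpUr p)) i j ^ p ∈
        pIdeal p (ZpUr p) := frob_sub_pow_mem p _
    have h2 : (PhiAt p φ a : Matrix ι ι (ZpUr p)) i j - (a : Matrix ι ι (ZpUr p)) i j ^ p ∈
        pIdeal p (ZpUr p) := by
      have := Ideal.mem_map_of_mem (evalHat p (RingHom.id (ZpUr p)) a)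
        (φ.lift ((genXhat p ι : Matrix ι ι (OGLhat p ι)) i j))
      rw [pIdeal_map, map_sub, map_pow, evalHat_genXhat] at this
      exact this
    obtain ⟨c, hc⟩ := Ideal.mem_span_singleton.mp (sub_mem h1 h2)
    exact ⟨c, by rw [← hc]; ring⟩
  choose c hc using h
  refine ⟨Matrix.of c * ((PhiAt p φ a)⁻¹ : GL ι (ZpUr p)), ?_⟩
  have h3 : (p : ZpUr p) • Matrix.of c =
      (frobGL p a : Matrix ι ι (ZpUr p)) - (PhiAt p φ a : Matrix ι ι (ZpUr p)) := by
    refine Matrix.ext fun i j => ?_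
    simpa using hc i j
  rw [← Matrix.smul_mul, h3, sub_mul, Units.val_mul, Units.mul_inv]

/-- The arithmetic logarithmic derivative `lδ a = p⁻¹ (φ(a) Φ(a)⁻¹ - 1)` (the quotient by `p` exists
by `exists_logDeriv`, and is unique since `R` has no `p`-torsion). -/
def logDeriv (φ : FrobLift p ι) (a : GL ι (ZpUr p)) : Matrix ι ι (ZpUr p) :=
  (exists_logDeriv p φ a).choose

/-- The group law `a +_δ b = a + b + p a b` on `gl_ι(R)`. -/
def addDelta (a b : Matrix ι ι (ZpUr p)) : Matrix ι ι (ZpUr p) := a + b + (p : ZpUr p) • (a * b)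

/-- The `δ`-adjoint action `a ⋆_δ b = φ(a) b φ(a)⁻¹`. -/
def starDelta (a : GL ι (ZpUr p)) (b : Matrix ι ι (ZpUr p)) : Matrix ι ι (ZpUr p) :=
  (frobGL p a : Matrix ι ι (ZpUr p)) * b * ((frobGL p a)⁻¹ : GL ι (ZpUr p))

/-! ### The torus and the Weyl group of `GL_ι` -/

variable (ι) in
/-- The ideal of the torus `T` of diagonal matrices. -/
def torusIdeal : Ideal (OGL p ι) :=
  Ideal.span {f | ∃ i j, i ≠ j ∧ f = (genX p ι : Matrix ι ι (OGL p ι)) i j}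

/-- The permutation matrix of `σ`. -/
def permGL (σ : Equiv.Perm ι) : GL ι (ZpUr p) :=
  Matrix.GeneralLinearGroup.mk'' (σ.permMatrix (ZpUr p)) (by
    rw [Matrix.det_permutation]
    exact (Units.map (Int.castRingHom (ZpUr p)).toMonoidHom (Equiv.Perm.sign σ)).isUnit)

variable (ι) in
/-- The ideal of the (finite constant) subgroup scheme `W` of permutation matrices: the functions
vanishing at all permutation matrices. -/
def weylIdeal : Ideal (OGL p ι) :=
  ⨅ σ : Equiv.Perm ι, RingHom.ker (evalGL p (RingHom.id (ZpUr p)) (permGL p σ))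

end GLn
/-! ### The split classical groups and their canonical quadratic maps -/

/-- The split classical groups `GL_n`, `SO_{2r}`, `SO_{2r+1}`, `Sp_{2r}`, together with the index set
of the rows and columns of their matrices. -/
inductive ClassicalGroup : Type → Type
  | gl (n : ℕ) : ClassicalGroup (Fin n)
  | soEven (r : ℕ) : ClassicalGroup (Fin r ⊕ Fin r)
  | soOdd (r : ℕ) : ClassicalGroup (Unit ⊕ (Fin r ⊕ Fin r))
  | sp (r : ℕ) : ClassicalGroup (Fin r ⊕ Fin r)

namespace ClassicalGroup

/-- `S` is `SO_n` with `n` odd. -/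
def IsOddOrthogonal {ι : Type} : ClassicalGroup ι → Prop
  | soOdd _ => True
  | _ => False

/-- `S` is `GL_n`. -/
def isGL {ι : Type} : ClassicalGroup ι → Bool
  | gl _ => true
  | _ => false

/-- The matrix `q`, with integer entries. -/
def qMatrix {ι : Type} [DecidableEq ι] : ClassicalGroup ι → Matrix ι ι ℤ
  | gl _ => 1
  | soEven _ => Matrix.fromBlocks 0 1 1 0
  | soOdd _ => Matrix.fromBlocks 1 0 0 (Matrix.fromBlocks 0 1 1 0)
  | sp _ => Matrix.fromBlocks 0 1 (-1) 0

theorem qMatrix_mul_transpose {ι : Type} [hf : Fintype ι] [hd : DecidableEq ι]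
    (S : ClassicalGroup ι) : S.qMatrix * S.qMatrixᵀ = 1 := by
  cases S with
  | gl n =>
    obtain rfl : hf = Fin.fintype n := Subsingleton.elim _ _
    obtain rfl : hd = instDecidableEqFin n := Subsingleton.elim _ _
    simp [qMatrix]
  | soEven r =>
    obtain rfl : hf = instFintypeSum _ _ := Subsingleton.elim _ _
    obtain rfl : hd = instDecidableEqSum := Subsingleton.elim _ _
    simp [qMatrix, Matrix.fromBlocks_transpose, Matrix.fromBlocks_multiply]
  | soOdd r =>
    obtain rfl : hf = instFintypeSum _ _ := Subsingleton.elim _ _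
    obtain rfl : hd = instDecidableEqSum := Subsingleton.elim _ _
    simp [qMatrix, Matrix.fromBlocks_transpose, Matrix.fromBlocks_multiply]
  | sp r =>
    obtain rfl : hf = instFintypeSum _ _ := Subsingleton.elim _ _
    obtain rfl : hd = instDecidableEqSum := Subsingleton.elim _ _
    simp [qMatrix, Matrix.fromBlocks_transpose, Matrix.fromBlocks_multiply]

/-- `q` as an element of `GL_ι(C)`. -/
def q {ι : Type} [Fintype ι] [DecidableEq ι] (S : ClassicalGroup ι) (C : Type) [CommRing C] :
    GL ι C :=
  Matrix.GeneralLinearGroup.map (Int.castRingHom C)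
    ⟨S.qMatrix, S.qMatrixᵀ, S.qMatrix_mul_transpose,
      mul_eq_one_comm.mp S.qMatrix_mul_transpose⟩

/-- The transpose of an invertible matrix. -/
def transposeGL {ι : Type} [Fintype ι] [DecidableEq ι] {C : Type} [CommRing C] (g : GL ι C) :
    GL ι C :=
  ⟨(g : Matrix ι ι C)ᵀ, ((g⁻¹ : GL ι C) : Matrix ι ι C)ᵀ,
    by rw [← Matrix.transpose_mul, Units.inv_mul, Matrix.transpose_one],
    by rw [← Matrix.transpose_mul, Units.mul_inv, Matrix.transpose_one]⟩

/-- The involution `x ↦ x†`: the inverse for `GL_n`, the transpose for the other groups. -/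
def dagger {ι : Type} [Fintype ι] [DecidableEq ι] (S : ClassicalGroup ι) {C : Type} [CommRing C]
    (g : GL ι C) : GL ι C :=
  if S.isGL then g⁻¹ else transposeGL g

section Quadratic

variable {ι : Type} [Fintype ι] [DecidableEq ι] (S : ClassicalGroup ι)

/-- The canonical quadratic map `ℋ(x) = x† q x`, on `C`-points. -/
def quad {C : Type} [CommRing C] (g : GL ι C) : GL ι C := S.dagger g * S.q C * g

/-- The map `ℋ₂(x, y) = ℋ(x) x⁻¹ y`, on `C`-points. -/
def quadTwo {C : Type} [CommRing C] (g h : GL ι C) : GL ι C := S.quad g * g⁻¹ * h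

variable (p : ℕ) [Fact p.Prime]

/-- Pullback of functions along `ℋ : Ĝ → Ĝ`. -/
def quadPull : OGLhat p ι →+* OGLhat p ι :=
  evalHat p (algebraMap (ZpUr p) _) (S.quad (genXhat p ι))

/-- Pullback of functions along `ℋ₂ : Ĝ × Ĝ → Ĝ`. -/
def quadTwoPull : OGLhat p ι →+* CTensor p (OGLhat p ι) (OGLhat p ι) :=
  evalHat p (algebraMap (ZpUr p) _)
    (S.quadTwo (Matrix.GeneralLinearGroup.map (inFst p (OGLhat p ι) (OGLhat p ι)) (genXhat p ι))
      (Matrix.GeneralLinearGroup.map (inSnd p (OGLhat p ι) (OGLhat p ι)) (genXhat p ι)))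

/-- `ℋ` is horizontal with respect to `φ_G, φ_{G,0}`: `ℋ ∘ φ_G = φ_{G,0} ∘ ℋ` on `Ĝ`. -/
def QuadHorizontal (φ φ₀ : FrobLift p ι) : Prop :=
  φ.toHom.comp (S.quadPull p) = (S.quadPull p).comp φ₀.toHom

/-- `ℋ` is symmetric with respect to `φ_G, φ_{G,0}`: `ℋ₂ ∘ (φ_{G,0}, φ_G) = ℋ₂ ∘ (φ_G, φ_{G,0})`
as morphisms `Ĝ → Ĝ`. The ring homomorphisms `F`, `F'` are the pullbacks along the morphisms
`(φ_{G,0}, φ_G), (φ_G, φ_{G,0}) : Ĝ → Ĝ × Ĝ`, determined by their components. -/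
def QuadSymmetric (φ φ₀ : FrobLift p ι) : Prop :=
  ∃ F F' : CTensor p (OGLhat p ι) (OGLhat p ι) →+* OGLhat p ι,
    F.comp (inFst p _ _) = φ₀.toHom ∧ F.comp (inSnd p _ _) = φ.toHom ∧
    F'.comp (inFst p _ _) = φ.toHom ∧ F'.comp (inSnd p _ _) = φ₀.toHom ∧
    F.comp (S.quadTwoPull p) = F'.comp (S.quadTwoPull p)

/-! ### The group defined by `ℋ`, its torus, roots and root groups -/

/-- The ideal of `ℋ⁻¹(q)`. -/
def fibreIdeal : Ideal (OGL p ι) :=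
  Ideal.span {f | ∃ i j, f = (S.quad (genX p ι) : Matrix ι ι (OGL p ι)) i j -
    (S.q (OGL p ι) : Matrix ι ι (OGL p ι)) i j}

variable (ι) in
/-- The generic point of the identity section of `G`. -/
def identityPoint : PrimeSpectrum (OGL p ι) :=
  PrimeSpectrum.comap (evalGL p (RingHom.id (ZpUr p)) (1 : GL ι (ZpUr p)))
    ⟨⊥, Ideal.isPrime_bot⟩

/-- The ideal of the group `S = ℋ⁻¹(q)°`: the connected component of `ℋ⁻¹(q)` that contains the
identity, with its reduced structure (for `p` odd, `ℋ⁻¹(q)` is smooth over `R`, hence reduced). -/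
def groupIdeal : Ideal (OGL p ι) :=
  PrimeSpectrum.vanishingIdeal
    (connectedComponentIn (PrimeSpectrum.zeroLocus (S.fibreIdeal p : Set (OGL p ι)))
      (identityPoint ι p))

/-- The ideal of `T_S = T ∩ S`. -/
def torusS : Ideal (OGL p ι) := torusIdeal p ι ⊔ S.groupIdeal p

/-- The ideal of `W_S = W ∩ S`. -/
def weylS : Ideal (OGL p ι) := weylIdeal p ι ⊔ S.groupIdeal p

/-- The diagonal matrix with entries `d`. -/
def diagGL {C : Type} [CommRing C] (d : ι → Cˣ) : GL ι C :=
  ⟨Matrix.diagonal fun i => (d i : C), Matrix.diagonal fun i => ((d i)⁻¹ : Cˣ),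
    by simp [Matrix.diagonal_mul_diagonal], by simp [Matrix.diagonal_mul_diagonal]⟩

end Quadratic

/-- The positions `i` for which the diagonal entries `t_i` form a basis of the characters of `T_S`:
all of them for `GL_n`, those of the first block of size `r` for the other groups. -/
def IsCoord {ι : Type} (S : ClassicalGroup ι) : ι → Prop :=
  match S with
  | gl _ => fun _ => True
  | soEven _ => fun i => i.isLeft = true
  | soOdd _ => fun i => ∃ k, i = Sum.inr (Sum.inl k)
  | sp _ => fun i => i.isLeft = true

section Roots

variable {ι : Type} [Fintype ι] [DecidableEq ι] (S : ClassicalGroup ι) (p : ℕ) [Fact p.Prime]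

/-- The characters of `T_S`, written in the basis above: `χ` is the character
`t ↦ ∏ t_i ^ χ_i`. -/
def IsCharacter (χ : ι → ℤ) : Prop := ∀ i, ¬ S.IsCoord i → χ i = 0

/-- The value `χ(t)` at the diagonal matrix with entries `d`. -/
def charValue {C : Type} [CommRing C] (χ : ι → ℤ) (d : ι → Cˣ) : Cˣ := ∏ i, d i ^ χ i

/-- The Lie algebra `L(S)`: the matrices `a` over `R` with `1 + ε a ∈ S(R[ε])`. -/
def lieAlg : Set (Matrix ι ι (ZpUr p)) :=
  {a | ∃ g ∈ points p (S.groupIdeal p) (DualNumber (ZpUr p)),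
    (g : Matrix ι ι (DualNumber (ZpUr p))) =
      1 + a.map fun c => (algebraMap (ZpUr p) (DualNumber (ZpUr p)) c) * DualNumber.eps}

/-- `χ` is a root of `S` (with respect to `T_S`): a non-zero character occurring in the adjoint
action of `T_S` on `L(S)`. -/
def IsRoot (χ : ι → ℤ) : Prop :=
  S.IsCharacter χ ∧ χ ≠ 0 ∧ ∃ a ∈ S.lieAlg p, a ≠ 0 ∧
    ∀ (C : Type) [CommRing C] [Algebra (ZpUr p) C] (d : ι → Cˣ),
      diagGL d ∈ points p (S.torusS p) C →
      (diagGL d : Matrix ι ι C) * a.map (algebraMap (ZpUr p) C) *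
        ((diagGL d)⁻¹ : GL ι C) = (charValue χ d : C) • a.map (algebraMap (ZpUr p) C)

/-- `χ` is a shortest root of `S`, for the Weyl invariant inner product for which the basis above is
orthonormal. -/
def IsShortestRoot (χ : ι → ℤ) : Prop :=
  S.IsRoot p χ ∧ ∀ χ', S.IsRoot p χ' → ∑ i, χ i ^ 2 ≤ ∑ i, χ' i ^ 2

/-- The value at `c ∈ C` of a matrix over `R[s]`. -/
def evalParam {C : Type} [CommRing C] [Algebra (ZpUr p) C] (u : GL ι (ZpUr p)[X]) (c : C) :
    GL ι C :=
  Matrix.GeneralLinearGroup.map (Polynomial.aeval c : (ZpUr p)[X] →ₐ[ZpUr p] C).toRingHom u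

/-- `U` is the ideal of the root group `U_χ`: there is a closed immersion `u : 𝔾_a → G` with image
`U_χ` which factors through `S`, is a homomorphism, and satisfies `t u(c) t⁻¹ = u(χ(t) c)` for
`t` in `T_S`. -/
def IsRootGroup (χ : ι → ℤ) (U : Ideal (OGL p ι)) : Prop :=
  ∃ u : GL ι (ZpUr p)[X],
    Function.Surjective (evalGL p (algebraMap (ZpUr p) (ZpUr p)[X]) u) ∧
    RingHom.ker (evalGL p (algebraMap (ZpUr p) (ZpUr p)[X]) u) = U ∧
    u ∈ points p (S.groupIdeal p) (ZpUr p)[X] ∧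
    (∀ (C : Type) [CommRing C] [Algebra (ZpUr p) C] (b c : C),
      evalParam p u (b + c) = evalParam p u b * evalParam p u c) ∧
    ∀ (C : Type) [CommRing C] [Algebra (ZpUr p) C] (d : ι → Cˣ) (c : C),
      diagGL d ∈ points p (S.torusS p) C →
      diagGL d * evalParam p u c * (diagGL d)⁻¹ = evalParam p u ((charValue χ d : C) * c)

end Roots

end ClassicalGroup

end
end DeltaFlow

namespace DeltaFlow

noncomputable section

set_option linter.unusedSectionVars false

/-! ### Ring homomorphisms out of `p`-adic completions and out of `R` -/

/-! Everything reduces to one equation at one point. For a point `g` of `GL` over a `p`-adically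
complete ring, the conditions on the value `Y = Φ(g)` are collected in `IsPhi`: `Y ≡ g^{(p)}` mod
`p`, `ℋ(Y) = ℋ(g)^{(p)}`, and symmetry. Put `Y = g^{(p)} L`, `A = ℋ(g^{(p)})`, `B = ℋ(g)^{(p)}`.
Symmetry forces `ℋ(Y) = A L²`, so `L` is a square root of `A⁻¹B` congruent to `1` mod `p`. As `A ≡
B` mod `p` and `2` is invertible, there is exactly one such root (`matrix_sqrt_exists`,
`matrix_sqrt_unique`). Conversely it gives back symmetry: outside `GL_n`, `A` and `B` are both
symmetric or both antisymmetric, so `A⁻¹LᵗA` is a root of the same kind and equals `L`. For `GL_n`,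
`L = 1`. At the generic matrix this is assertion 1.

The rest exploits uniqueness (`IsPhi.unique`) and naturality (`IsPhi.map`): to compute `Φ` at a
point it is enough to exhibit a solution. If distinct entries in each column of `m` have product
zero, then `(gm)^{(p)} = g^{(p)} m^{(p)}` and `Φ(g) m^{(p)}` solves the equations at `gm`; on the
left one needs the same for rows, and `ℋ(m) = q`. This gives the compatibilities of assertion 2, and
the cocycle rule is the identity `Φ(ab) = Φ(a)Φ(b)` rewritten.

Horizontality rests on `horizontal_of_evalGL`: `Φ` at a point with values in a ring `B` must come
from a `φ`-semilinear map out of `B`, and the ideal must be saturated with respect to powers of `p`.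
For tori the map raises characters to the `p`-th power; for Weyl groups it is induced by `φ` on a
product of quotients of `R`; for a root group it is `s ↦ v s^p`. In the last case weights show that
the parametrization is `1 + sN` with entries of `N` among `0, c, -c`, so its entrywise `p`-th power
is a reparametrization, stays in `ℋ⁻¹(q)`, and is therefore the value of `Φ`. A term in `s^k` with
`k ≥ 2` would have weight `kχ`, too long to be a difference of two weights; the short roots of odd
orthogonal groups escape this bound. -/

theorem exists_sub_algebraMap_mem (p : ℕ) {A : Type*} [CommRing A] (x : Hat p A) (n : ℕ) :
    ∃ a : A, x - algebraMap A (Hat p A) a ∈ pIdeal p (Hat p A) ^ n := by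
  induction n generalizing x with
  | zero => exact ⟨0, by simp⟩
  | succ n ih =>
    obtain ⟨a, ha⟩ := Ideal.Quotient.mk_surjective (AdicCompletion.evalOneₐ (pIdeal p A) x)
    have hx : x - algebraMap A (Hat p A) a ∈ pIdeal p (Hat p A) := by
      rw [← pIdeal_map p (algebraMap A (Hat p A)),
        ← AdicCompletion.ker_evalOneₐ_eq_map (pIdeal p A) ⟨{(p : A)}, by simp⟩]
      change AdicCompletion.evalOneₐ (pIdeal p A) (x - algebraMap A (Hat p A) a) = 0
      rw [map_sub, ← ha, sub_eq_zero]
      rfl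
    obtain ⟨y, hy⟩ := Ideal.mem_span_singleton'.mp hx
    obtain ⟨b, hb⟩ := ih y
    refine ⟨a + p * b, ?_⟩
    have : x - algebraMap A (Hat p A) (a + p * b) = (y - algebraMap A (Hat p A) b) * p := by
      rw [map_add, map_mul, map_natCast, ← sub_sub, ← hy]
      ring
    rw [this, pow_succ]
    exact Ideal.mul_mem_mul hb (Ideal.mem_span_singleton_self _)

theorem eq_zero_of_forall_mem_pow (p : ℕ) {C : Type*} [CommRing C] [IsHausdorff (pIdeal p C) C]
    {c : C} (h : ∀ n, c ∈ pIdeal p C ^ n) : c = 0 :=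
  IsHausdorff.haus (I := pIdeal p C) inferInstance _ fun n => by
    rw [SModEq.zero, smul_eq_mul, Ideal.mul_top]
    exact h n

/-- Ring homomorphisms out of `Â` into a `p`-adically separated ring agree if they agree on `A`. -/
theorem hat_ringHom_ext (p : ℕ) {A C : Type*} [CommRing A] [CommRing C]
    [IsHausdorff (pIdeal p C) C] {f g : Hat p A →+* C}
    (h : f.comp (algebraMap A (Hat p A)) = g.comp (algebraMap A (Hat p A))) : f = g := by
  ext x
  rw [← sub_eq_zero]
  refine eq_zero_of_forall_mem_pow p fun n => ?_
  obtain ⟨a, ha⟩ := exists_sub_algebraMap_mem p x n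
  have h1 := RingHom.congr_fun h a
  simp only [RingHom.comp_apply] at h1
  have : f x - g x = f (x - algebraMap A (Hat p A) a) - g (x - algebraMap A (Hat p A) a) := by
    rw [map_sub, map_sub, h1]
    ring
  rw [this]
  exact sub_mem (pIdeal_pow_le_comap p f n ha) (pIdeal_pow_le_comap p g n ha)

/-- The projection `Â → A/pⁿ` kills `pⁿÂ`, so divisibility by `pⁿ` descends from the completion. -/
theorem mem_pIdeal_pow_of_algebraMap_mem (p : ℕ) {A : Type*} [CommRing A] {a : A} {n : ℕ}
    (h : algebraMap A (Hat p A) a ∈ pIdeal p (Hat p A) ^ n) : a ∈ pIdeal p A ^ n := by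
  have h1 := pIdeal_pow_le_comap p
    (AdicCompletion.evalₐ (pIdeal p A) n : Hat p A →+* A ⧸ pIdeal p A ^ n) n h
  have h2 : pIdeal p (A ⧸ pIdeal p A ^ n) ^ n = ⊥ := by
    rw [← pIdeal_map p (Ideal.Quotient.mk (pIdeal p A ^ n)), ← Ideal.map_pow,
      Ideal.map_quotient_self]
  rw [h2, Ideal.mem_comap, Ideal.mem_bot] at h1
  rw [← Ideal.Quotient.eq_zero_iff_mem, ← h1]
  simp

/-- Over a Noetherian ring, extended ideals of the `p`-adic completion are closed. -/
theorem mem_map_of_forall_exists (p : ℕ) {A : Type} [CommRing A] [IsNoetherianRing A]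
    {I : Ideal A} {h : Hat p A}
    (H : ∀ n, ∃ a ∈ I, h - algebraMap A (Hat p A) a ∈ pIdeal p (Hat p A) ^ n) :
    h ∈ I.map (algebraMap A (Hat p A)) := by
  -- Completion is exact on `0 → I → A → A/I`, so it suffices that `h` dies in the completion of
  -- `A/I`. It then comes from the completion of `I`, which is spanned by `I` over `Â` because `I`
  -- is finite.
  have hex := AdicCompletion.map_exact (I := pIdeal p A) (f := I.subtype) (g := I.mkQ)
    I.injective_subtype (LinearMap.exact_subtype_mkQ I) I.mkQ_surjective
  have h0 : AdicCompletion.map (pIdeal p A) I.mkQ h = 0 := by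
    refine AdicCompletion.ext fun n => ?_
    obtain ⟨a, ha, hn⟩ := H n
    have h1 : h - AdicCompletion.of (pIdeal p A) A a ∈
        (AdicCompletion.eval (pIdeal p A) A n).ker := by
      refine AdicCompletion.pow_smul_top_le_ker_eval (I := pIdeal p A) (M := A) n ?_
      rw [← pIdeal_map p (algebraMap A (Hat p A)), ← Ideal.map_pow,
        ← Submodule.restrictScalars_mem A, ← Ideal.smul_top_eq_map] at hn
      exact hn
    have h2 : h.val n = (AdicCompletion.of (pIdeal p A) A a).val n := by
      rw [← sub_eq_zero]; exact h1
    rw [AdicCompletion.map_val_apply, h2, ← AdicCompletion.map_val_apply, AdicCompletion.map_of]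
    rw [show I.mkQ a = 0 from (Submodule.Quotient.mk_eq_zero I).mpr ha, map_zero]
  obtain ⟨y, rfl⟩ := (hex h).mp h0
  obtain ⟨z, rfl⟩ := AdicCompletion.ofTensorProduct_surjective_of_finite (pIdeal p A) I y
  clear H h0
  induction z with
  | zero => simp
  | add z w hz hw =>
    rw [map_add, map_add]
    exact add_mem hz hw
  | tmul r i =>
    rw [AdicCompletion.ofTensorProduct_tmul, map_smul, AdicCompletion.map_of]
    exact Ideal.mul_mem_left _ _ (Ideal.mem_map_of_mem _ i.2)


/-- Two ring homomorphisms out of `R` into a `p`-adically separated ring agree if they agree modulo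
`p`. -/
theorem zpUr_ringHom_ext (p : ℕ) [Fact p.Prime] {C : Type*} [CommRing C]
    [IsHausdorff (pIdeal p C) C] {f g : ZpUr p →+* C}
    (h : ∀ r, f r - g r ∈ pIdeal p C) : f = g := by
  -- The residue field is perfect, so a Teichmüller element is a `pⁿ`-th power of another, and
  -- taking `pⁿ`-th powers improves a congruence mod `p` to one mod `pⁿ⁺¹`. Maps into a ring where
  -- `p` is nilpotent are determined on Teichmüller elements.
  have hT : ∀ x n, f (WittVector.teichmuller p x) - g (WittVector.teichmuller p x) ∈
      pIdeal p C ^ n := by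
    intro x n
    obtain ⟨y, rfl⟩ := (iterateFrobeniusEquiv (AlgebraicClosure (ZMod p)) p n).surjective x
    rw [iterateFrobeniusEquiv_def, map_pow, map_pow, map_pow, pIdeal, Ideal.span_singleton_pow,
      Ideal.mem_span_singleton]
    refine (pow_dvd_pow _ (Nat.le_succ n)).trans (dvd_sub_pow_of_dvd_sub ?_ n)
    exact Ideal.mem_span_singleton.mp (h _)
  ext x
  rw [← sub_eq_zero]
  refine eq_zero_of_forall_mem_pow p fun n => ?_
  rw [← Ideal.Quotient.mk_eq_mk_iff_sub_mem]
  refine RingHom.congr_fun (WittVector.eq_of_apply_teichmuller_eq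
    ((Ideal.Quotient.mk (pIdeal p C ^ n)).comp f) ((Ideal.Quotient.mk (pIdeal p C ^ n)).comp g)
    ⟨n, ?_⟩ fun x => ?_) x
  · rw [← map_natCast (Ideal.Quotient.mk (pIdeal p C ^ n)), ← map_pow,
      Ideal.Quotient.eq_zero_iff_mem]
    exact Ideal.pow_mem_pow (Ideal.mem_span_singleton_self _) n
  · exact (Ideal.Quotient.mk_eq_mk_iff_sub_mem _ _).mpr (hT x n)

/-- The elements `r` and `φ(r)` of the discrete valuation ring `R` are associated. -/
theorem associated_frob (p : ℕ) [Fact p.Prime] (r : ZpUr p) : Associated r (frob p r) := by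
  rcases eq_or_ne r 0 with rfl | hr
  · simp
  · obtain ⟨m, u, rfl⟩ := WittVector.exists_eq_pow_p_mul' r hr
    rw [map_mul, map_pow, map_natCast]
    refine Associated.mul_left _ ?_
    exact (associated_one_iff_isUnit.mpr u.isUnit).trans
      (associated_one_iff_isUnit.mpr (u.isUnit.map (frob p))).symm

/-! ### Homomorphisms out of `O(Ĝ)`; lifts of Frobenius as matrices -/

variable {p : ℕ} [Fact p.Prime] {ι : Type} [Fintype ι] [DecidableEq ι]

theorem genX_map_algebraMap :
    Matrix.GeneralLinearGroup.map (algebraMap (OGL p ι) (OGLhat p ι)) (genX p ι) = genXhat p ι :=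
  rfl

theorem oGL_ringHom_ext {C : Type*} [CommRing C] {f g : OGL p ι →+* C}
    (hR : f.comp (algebraMap (ZpUr p) (OGL p ι)) = g.comp (algebraMap (ZpUr p) (OGL p ι)))
    (hx : Matrix.GeneralLinearGroup.map f (genX p ι) =
      Matrix.GeneralLinearGroup.map g (genX p ι)) : f = g := by
  apply IsLocalization.ringHom_ext (Submonoid.powers (Matrix.mvPolynomialX ι ι (ZpUr p)).det)
  apply MvPolynomial.ringHom_ext
  · intro r
    exact RingHom.congr_fun hR r
  · intro ij
    exact congrArg (fun g : GL ι C => (g : Matrix ι ι C) ij.1 ij.2) hx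

theorem oGLhat_ringHom_ext {C : Type*} [CommRing C] [IsHausdorff (pIdeal p C) C]
    {f g : OGLhat p ι →+* C}
    (hR : f.comp (algebraMap (ZpUr p) (OGLhat p ι)) = g.comp (algebraMap (ZpUr p) (OGLhat p ι)))
    (hx : Matrix.GeneralLinearGroup.map f (genXhat p ι) =
      Matrix.GeneralLinearGroup.map g (genXhat p ι)) : f = g :=
  hat_ringHom_ext p (oGL_ringHom_ext hR hx)

theorem map_evalGL_genX {C : Type*} [CommRing C] (h : ZpUr p →+* C) (g : GL ι C) :
    Matrix.GeneralLinearGroup.map (evalGL p h g) (genX p ι) = g :=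
  Units.ext (Matrix.ext fun i j => evalGL_genX p h g i j)

theorem map_evalHat_genXhat {C : Type*} [CommRing C] [IsAdicComplete (pIdeal p C) C]
    (h : ZpUr p →+* C) (g : GL ι C) :
    Matrix.GeneralLinearGroup.map (evalHat p h g) (genXhat p ι) = g :=
  Units.ext (Matrix.ext fun i j => evalHat_genXhat p h g i j)

theorem evalGL_comp_algebraMap {C : Type*} [CommRing C] (h : ZpUr p →+* C) (g : GL ι C) :
    (evalGL p h g).comp (algebraMap (ZpUr p) (OGL p ι)) = h :=
  RingHom.ext fun r => evalGL_algebraMap p h g r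

theorem evalHat_comp_algebraMap {C : Type*} [CommRing C] [IsAdicComplete (pIdeal p C) C]
    (h : ZpUr p →+* C) (g : GL ι C) :
    (evalHat p h g).comp (algebraMap (ZpUr p) (OGLhat p ι)) = h :=
  RingHom.ext fun r => evalHat_algebraMap p h g r

theorem evalHat_comp {C : Type*} [CommRing C] [IsAdicComplete (pIdeal p C) C]
    (h : ZpUr p →+* C) (g : GL ι C) :
    (evalHat p h g).comp (algebraMap (OGL p ι) (OGLhat p ι)) = evalGL p h g :=
  RingHom.ext fun a => extendHat_algebraMap p _ a

theorem glMap_comp {A B C : Type*} [CommRing A] [CommRing B] [CommRing C] (f : A →+* B)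
    (g : B →+* C) (x : GL ι A) :
    Matrix.GeneralLinearGroup.map (g.comp f) x =
      Matrix.GeneralLinearGroup.map g (Matrix.GeneralLinearGroup.map f x) := rfl

/-- A lift of Frobenius on `Ĝ` restricts to `φ` on `R`. -/
theorem FrobLift.comp_algebraMap (φ : FrobLift p ι) :
    φ.toHom.comp (algebraMap (ZpUr p) (OGLhat p ι)) =
      (algebraMap (ZpUr p) (OGLhat p ι)).comp (frob p) := by
  refine zpUr_ringHom_ext p fun r => ?_
  have h1 := φ.lift (algebraMap (ZpUr p) (OGLhat p ι) r)
  have h2 := Ideal.mem_map_of_mem (algebraMap (ZpUr p) (OGLhat p ι)) (frob_sub_pow_mem p r)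
  rw [pIdeal_map, map_sub, map_pow] at h2
  simpa using sub_mem h1 h2

/-- The matrix `Φ(x) = φ_G(x)`. -/
def FrobLift.mat (φ : FrobLift p ι) : GL ι (OGLhat p ι) :=
  Matrix.GeneralLinearGroup.map φ.toHom (genXhat p ι)

/-- The restriction to `R` is forced, so the only freedom in a lift of Frobenius is its matrix. -/
theorem FrobLift.toHom_eq (φ : FrobLift p ι) :
    φ.toHom = evalHat p ((algebraMap (ZpUr p) (OGLhat p ι)).comp (frob p)) φ.mat := by
  apply oGLhat_ringHom_ext
  · rw [evalHat_comp_algebraMap, φ.comp_algebraMap]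
  · rw [map_evalHat_genXhat]
    rfl

theorem FrobLift.ext_mat {φ ψ : FrobLift p ι} (h : φ.mat = ψ.mat) : φ = ψ := by
  have : φ.toHom = ψ.toHom := by rw [φ.toHom_eq, ψ.toHom_eq, h]
  cases φ
  cases ψ
  congr

theorem phiZero_mat : (phiZero p ι).mat = powP p (genXhat p ι) :=
  map_evalHat_genXhat _ _

/-- The lift of Frobenius with a prescribed matrix `Φ(x)`. -/
def FrobLift.ofMat (Y : GL ι (OGLhat p ι))
    (hY : ∀ i j, (Y : Matrix ι ι (OGLhat p ι)) i j -
      (powP p (genXhat p ι) : Matrix ι ι (OGLhat p ι)) i j ∈ pIdeal p (OGLhat p ι)) :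
    FrobLift p ι where
  toHom := evalHat p ((algebraMap (ZpUr p) (OGLhat p ι)).comp (frob p)) Y
  lift := by
    -- Comparing with `φ_{G,0}` mod `p`: the two agree on `R` and on `x`, so the Frobenius
    -- congruence is inherited.
    have key : (Ideal.Quotient.mk (pIdeal p (OGLhat p ι))).comp
        (evalHat p ((algebraMap (ZpUr p) (OGLhat p ι)).comp (frob p)) Y) =
        (Ideal.Quotient.mk (pIdeal p (OGLhat p ι))).comp (phiZero p ι).toHom := by
      apply hat_hom_ext p
      · rw [← map_natCast (Ideal.Quotient.mk (pIdeal p (OGLhat p ι))),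
          Ideal.Quotient.eq_zero_iff_mem]
        exact Ideal.mem_span_singleton_self _
      · apply oGL_ringHom_ext
        · rw [RingHom.comp_assoc, RingHom.comp_assoc, RingHom.comp_assoc, RingHom.comp_assoc,
            ← IsScalarTower.algebraMap_eq, evalHat_comp_algebraMap, FrobLift.comp_algebraMap]
        · rw [glMap_comp, glMap_comp, glMap_comp, glMap_comp, genX_map_algebraMap,
            map_evalHat_genXhat]
          change _ = Matrix.GeneralLinearGroup.map _ (phiZero p ι).mat
          rw [phiZero_mat]
          exact Units.ext (Matrix.ext fun i j =>
            (Ideal.Quotient.mk_eq_mk_iff_sub_mem _ _).mpr (hY i j))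
    intro f
    have h1 := (Ideal.Quotient.mk_eq_mk_iff_sub_mem _ _).mp (RingHom.congr_fun key f)
    simpa using add_mem h1 ((phiZero p ι).lift f)

theorem FrobLift.mat_ofMat (Y : GL ι (OGLhat p ι)) (hY) : (FrobLift.ofMat Y hY).mat = Y :=
  map_evalHat_genXhat _ _

theorem FrobLift.mat_sub_mem (φ : FrobLift p ι) (i j : ι) :
    (φ.mat : Matrix ι ι (OGLhat p ι)) i j - (powP p (genXhat p ι) : Matrix ι ι (OGLhat p ι)) i j ∈
      pIdeal p (OGLhat p ι) :=
  φ.lift ((genXhat p ι : Matrix ι ι (OGLhat p ι)) i j)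

/-! ### Ring homomorphisms out of completed tensor products -/

/-- The maps to be glued are semilinear over the Frobenius of `R`, so `D` carries no prescribed
algebra structure. It gets the one through `f`, for which `h` makes `g` linear as well. -/
theorem exists_tensor_lift {R B C D : Type*} [CommRing R] [CommRing B] [CommRing C] [CommRing D]
    [Algebra R B] [Algebra R C] (f : B →+* D) (g : C →+* D)
    (h : f.comp (algebraMap R B) = g.comp (algebraMap R C)) :
    ∃ F : B ⊗[R] C →+* D, F.comp Algebra.TensorProduct.includeLeftRingHom = f ∧
      F.comp (Algebra.TensorProduct.includeRight : C →ₐ[R] B ⊗[R] C).toRingHom = g := by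
  let _ : Algebra R D := (f.comp (algebraMap R B)).toAlgebra
  let f' : B →ₐ[R] D := { f with commutes' := fun _ => rfl }
  let g' : C →ₐ[R] D := { g with commutes' := fun r => (RingHom.congr_fun h r).symm }
  refine ⟨(Algebra.TensorProduct.productMap f' g').toRingHom, ?_, ?_⟩
  · ext b
    simp [f']
  · ext c
    simp [g']

theorem exists_cTensor_lift {B C D : Type} [CommRing B] [CommRing C] [CommRing D]
    [Algebra (ZpUr p) B] [Algebra (ZpUr p) C] [IsAdicComplete (pIdeal p D) D] (f : B →+* D)
    (g : C →+* D) (h : f.comp (algebraMap (ZpUr p) B) = g.comp (algebraMap (ZpUr p) C)) :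
    ∃ F : CTensor p B C →+* D, F.comp (inFst p B C) = f ∧ F.comp (inSnd p B C) = g := by
  obtain ⟨F, hf, hg⟩ := exists_tensor_lift f g h
  refine ⟨extendHat p F, ?_, ?_⟩
  · rw [← hf, inFst, ← RingHom.comp_assoc]
    congr 1
    exact RingHom.ext fun a => extendHat_algebraMap p _ a
  · rw [← hg, inSnd, ← RingHom.comp_assoc]
    congr 1
    exact RingHom.ext fun a => extendHat_algebraMap p _ a

theorem inFst_comp_algebraMap (B C : Type) [CommRing B] [CommRing C] [Algebra (ZpUr p) B]
    [Algebra (ZpUr p) C] :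
    (inFst p B C).comp (algebraMap (ZpUr p) B) = algebraMap (ZpUr p) (CTensor p B C) := by
  rw [IsScalarTower.algebraMap_eq (ZpUr p) (B ⊗[ZpUr p] C) (CTensor p B C)]
  rfl

theorem inSnd_comp_algebraMap (B C : Type) [CommRing B] [CommRing C] [Algebra (ZpUr p) B]
    [Algebra (ZpUr p) C] :
    (inSnd p B C).comp (algebraMap (ZpUr p) C) = algebraMap (ZpUr p) (CTensor p B C) := by
  rw [IsScalarTower.algebraMap_eq (ZpUr p) (B ⊗[ZpUr p] C) (CTensor p B C), inSnd,
    RingHom.comp_assoc]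
  congr 1
  exact (Algebra.TensorProduct.includeRight : C →ₐ[ZpUr p] B ⊗[ZpUr p] C).comp_algebraMap

/-! ### Square roots of matrices congruent to `1` modulo `p` -/

/-- If `p = 2k + 1`, then `1 - p = -2k` is a unit, because `p` lies in the Jacobson radical. -/
theorem isUnit_two_of_isAdicComplete (hp : p ≠ 2) (C : Type*) [CommRing C]
    [IsAdicComplete (pIdeal p C) C] : IsUnit (2 : C) := by
  obtain ⟨k, hk⟩ := (Fact.out : p.Prime).odd_of_ne_two hp
  have h : (p : C) ∈ Ideal.jacobson (⊥ : Ideal C) :=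
    IsAdicComplete.le_jacobson_bot (pIdeal p C) (Ideal.mem_span_singleton_self _)
  rw [Ideal.mem_jacobson_bot] at h
  have h1 := h (-1)
  have h2 : (p : C) * (-1) + 1 = 2 * (-(k : C)) := by
    have : (p : C) = 2 * k + 1 := by exact_mod_cast congrArg (Nat.cast : ℕ → C) hk
    rw [this]
    ring
  rw [h2] at h1
  exact isUnit_of_mul_isUnit_left h1

theorem entries_mul_mem {C : Type*} [CommRing C] {I J : Ideal C} {M N : Matrix ι ι C}
    (hM : ∀ i j, M i j ∈ I) (hN : ∀ i j, N i j ∈ J) (i j : ι) : (M * N) i j ∈ I * J := by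
  rw [Matrix.mul_apply]
  exact sum_mem fun k _ => Ideal.mul_mem_mul (hM i k) (hN k j)

/-- The contraction estimate: squaring matrices that vanish mod `I` gains a factor `I` in their
difference. It drives both uniqueness and convergence of square roots. -/
theorem entries_sq_sub_sq_mem {C : Type*} [CommRing C] {I J : Ideal C} {a b : Matrix ι ι C}
    (ha : ∀ i j, a i j ∈ I) (hb : ∀ i j, b i j ∈ I) (hab : ∀ i j, (a - b) i j ∈ J) (i j : ι) :
    (a * a - b * b) i j ∈ I * J := by
  have h : a * a - b * b = a * (a - b) + (a - b) * b := by noncomm_ring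
  rw [h, Matrix.add_apply]
  refine add_mem (entries_mul_mem ha hab i j) ?_
  rw [mul_comm]
  exact entries_mul_mem hab hb i j

/-- With `a = 1 + a'` and `b = 1 + b'`, equality of squares reads `2(a' - b') = -(a'² - b'²)`. The
contraction estimate then makes `a' - b'` divisible by every power of `p`. -/
theorem matrix_sqrt_unique {C : Type*} [CommRing C] [IsHausdorff (pIdeal p C) C]
    (h2 : IsUnit (2 : C)) {a b : Matrix ι ι C} (ha : ∀ i j, (a - 1) i j ∈ pIdeal p C)
    (hb : ∀ i j, (b - 1) i j ∈ pIdeal p C) (h : a * a = b * b) : a = b := by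
  have key : ∀ n i j, ((a - 1) - (b - 1)) i j ∈ pIdeal p C ^ n := by
    intro n
    induction n with
    | zero => simp
    | succ n ih =>
      intro i j
      have h1 : (2 : C) • ((a - 1) - (b - 1)) =
          -((a - 1) * (a - 1) - (b - 1) * (b - 1)) + (a * a - b * b) := by
        rw [two_smul]
        noncomm_ring
      rw [h, sub_self, add_zero] at h1
      have h3 := neg_mem (entries_sq_sub_sq_mem ha hb ih i j)
      rw [← Matrix.neg_apply, ← h1, Matrix.smul_apply, smul_eq_mul, ← pow_succ'] at h3
      exact (Ideal.unit_mul_mem_iff_mem _ h2).mp h3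
  ext i j
  rw [← sub_eq_zero]
  refine eq_zero_of_forall_mem_pow p fun n => ?_
  simpa using key n i j

/-- The iteration `a ↦ (N - a²) / 2` converging to `√(1 + N) - 1`. -/
def sqrtSeq {C : Type*} [CommRing C] (half : C) (N : Matrix ι ι C) : ℕ → Matrix ι ι C
  | 0 => 0
  | n + 1 => half • (N - sqrtSeq half N n * sqrtSeq half N n)

theorem exists_matrix_limit {C : Type*} [CommRing C] [IsAdicComplete (pIdeal p C) C]
    {s : ℕ → Matrix ι ι C} (hstep : ∀ n i j, (s n - s (n + 1)) i j ∈ pIdeal p C ^ n) :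
    ∃ a : Matrix ι ι C, ∀ n i j, (s n - a) i j ∈ pIdeal p C ^ n := by
  have hcauchy : ∀ i j {m n : ℕ}, m ≤ n → s m i j - s n i j ∈ pIdeal p C ^ m := by
    intro i j m n hmn
    induction n, hmn using Nat.le_induction with
    | base => simp
    | succ n hmn ih =>
      have := add_mem ih (Ideal.pow_le_pow_right hmn (hstep n i j))
      simpa using this
  have hlim : ∀ i j, ∃ c, ∀ n, s n i j - c ∈ pIdeal p C ^ n := by
    intro i j
    obtain ⟨c, hc⟩ := IsPrecomplete.prec (I := pIdeal p C) (M := C) inferInstance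
      (f := fun n => s n i j) (fun {m n} hmn => by
        rw [SModEq.sub_mem, smul_eq_mul, Ideal.mul_top]
        exact hcauchy i j hmn)
    refine ⟨c, fun n => ?_⟩
    have := hc n
    rwa [SModEq.sub_mem, smul_eq_mul, Ideal.mul_top] at this
  choose a ha using hlim
  exact ⟨Matrix.of a, fun n i j => ha i j n⟩

theorem sqrtSeq_mem {C : Type*} [CommRing C] (half : C) {N : Matrix ι ι C}
    (hN : ∀ i j, N i j ∈ pIdeal p C) (n : ℕ) : ∀ i j, sqrtSeq half N n i j ∈ pIdeal p C := by
  induction n with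
  | zero => intro i j; exact zero_mem _
  | succ n ih =>
    intro i j
    rw [sqrtSeq, Matrix.smul_apply, Matrix.sub_apply]
    exact Ideal.mul_mem_left _ _ (sub_mem (hN i j)
      (Ideal.mul_le_left (entries_mul_mem ih ih i j)))

theorem sqrtSeq_sub_mem {C : Type*} [CommRing C] (half : C) {N : Matrix ι ι C}
    (hN : ∀ i j, N i j ∈ pIdeal p C) (n : ℕ) :
    ∀ i j, (sqrtSeq half N n - sqrtSeq half N (n + 1)) i j ∈ pIdeal p C ^ n := by
  induction n with
  | zero => simp
  | succ n ih =>
    intro i j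
    have h1 : sqrtSeq half N (n + 1) - sqrtSeq half N (n + 1 + 1) =
        half • -(sqrtSeq half N n * sqrtSeq half N n -
          sqrtSeq half N (n + 1) * sqrtSeq half N (n + 1)) := by
      rw [show sqrtSeq half N (n + 1 + 1) =
        half • (N - sqrtSeq half N (n + 1) * sqrtSeq half N (n + 1)) from rfl]
      generalize sqrtSeq half N (n + 1) * sqrtSeq half N (n + 1) = t
      rw [sqrtSeq, ← smul_sub]
      congr 1
      abel
    rw [h1, Matrix.smul_apply, Matrix.neg_apply, pow_succ']
    exact Ideal.mul_mem_left _ _ (neg_mem (entries_sq_sub_sq_mem (sqrtSeq_mem half hN n)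
      (sqrtSeq_mem half hN (n + 1)) ih i j))

theorem matrix_sqrt_exists {C : Type*} [CommRing C] [IsAdicComplete (pIdeal p C) C]
    (h2 : IsUnit (2 : C)) {M : Matrix ι ι C} (hM : ∀ i j, (M - 1) i j ∈ pIdeal p C) :
    ∃ a : Matrix ι ι C, (∀ i j, (a - 1) i j ∈ pIdeal p C) ∧ a * a = M := by
  obtain ⟨half, hhalf⟩ := h2.exists_right_inv
  have hp := sqrtSeq_mem half hM
  have hs1 : ∀ n, sqrtSeq half (M - 1) (n + 1) =
    half • ((M - 1) - sqrtSeq half (M - 1) n * sqrtSeq half (M - 1) n) := fun n => rfl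
  obtain ⟨a, ha⟩ := exists_matrix_limit (sqrtSeq_sub_mem half hM)
  set s := sqrtSeq half (M - 1)
  clear_value s
  have hap : ∀ i j, a i j ∈ pIdeal p C := by
    intro i j
    have h := ha 1 i j
    rw [pow_one, Matrix.sub_apply] at h
    exact (Submodule.sub_mem_iff_right _ (hp 1 i j)).mp h
  refine ⟨1 + a, fun i j => by rw [add_sub_cancel_left]; exact hap i j, ?_⟩
  ext i j
  rw [← sub_eq_zero]
  refine eq_zero_of_forall_mem_pow p fun n => ?_
  -- The recursion `2 s (n+1) = (M - 1) - (s n)²` expresses the defect of `1 + a` through the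
  -- distances of `s n` and `s (n+1)` to the limit.
  have h1 : (1 + a) * (1 + a) - M = -(s n * s n - a * a) - (2 : C) • (s (n + 1) - a) := by
    rw [smul_sub, hs1, smul_smul, hhalf, one_smul, two_smul, add_mul, one_mul, mul_add, mul_one]
    abel
  rw [← Matrix.sub_apply, h1, Matrix.sub_apply, Matrix.neg_apply, Matrix.smul_apply]
  have h3 := Ideal.mul_le_right (entries_sq_sub_sq_mem (hp n) hap (ha n) i j)
  have h4 := Ideal.pow_le_pow_right (Nat.le_succ n) (ha (n + 1) i j)
  exact sub_mem (neg_mem h3) (Ideal.mul_mem_left _ _ h4)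

/-! ### Entrywise `p`-th powers -/

theorem powP_apply {C : Type*} [CommRing C] [IsAdicComplete (pIdeal p C) C] (g : GL ι C)
    (i j : ι) : (powP p g : Matrix ι ι C) i j = (g : Matrix ι ι C) i j ^ p := rfl

theorem map_powP {C D : Type*} [CommRing C] [IsAdicComplete (pIdeal p C) C] [CommRing D]
    [IsAdicComplete (pIdeal p D) D] (e : C →+* D) (g : GL ι C) :
    Matrix.GeneralLinearGroup.map e (powP p g) = powP p (Matrix.GeneralLinearGroup.map e g) :=
  Units.ext (Matrix.ext fun _ _ => map_pow e _ p)

/-- Reduction modulo `p` followed by Frobenius. -/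
theorem exists_powP_reduction (p : ℕ) [Fact p.Prime] (C : Type*) [CommRing C] :
    ∃ ρ : C →+* C ⧸ pIdeal p C, ∀ c, ρ c = Ideal.Quotient.mk (pIdeal p C) (c ^ p) := by
  rcases subsingleton_or_nontrivial (C ⧸ pIdeal p C) with hs | hn
  · exact ⟨Ideal.Quotient.mk _, fun _ => Subsingleton.elim _ _⟩
  · have := charP_quotient p C
    exact ⟨(frobenius _ p).comp (Ideal.Quotient.mk _), fun c => by simp [frobenius_def]⟩

theorem glMap_mk_eq_iff {C : Type*} [CommRing C] {I : Ideal C} {g h : GL ι C} :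
    Matrix.GeneralLinearGroup.map (Ideal.Quotient.mk I) g =
      Matrix.GeneralLinearGroup.map (Ideal.Quotient.mk I) h ↔
    ∀ i j, (g : Matrix ι ι C) i j - (h : Matrix ι ι C) i j ∈ I := by
  constructor
  · intro H i j
    rw [← Ideal.Quotient.mk_eq_mk_iff_sub_mem]
    exact congrArg (fun g : GL ι (C ⧸ I) => (g : Matrix ι ι (C ⧸ I)) i j) H
  · intro H
    exact Units.ext (Matrix.ext fun i j =>
      (Ideal.Quotient.mk_eq_mk_iff_sub_mem _ _).mpr (H i j))

theorem add_pow_of_mul_eq_zero {C : Type*} [CommRing C] {a b : C} (h : a * b = 0) {n : ℕ}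
    (hn : n ≠ 0) : (a + b) ^ n = a ^ n + b ^ n := by
  obtain ⟨k, rfl⟩ := Nat.exists_eq_succ_of_ne_zero hn
  clear hn
  induction k with
  | zero => simp
  | succ k ih =>
    rw [pow_succ, ih]
    simp only [Nat.succ_eq_add_one]
    linear_combination (a ^ k + b ^ k) * h

theorem sum_pow_of_mul_eq_zero {C κ : Type*} [CommRing C] (s : Finset κ) {f : κ → C}
    (h : ∀ k l, k ≠ l → f k * f l = 0) {n : ℕ} (hn : n ≠ 0) :
    (∑ k ∈ s, f k) ^ n = ∑ k ∈ s, f k ^ n := by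
  classical
  induction s using Finset.induction_on with
  | empty => simp [hn]
  | insert k s hk ih =>
    rw [Finset.sum_insert hk, Finset.sum_insert hk, add_pow_of_mul_eq_zero _ hn, ih]
    rw [Finset.mul_sum]
    exact Finset.sum_eq_zero fun l hl => h k l fun hkl => hk (hkl ▸ hl)

/-- Any two distinct entries in the same column have product zero. -/
def ColMonomial {C : Type*} [CommRing C] (m : Matrix ι ι C) : Prop :=
  ∀ j k l, k ≠ l → m k j * m l j = 0

theorem ColMonomial.map {C D : Type*} [CommRing C] [CommRing D] (e : C →+* D) {m : Matrix ι ι C}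
    (hm : ColMonomial m) : ColMonomial (m.map e) := fun j k l hkl => by
  rw [Matrix.map_apply, Matrix.map_apply, ← map_mul, hm j k l hkl, map_zero]

theorem colMonomial_of_diagonal {C : Type*} [CommRing C] {m : Matrix ι ι C}
    (hm : ∀ i j, i ≠ j → m i j = 0) : ColMonomial m := fun j k l hkl => by
  rcases eq_or_ne k j with rfl | hk
  · rw [hm l k hkl.symm, mul_zero]
  · rw [hm k j hk, zero_mul]

/-- The summands of each entry of `N * m` annihilate one another pairwise, so the `p`-th power is
additive on them exactly, not only mod `p`. -/
theorem map_pow_mul {C : Type*} [CommRing C] {m : Matrix ι ι C} (hm : ColMonomial m)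
    (N : Matrix ι ι C) : (N * m).map (· ^ p) = N.map (· ^ p) * m.map (· ^ p) := by
  ext i j
  rw [Matrix.map_apply, Matrix.mul_apply, Matrix.mul_apply,
    sum_pow_of_mul_eq_zero _ _ (Fact.out : p.Prime).ne_zero]
  · exact Finset.sum_congr rfl fun k _ => mul_pow _ _ _
  · intro k l hkl
    linear_combination N i k * N i l * hm j k l hkl

theorem map_pow_mul' {C : Type*} [CommRing C] {m : Matrix ι ι C} (hm : ColMonomial mᵀ)
    (N : Matrix ι ι C) : (m * N).map (· ^ p) = m.map (· ^ p) * N.map (· ^ p) := by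
  apply Matrix.transpose_injective
  rw [Matrix.transpose_mul, ← Matrix.transpose_map, ← Matrix.transpose_map,
    ← Matrix.transpose_map, Matrix.transpose_mul]
  exact map_pow_mul hm Nᵀ

theorem powP_mul {C : Type*} [CommRing C] [IsAdicComplete (pIdeal p C) C] (g : GL ι C)
    {m : GL ι C} (hm : ColMonomial (m : Matrix ι ι C)) :
    powP p (g * m) = powP p g * powP p m :=
  Units.ext (map_pow_mul hm _)

theorem powP_mul' {C : Type*} [CommRing C] [IsAdicComplete (pIdeal p C) C] (g : GL ι C)
    {m : GL ι C} (hm : ColMonomial (m : Matrix ι ι C)ᵀ) :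
    powP p (m * g) = powP p m * powP p g :=
  Units.ext (map_pow_mul' hm _)

theorem powP_one {C : Type*} [CommRing C] [IsAdicComplete (pIdeal p C) C] :
    powP p (1 : GL ι C) = 1 := by
  refine Units.ext (Matrix.ext fun i j => ?_)
  rw [powP_apply, Units.val_one, Matrix.one_apply]
  split_ifs <;> simp [(Fact.out : p.Prime).ne_zero]

theorem powP_neg (hp : p ≠ 2) {C : Type*} [CommRing C] [IsAdicComplete (pIdeal p C) C]
    (g : GL ι C) : powP p (-g) = -powP p g :=
  Units.ext (Matrix.ext fun _ _ => ((Fact.out : p.Prime).odd_of_ne_two hp).neg_pow _)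

namespace ClassicalGroup

/-! ### The quadratic map -/

/-- The involution `i ↦ i'` of the index set such that `q` is supported at the positions
`(i, i')`. -/
def partner {ι : Type} : ClassicalGroup ι → ι → ι
  | gl _ => id
  | soEven _ => Sum.swap
  | soOdd _ => Sum.map id Sum.swap
  | sp _ => Sum.swap

variable (S : ClassicalGroup ι)

theorem partner_partner (i : ι) : S.partner (S.partner i) = i := by
  cases S <;> simp [partner]

theorem qMatrix_partner (i : ι) :
    S.qMatrix i (S.partner i) = 1 ∨ S.qMatrix i (S.partner i) = -1 := by
  cases S with
  | gl n => exact Or.inl (if_pos rfl)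
  | soEven r => rcases i with i | i <;> simp [qMatrix, partner]
  | soOdd r => rcases i with i | i | i <;> simp [qMatrix, partner, Matrix.fromBlocks]
  | sp r => rcases i with i | i <;> simp [qMatrix, partner]

theorem qMatrix_of_ne {i j : ι} (h : j ≠ S.partner i) : S.qMatrix i j = 0 := by
  cases S with
  | gl n => exact if_neg fun h' : i = j => h h'.symm
  | soEven r =>
    rcases i with i | i <;> rcases j with j | j <;>
      simp_all [qMatrix, partner, eq_comm]
  | soOdd r =>
    rcases i with i | i | i <;> rcases j with j | j | j <;>
      simp_all [qMatrix, partner, Matrix.fromBlocks, eq_comm]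
  | sp r =>
    rcases i with i | i <;> rcases j with j | j <;>
      simp_all [qMatrix, partner, eq_comm]

theorem qMatrix_transpose : S.qMatrixᵀ = S.qMatrix ∨ S.qMatrixᵀ = -S.qMatrix := by
  cases S with
  | gl n => left; simp [qMatrix]
  | soEven r => left; simp [qMatrix, Matrix.fromBlocks_transpose]
  | soOdd r => left; simp [qMatrix, Matrix.fromBlocks_transpose]
  | sp r => right; simp [qMatrix, Matrix.fromBlocks_transpose, Matrix.fromBlocks_neg]

variable {C D : Type} [CommRing C] [CommRing D]

theorem transposeGL_mul (g h : GL ι C) :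
    transposeGL (g * h) = transposeGL h * transposeGL g :=
  Units.ext (Matrix.transpose_mul _ _)

theorem transposeGL_transposeGL (g : GL ι C) : transposeGL (transposeGL g) = g :=
  Units.ext (Matrix.transpose_transpose _)

theorem transposeGL_one : transposeGL (1 : GL ι C) = 1 := Units.ext Matrix.transpose_one

theorem transposeGL_inv (g : GL ι C) : transposeGL g⁻¹ = (transposeGL g)⁻¹ :=
  Units.ext rfl

theorem glMap_transposeGL (f : C →+* D) (g : GL ι C) :
    Matrix.GeneralLinearGroup.map f (transposeGL g) =
      transposeGL (Matrix.GeneralLinearGroup.map f g) :=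
  Units.ext rfl

theorem q_apply (i j : ι) : (S.q C : Matrix ι ι C) i j = (S.qMatrix i j : C) := rfl

theorem glMap_q (f : C →+* D) : Matrix.GeneralLinearGroup.map f (S.q C) = S.q D :=
  Units.ext (Matrix.ext fun i j => by
    change f (S.qMatrix i j : C) = (S.qMatrix i j : D)
    simp)

theorem glMap_dagger (f : C →+* D) (g : GL ι C) :
    Matrix.GeneralLinearGroup.map f (S.dagger g) =
      S.dagger (Matrix.GeneralLinearGroup.map f g) := by
  unfold dagger
  split_ifs
  · exact map_inv _ _
  · exact glMap_transposeGL f g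

theorem glMap_quad (f : C →+* D) (g : GL ι C) :
    Matrix.GeneralLinearGroup.map f (S.quad g) =
      S.quad (Matrix.GeneralLinearGroup.map f g) := by
  rw [quad, map_mul, map_mul, glMap_dagger, glMap_q, quad]

theorem glMap_quadTwo (f : C →+* D) (g h : GL ι C) :
    Matrix.GeneralLinearGroup.map f (S.quadTwo g h) =
      S.quadTwo (Matrix.GeneralLinearGroup.map f g) (Matrix.GeneralLinearGroup.map f h) := by
  rw [quadTwo, map_mul, map_mul, glMap_quad, map_inv, quadTwo]

variable {S}

theorem q_of_isGL (hS : S.isGL = true) : S.q C = 1 := by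
  refine Units.ext (Matrix.ext fun i j => ?_)
  rw [q_apply]
  cases S with
  | gl n => simp [qMatrix, Matrix.one_apply]
  | soEven r => simp [isGL] at hS
  | soOdd r => simp [isGL] at hS
  | sp r => simp [isGL] at hS

theorem quad_of_isGL (hS : S.isGL = true) (g : GL ι C) : S.quad g = 1 := by
  rw [quad, q_of_isGL hS, dagger, if_pos hS, mul_one, inv_mul_cancel]

theorem quad_of_not_isGL (hS : ¬ S.isGL = true) (g : GL ι C) :
    S.quad g = transposeGL g * S.q C * g := by
  rw [quad, dagger, if_neg hS]

theorem quadTwo_of_isGL (hS : S.isGL = true) (g h : GL ι C) : S.quadTwo g h = g⁻¹ * h := by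
  rw [quadTwo, quad_of_isGL hS, one_mul]

theorem quadTwo_of_not_isGL (hS : ¬ S.isGL = true) (g h : GL ι C) :
    S.quadTwo g h = transposeGL g * S.q C * h := by
  rw [quadTwo, quad_of_not_isGL hS, mul_inv_cancel_right]

theorem quad_one : S.quad (1 : GL ι C) = S.q C := by
  rw [quad, mul_one, dagger, inv_one, transposeGL_one, ite_self, one_mul]

theorem transposeGL_quad (hS : ¬ S.isGL = true) :
    (∀ g : GL ι C, transposeGL (S.quad g) = S.quad g) ∨
      ∀ g : GL ι C, transposeGL (S.quad g) = -S.quad g := by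
  rcases S.qMatrix_transpose with h | h
  · left
    have hq : transposeGL (S.q C) = S.q C := Units.ext (Matrix.ext fun i j => by
      change ((S.qMatrixᵀ i j : ℤ) : C) = (S.qMatrix i j : C)
      rw [h])
    intro g
    rw [quad_of_not_isGL hS, transposeGL_mul, transposeGL_mul, hq, transposeGL_transposeGL,
      mul_assoc]
  · right
    have hq : transposeGL (S.q C) = -S.q C := Units.ext (Matrix.ext fun i j => by
      change ((S.qMatrixᵀ i j : ℤ) : C) = -(S.qMatrix i j : C)
      rw [h]
      simp)
    intro g
    rw [quad_of_not_isGL hS, transposeGL_mul, transposeGL_mul, hq, transposeGL_transposeGL,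
      neg_mul, mul_neg, mul_assoc]

theorem transposeGL_powP [IsAdicComplete (pIdeal p C) C] (g : GL ι C) :
    transposeGL (powP p g) = powP p (transposeGL g) :=
  Units.ext rfl

theorem powP_q (hp : p ≠ 2) [IsAdicComplete (pIdeal p C) C] : powP p (S.q C) = S.q C := by
  refine Units.ext (Matrix.ext fun i j => ?_)
  have hodd := (Fact.out : p.Prime).odd_of_ne_two hp
  rw [powP_apply, q_apply]
  rcases eq_or_ne j (S.partner i) with rfl | hj
  · rcases S.qMatrix_partner i with h | h <;> rw [h] <;> simp [hodd.neg_one_pow]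
  · rw [S.qMatrix_of_ne hj]
    simp [(Fact.out : p.Prime).ne_zero]

/-! ### The matrix `Φ` at a point -/

variable (S)

/-- `Y` is a value `Φ(g)` at `g` of a matrix `Φ` with respect to which `ℋ` is horizontal and
symmetric. -/
structure IsPhi (p : ℕ) [Fact p.Prime] [IsAdicComplete (pIdeal p C) C] (g Y : GL ι C) :
    Prop where
  sub_mem : ∀ i j, (Y : Matrix ι ι C) i j - (powP p g : Matrix ι ι C) i j ∈ pIdeal p C
  quad_eq : S.quad Y = powP p (S.quad g)
  symm : S.quadTwo (powP p g) Y = S.quadTwo Y (powP p g)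

/-! ### Naturality, uniqueness and existence of the value `Φ(g)` -/

variable [IsAdicComplete (pIdeal p C) C] [IsAdicComplete (pIdeal p D) D] {S}

/-- The conditions involve only integer coefficients and congruences mod `p`, so they survive every
ring homomorphism. Linearity over `R` is not needed, which allows Frobenius-semilinear maps. -/
theorem IsPhi.map (f : C →+* D) {g Y : GL ι C} (h : S.IsPhi p g Y) :
    S.IsPhi p (Matrix.GeneralLinearGroup.map f g) (Matrix.GeneralLinearGroup.map f Y) where
  sub_mem i j := by
    have := Ideal.mem_map_of_mem f (h.sub_mem i j)
    rw [pIdeal_map, map_sub] at this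
    rwa [← map_powP]
  quad_eq := by rw [← glMap_quad, h.quad_eq, map_powP, glMap_quad]
  symm := by rw [← map_powP, ← glMap_quadTwo, h.symm, glMap_quadTwo]

/-- Outside `GL_n`, symmetry says `Lᵗ A = A L` for `A = ℋ(g)`, hence `Lᵗ A L = A L²`. For `GL_n` it
says `L = L⁻¹`, so `L² = 1`. This turns the quadratic condition on `Φ(g)` into a square root
problem. -/
theorem quad_mul_of_symm {g L : GL ι C} (h : S.quadTwo g (g * L) = S.quadTwo (g * L) g) :
    S.quad (g * L) = S.quad g * (L * L) := by
  by_cases hS : S.isGL = true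
  · rw [quadTwo_of_isGL hS, quadTwo_of_isGL hS, inv_mul_cancel_left, mul_inv_rev,
      inv_mul_cancel_right, eq_inv_iff_mul_eq_one] at h
    rw [quad_of_isGL hS, quad_of_isGL hS, h, one_mul]
  · rw [quadTwo_of_not_isGL hS, quadTwo_of_not_isGL hS] at h
    rw [quad_of_not_isGL hS, quad_of_not_isGL hS, ← mul_assoc, ← h]
    group

/-- Mod `p` the entrywise power is a ring homomorphism, and `ℋ` commutes with those. -/
theorem glMap_mk_powP_quad (g : GL ι C) :
    Matrix.GeneralLinearGroup.map (Ideal.Quotient.mk (pIdeal p C)) (powP p (S.quad g)) =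
      Matrix.GeneralLinearGroup.map (Ideal.Quotient.mk (pIdeal p C)) (S.quad (powP p g)) := by
  obtain ⟨ρ, hρ⟩ := exists_powP_reduction p C
  have h : ∀ g : GL ι C, Matrix.GeneralLinearGroup.map (Ideal.Quotient.mk (pIdeal p C)) (powP p g)
      = Matrix.GeneralLinearGroup.map ρ g :=
    fun g => Units.ext (Matrix.ext fun i j => (hρ _).symm)
  rw [h, glMap_quad, glMap_quad, h]

theorem sub_one_mem_of_glMap_mk_eq {I : Ideal C} {g h : GL ι C}
    (H : Matrix.GeneralLinearGroup.map (Ideal.Quotient.mk I) g =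
      Matrix.GeneralLinearGroup.map (Ideal.Quotient.mk I) h) (i j : ι) :
    (((g⁻¹ * h : GL ι C) : Matrix ι ι C) - 1) i j ∈ I := by
  have h1 := (glMap_mk_eq_iff (I := I) (g := g⁻¹ * h) (h := 1)).mp ?_ i j
  · exact h1
  rw [map_mul, map_inv, H, inv_mul_cancel, map_one]

/-- The correction factor `(g^{(p)})⁻¹ Y` is a square root congruent to `1` of a matrix depending
only on `g`. Every later computation of `Φ` ends by an appeal to this. -/
theorem IsPhi.unique (hp : p ≠ 2) {g Y Y' : GL ι C} (h : S.IsPhi p g Y) (h' : S.IsPhi p g Y') :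
    Y = Y' := by
  have key : ∀ {Y}, S.IsPhi p g Y →
      ((powP p g)⁻¹ * Y) * ((powP p g)⁻¹ * Y) = (S.quad (powP p g))⁻¹ * powP p (S.quad g) := by
    intro Y h
    have h1 := quad_mul_of_symm (S := S) (g := powP p g) (L := (powP p g)⁻¹ * Y)
      (by rw [mul_inv_cancel_left]; exact h.symm)
    rw [mul_inv_cancel_left, h.quad_eq] at h1
    rw [h1, inv_mul_cancel_left]
  have h2 : (powP p g)⁻¹ * Y = (powP p g)⁻¹ * Y' := by
    refine Units.ext (matrix_sqrt_unique (p := p) (isUnit_two_of_isAdicComplete hp C) ?_ ?_ ?_)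
    · exact sub_one_mem_of_glMap_mk_eq (glMap_mk_eq_iff.mpr h.sub_mem).symm
    · exact sub_one_mem_of_glMap_mk_eq (glMap_mk_eq_iff.mpr h'.sub_mem).symm
    · rw [← Units.val_mul, ← Units.val_mul, key h, key h']
  exact mul_left_cancel h2

theorem isPhi_powP_of_isGL (hS : S.isGL = true) (g : GL ι C) : S.IsPhi p g (powP p g) where
  sub_mem i j := by simp
  quad_eq := by rw [quad_of_isGL hS, quad_of_isGL hS, powP_one]
  symm := rfl

theorem IsPhi.exists (hp : p ≠ 2) (g : GL ι C) : ∃ Y, S.IsPhi p g Y := by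
  by_cases hS : S.isGL = true
  · exact ⟨_, isPhi_powP_of_isGL hS g⟩
  have h2 := isUnit_two_of_isAdicComplete hp C
  set A := S.quad (powP p g) with hA
  set B := powP p (S.quad g) with hB
  have hAB : Matrix.GeneralLinearGroup.map (Ideal.Quotient.mk (pIdeal p C)) A =
    Matrix.GeneralLinearGroup.map (Ideal.Quotient.mk (pIdeal p C)) B :=
    (glMap_mk_powP_quad g).symm
  obtain ⟨L, hL1, hL2⟩ := matrix_sqrt_exists (p := p) h2 (sub_one_mem_of_glMap_mk_eq hAB)
  have hLu : IsUnit L := by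
    refine (isUnit_pow_iff two_ne_zero).mp ?_
    rw [sq, hL2]
    exact Units.isUnit _
  obtain ⟨L, rfl⟩ := hLu
  have hL2' : L * L = A⁻¹ * B := Units.ext hL2
  -- `A` and `B` have the same symmetry type, since `p` is odd and entrywise powers preserve signs.
  have htr : transposeGL (A⁻¹ * B) = B * A⁻¹ := by
    rw [transposeGL_mul, transposeGL_inv, hA, hB, transposeGL_powP]
    rcases transposeGL_quad (C := C) hS with h | h
    · rw [h, h]
    · rw [h, h, powP_neg hp, inv_neg, neg_mul_neg]
  -- `A⁻¹LᵗA` is also a square root of `A⁻¹B` congruent to `1`, so uniqueness identifies it with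
  -- `L`; this is the symmetry condition.
  have hsym : A⁻¹ * transposeGL L * A = L := by
    refine Units.ext (matrix_sqrt_unique (p := p) h2 ?_ hL1 ?_)
    · refine (glMap_mk_eq_iff (g := A⁻¹ * transposeGL L * A) (h := 1)).mp ?_
      have h1 : Matrix.GeneralLinearGroup.map (Ideal.Quotient.mk (pIdeal p C)) L =
          Matrix.GeneralLinearGroup.map (Ideal.Quotient.mk (pIdeal p C)) 1 :=
        glMap_mk_eq_iff.mpr hL1
      rw [map_mul, map_mul, map_inv, glMap_transposeGL, h1, map_one, transposeGL_one, mul_one,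
        inv_mul_cancel]
    · rw [← Units.val_mul, ← Units.val_mul]
      congr 1
      calc A⁻¹ * transposeGL L * A * (A⁻¹ * transposeGL L * A)
          = A⁻¹ * (transposeGL L * transposeGL L) * A := by group
        _ = A⁻¹ * (B * A⁻¹) * A := by rw [← transposeGL_mul, hL2', htr]
        _ = L * L := by rw [hL2']; group
  have hsymm : S.quadTwo (powP p g) (powP p g * L) = S.quadTwo (powP p g * L) (powP p g) := by
    rw [quadTwo_of_not_isGL hS, quadTwo_of_not_isGL hS, transposeGL_mul, ← mul_assoc,
      ← quad_of_not_isGL hS, mul_assoc, mul_assoc, ← mul_assoc (transposeGL (powP p g)),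
      ← quad_of_not_isGL hS, ← hA]
    conv_lhs => rw [← hsym]
    group
  refine ⟨powP p g * L, ?_, ?_, hsymm⟩
  · refine glMap_mk_eq_iff.mp ?_
    have h1 : Matrix.GeneralLinearGroup.map (Ideal.Quotient.mk (pIdeal p C)) L =
        Matrix.GeneralLinearGroup.map (Ideal.Quotient.mk (pIdeal p C)) 1 :=
      glMap_mk_eq_iff.mpr hL1
    rw [map_mul, h1, map_one, mul_one]
  · rw [quad_mul_of_symm hsymm, hL2', ← hA, mul_inv_cancel_left]

/-- Here no correction is needed: the factor `L` is `1` as soon as the entrywise power stays in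
`ℋ⁻¹(q)`. This is how root groups are treated. -/
theorem isPhi_powP_of_quad (hp : p ≠ 2) {g : GL ι C} (h : S.quad g = S.q C)
    (h' : S.quad (powP p g) = S.q C) : S.IsPhi p g (powP p g) where
  sub_mem i j := by simp
  quad_eq := by rw [h, h', powP_q hp]
  symm := rfl

/-! ### Values of `Φ` at products with monomial matrices -/

theorem quad_mul_right (hS : ¬ S.isGL = true) (g m : GL ι C) :
    S.quad (g * m) = transposeGL m * S.quad g * m := by
  rw [quad_of_not_isGL hS, quad_of_not_isGL hS, transposeGL_mul]
  group

theorem quadTwo_mul_right (hS : ¬ S.isGL = true) (g h m : GL ι C) :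
    S.quadTwo (g * m) (h * m) = transposeGL m * S.quadTwo g h * m := by
  rw [quadTwo_of_not_isGL hS, quadTwo_of_not_isGL hS, transposeGL_mul]
  group

theorem powP_transpose_mul_mul {m : GL ι C} (hm : ColMonomial (m : Matrix ι ι C)) (N : GL ι C) :
    powP p (transposeGL m * N * m) = transposeGL (powP p m) * powP p N * powP p m := by
  rw [powP_mul _ hm, powP_mul', transposeGL_powP]
  exact hm

/-- `Φ(g m) = Φ(g) m^{(p)}` if distinct entries in a column of `m` have product zero. -/
theorem IsPhi.mul_right {g Y m : GL ι C} (h : S.IsPhi p g Y)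
    (hm : ColMonomial (m : Matrix ι ι C)) : S.IsPhi p (g * m) (Y * powP p m) where
  sub_mem := by
    refine glMap_mk_eq_iff.mp ?_
    rw [powP_mul g hm, map_mul, map_mul, glMap_mk_eq_iff.mpr h.sub_mem]
  quad_eq := by
    by_cases hS : S.isGL = true
    · rw [quad_of_isGL hS, quad_of_isGL hS, powP_one]
    · rw [quad_mul_right hS, quad_mul_right hS, h.quad_eq, powP_transpose_mul_mul hm]
  symm := by
    rw [powP_mul g hm]
    by_cases hS : S.isGL = true
    · have h1 := h.symm
      rw [quadTwo_of_isGL hS, quadTwo_of_isGL hS] at h1 ⊢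
      rw [mul_inv_rev, mul_inv_rev, mul_assoc, ← mul_assoc _ Y, h1]
      group
    · rw [quadTwo_mul_right hS, quadTwo_mul_right hS, h.symm]

/-- `Φ(m g) = m^{(p)} Φ(g)` if distinct entries in a row or column of `m` have product zero and
`ℋ(m) = q`. -/
theorem IsPhi.mul_left (hp : p ≠ 2) {g Y m : GL ι C} (h : S.IsPhi p g Y)
    (hm : ColMonomial (m : Matrix ι ι C)) (hm' : ColMonomial (m : Matrix ι ι C)ᵀ)
    (hq : S.quad m = S.q C) : S.IsPhi p (m * g) (powP p m * Y) := by
  -- Entrywise powers of `mᵗ q m = q`, together with `q^{(p)} = q`, show that `m^{(p)}` again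
  -- preserves `q`.
  have hq' : ¬ S.isGL = true → transposeGL (powP p m) * S.q C * powP p m = S.q C := by
    intro hS
    rw [quad_of_not_isGL hS] at hq
    have := powP_transpose_mul_mul (p := p) hm (S.q C)
    rw [hq, powP_q hp] at this
    exact this.symm
  refine ⟨?_, ?_, ?_⟩
  · refine glMap_mk_eq_iff.mp ?_
    rw [powP_mul' g hm', map_mul, map_mul, glMap_mk_eq_iff.mpr h.sub_mem]
  · by_cases hS : S.isGL = true
    · rw [quad_of_isGL hS, quad_of_isGL hS, powP_one]
    · have h1 := h.quad_eq
      rw [quad_of_not_isGL hS] at hq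
      rw [quad_of_not_isGL hS, quad_of_not_isGL hS] at h1 ⊢
      calc transposeGL (powP p m * Y) * S.q C * (powP p m * Y)
          = transposeGL Y * (transposeGL (powP p m) * S.q C * powP p m) * Y := by
            rw [transposeGL_mul]; group
        _ = powP p (transposeGL g * S.q C * g) := by rw [hq' hS, h1]
        _ = powP p (transposeGL (m * g) * S.q C * (m * g)) := by
            rw [← hq]
            congr 1
            rw [transposeGL_mul, hq]
            nth_rw 1 [← hq]
            group
  · rw [powP_mul' g hm']
    by_cases hS : S.isGL = true
    · have h1 := h.symm
      rw [quadTwo_of_isGL hS, quadTwo_of_isGL hS] at h1 ⊢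
      rw [mul_inv_rev, mul_inv_rev, mul_assoc, inv_mul_cancel_left, h1, mul_assoc,
        inv_mul_cancel_left]
    · have h1 := h.symm
      rw [quadTwo_of_not_isGL hS, quadTwo_of_not_isGL hS] at h1 ⊢
      have h2 : ∀ a b : GL ι C, transposeGL (powP p m * a) * S.q C * (powP p m * b) =
          transposeGL a * (transposeGL (powP p m) * S.q C * powP p m) * b := by
        intro a b
        rw [transposeGL_mul]
        group
      rw [h2, h2, hq' hS, h1]

theorem isPhi_one (hp : p ≠ 2) : S.IsPhi p (1 : GL ι C) 1 := by
  have := isPhi_powP_of_quad hp (S := S) (g := (1 : GL ι C)) quad_one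
    (by rw [powP_one, quad_one])
  rwa [powP_one] at this

theorem isPhi_powP_of_colMonomial (hp : p ≠ 2) {m : GL ι C}
    (hm : ColMonomial (m : Matrix ι ι C)) : S.IsPhi p m (powP p m) := by
  simpa using (isPhi_one hp (S := S)).mul_right hm

end ClassicalGroup

/-! ### Existence and uniqueness of the lift of Frobenius -/

section

open ClassicalGroup

variable {S : ClassicalGroup ι} {φ : FrobLift p ι}

/-- Both composites restrict to `φ` on `R`, so they agree once they agree on the matrix `x`. -/
theorem quadHorizontal_iff :
    S.QuadHorizontal p φ (phiZero p ι) ↔ S.quad φ.mat = powP p (S.quad (genXhat p ι)) := by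
  have h1 : Matrix.GeneralLinearGroup.map (φ.toHom.comp (S.quadPull p)) (genXhat p ι) =
      S.quad φ.mat := by
    rw [glMap_comp, quadPull, map_evalHat_genXhat, glMap_quad]
    rfl
  have h2 : Matrix.GeneralLinearGroup.map ((S.quadPull p).comp (phiZero p ι).toHom)
      (genXhat p ι) = powP p (S.quad (genXhat p ι)) := by
    rw [glMap_comp]
    change Matrix.GeneralLinearGroup.map _ (phiZero p ι).mat = _
    rw [phiZero_mat, map_powP, quadPull, map_evalHat_genXhat]
  constructor
  · intro h
    rw [← h1, h, h2]
  · intro h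
    apply oGLhat_ringHom_ext
    · rw [RingHom.comp_assoc, RingHom.comp_assoc, FrobLift.comp_algebraMap, quadPull,
        evalHat_comp_algebraMap, φ.comp_algebraMap, ← RingHom.comp_assoc, evalHat_comp_algebraMap]
    · rw [h1, h2, h]

theorem glMap_comp_quadTwoPull (F : CTensor p (OGLhat p ι) (OGLhat p ι) →+* OGLhat p ι) :
    Matrix.GeneralLinearGroup.map (F.comp (S.quadTwoPull p)) (genXhat p ι) =
      S.quadTwo (Matrix.GeneralLinearGroup.map (F.comp (inFst p _ _)) (genXhat p ι))
        (Matrix.GeneralLinearGroup.map (F.comp (inSnd p _ _)) (genXhat p ι)) := by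
  rw [glMap_comp, quadTwoPull, map_evalHat_genXhat, glMap_quadTwo]
  rfl

theorem quadSymmetric_iff :
    S.QuadSymmetric p φ (phiZero p ι) ↔
      S.quadTwo (powP p (genXhat p ι)) φ.mat = S.quadTwo φ.mat (powP p (genXhat p ι)) := by
  rw [← phiZero_mat]
  constructor
  · rintro ⟨F, F', h1, h2, h3, h4, h⟩
    have := glMap_comp_quadTwoPull (S := S) F
    rw [h, glMap_comp_quadTwoPull, h1, h2, h3, h4] at this
    exact this.symm
  · intro h
    obtain ⟨F, h1, h2⟩ := exists_cTensor_lift (phiZero p ι).toHom φ.toHom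
      (by rw [φ.comp_algebraMap, FrobLift.comp_algebraMap])
    obtain ⟨F', h3, h4⟩ := exists_cTensor_lift φ.toHom (phiZero p ι).toHom
      (by rw [φ.comp_algebraMap, FrobLift.comp_algebraMap])
    refine ⟨F, F', h1, h2, h3, h4, ?_⟩
    apply oGLhat_ringHom_ext
    · rw [RingHom.comp_assoc, RingHom.comp_assoc, quadTwoPull, evalHat_comp_algebraMap,
        ← inFst_comp_algebraMap, ← RingHom.comp_assoc, ← RingHom.comp_assoc, h1, h3,
        φ.comp_algebraMap, FrobLift.comp_algebraMap]
    · rw [glMap_comp_quadTwoPull, glMap_comp_quadTwoPull, h1, h2, h3, h4]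
      exact h

/-- The two conditions on `φ_G` are the pointwise ones at the generic matrix; the congruence in
`IsPhi` is automatic for a lift of Frobenius. -/
theorem isPhi_mat_iff :
    S.IsPhi p (genXhat p ι) φ.mat ↔
      S.QuadHorizontal p φ (phiZero p ι) ∧ S.QuadSymmetric p φ (phiZero p ι) := by
  rw [quadHorizontal_iff, quadSymmetric_iff]
  exact ⟨fun h => ⟨h.quad_eq, h.symm⟩, fun h => ⟨φ.mat_sub_mem, h.1, h.2⟩⟩

theorem existsUnique_frobLift (hp : p ≠ 2) (S : ClassicalGroup ι) :
    ∃! φ : FrobLift p ι,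
      S.QuadHorizontal p φ (phiZero p ι) ∧ S.QuadSymmetric p φ (phiZero p ι) := by
  obtain ⟨Y, hY⟩ := IsPhi.exists (S := S) hp (genXhat p ι)
  refine ⟨FrobLift.ofMat Y hY.sub_mem, ?_, fun ψ hψ => ?_⟩
  · beta_reduce
    rw [← isPhi_mat_iff, FrobLift.mat_ofMat]
    exact hY
  · refine FrobLift.ext_mat (IsPhi.unique hp (isPhi_mat_iff.mpr hψ) ?_)
    rw [FrobLift.mat_ofMat]
    exact hY

/-! ### Horizontal subschemes -/

theorem isPhi_evalHat (hφ : S.IsPhi p (genXhat p ι) φ.mat) {D : Type} [CommRing D]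
    [IsAdicComplete (pIdeal p D) D] (h : ZpUr p →+* D) (g : GL ι D) :
    S.IsPhi p g (Matrix.GeneralLinearGroup.map (evalHat p h g) φ.mat) := by
  have := hφ.map (evalHat p h g)
  rwa [map_evalHat_genXhat] at this

/-- Let `I` be the kernel of the evaluation `O(G) → B` at `b`. If `I` is saturated in the sense of
`hsat` and the value of `φ_G` at `b` is induced by an endomorphism of the completion of `B`, then
the subscheme defined by `I` is horizontal. -/
theorem horizontal_of_evalGL {B : Type} [CommRing B] [Algebra (ZpUr p) B] {I : Ideal (OGL p ι)}
    (b : GL ι B) (hI : ∀ f ∈ I, evalGL p (algebraMap (ZpUr p) B) b f = 0)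
    (hsat : ∀ n f, evalGL p (algebraMap (ZpUr p) B) b f ∈ pIdeal p B ^ n →
      ∃ a ∈ I, f - a ∈ pIdeal p (OGL p ι) ^ n)
    (ψ : B →+* Hat p B)
    (hψR : ψ.comp (algebraMap (ZpUr p) B) = (algebraMap (ZpUr p) (Hat p B)).comp (frob p))
    (hψ : Matrix.GeneralLinearGroup.map ψ b = Matrix.GeneralLinearGroup.map
      (evalHat p (algebraMap (ZpUr p) (Hat p B))
        (Matrix.GeneralLinearGroup.map (algebraMap B (Hat p B)) b)) φ.mat) :
    Horizontal p φ I := by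
  set E := evalHat p (algebraMap (ZpUr p) (Hat p B))
    (Matrix.GeneralLinearGroup.map (algebraMap B (Hat p B)) b) with hE
  have hE1 : E.comp (algebraMap (OGL p ι) (OGLhat p ι)) =
      (algebraMap B (Hat p B)).comp (evalGL p (algebraMap (ZpUr p) B) b) := by
    rw [hE, evalHat_comp]
    apply oGL_ringHom_ext
    · rw [RingHom.comp_assoc, evalGL_comp_algebraMap, evalGL_comp_algebraMap,
        ← IsScalarTower.algebraMap_eq]
    · rw [glMap_comp, map_evalGL_genX, map_evalGL_genX]
  have hE2 : (E.comp φ.toHom).comp (algebraMap (OGL p ι) (OGLhat p ι)) =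
      ψ.comp (evalGL p (algebraMap (ZpUr p) B) b) := by
    apply oGL_ringHom_ext
    · rw [RingHom.comp_assoc, RingHom.comp_assoc, RingHom.comp_assoc, evalGL_comp_algebraMap,
        ← IsScalarTower.algebraMap_eq, φ.comp_algebraMap, ← RingHom.comp_assoc, hE,
        evalHat_comp_algebraMap, hψR]
    · rw [glMap_comp _ ψ, map_evalGL_genX, hψ]
      rfl
  rw [Horizontal, Ideal.map_le_iff_le_comap]
  intro f hf
  rw [Ideal.mem_comap, Ideal.mem_comap]
  -- The extended ideal is closed, so approximation suffices. An element `a` of `O(G)` close to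
  -- `φ_G(f)` takes at `b` a value divisible by `pⁿ`, because `E` kills `φ_G(f)`; saturation then
  -- moves `a` into `I`.
  refine mem_map_of_forall_exists p fun n => ?_
  obtain ⟨a, ha⟩ := exists_sub_algebraMap_mem p (φ.toHom (algebraMap _ (OGLhat p ι) f)) n
  have h0 : E (φ.toHom (algebraMap _ (OGLhat p ι) f)) = 0 := by
    have := RingHom.congr_fun hE2 f
    simp only [RingHom.comp_apply] at this
    rw [this, hI f hf, map_zero]
  have h1 := pIdeal_pow_le_comap p E n ha
  rw [Ideal.mem_comap, map_sub, h0, zero_sub, neg_mem_iff] at h1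
  have h2 := RingHom.congr_fun hE1 a
  simp only [RingHom.comp_apply] at h2
  rw [h2] at h1
  obtain ⟨c, hc, hac⟩ := hsat n a (mem_pIdeal_pow_of_algebraMap_mem p h1)
  refine ⟨c, hc, ?_⟩
  have h3 := pIdeal_pow_le_comap p (algebraMap (OGL p ι) (OGLhat p ι)) n hac
  rw [Ideal.mem_comap, map_sub] at h3
  simpa using add_mem ha h3

/-! ### Compatibility with subgroups -/

theorem inducedHom_comp_mk {I : Ideal (OGL p ι)} (h : Horizontal p φ I) :
    (inducedHom p φ I h).comp (Ideal.Quotient.mk _) = (Ideal.Quotient.mk _).comp φ.toHom :=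
  RingHom.ext fun _ => rfl

theorem inducedHom_comp_algebraMap {I : Ideal (OGL p ι)} (h : Horizontal p φ I) :
    (inducedHom p φ I h).comp (algebraMap (ZpUr p) (OSubHat p I)) =
      (algebraMap (ZpUr p) (OSubHat p I)).comp (frob p) := by
  have h1 : algebraMap (ZpUr p) (OSubHat p I) =
      (Ideal.Quotient.mk _).comp (algebraMap (ZpUr p) (OGLhat p ι)) := rfl
  rw [h1, ← RingHom.comp_assoc, inducedHom_comp_mk, RingHom.comp_assoc, φ.comp_algebraMap,
    RingHom.comp_assoc]

/-- The generic point of the subscheme defined by `I`. -/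
def genSub (I : Ideal (OGL p ι)) : GL ι (OSubHat p I) :=
  Matrix.GeneralLinearGroup.map (Ideal.Quotient.mk _) (genXhat p ι)

/-- A semilinear `F` intertwines evaluation at `g` with `φ_G` as soon as `F(g)` is the value `Φ(g)`.
The compatibilities thus become computations of `Φ` at a product. -/
theorem comp_evalHat_eq {D : Type} [CommRing D] [Algebra (ZpUr p) D]
    [IsAdicComplete (pIdeal p D) D] {F : D →+* D}
    (hF : F.comp (algebraMap (ZpUr p) D) = (algebraMap (ZpUr p) D).comp (frob p)) {g : GL ι D}
    (hg : Matrix.GeneralLinearGroup.map F g =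
      Matrix.GeneralLinearGroup.map (evalHat p (algebraMap (ZpUr p) D) g) φ.mat) :
    F.comp (evalHat p (algebraMap (ZpUr p) D) g) =
      (evalHat p (algebraMap (ZpUr p) D) g).comp φ.toHom := by
  apply oGLhat_ringHom_ext
  · rw [RingHom.comp_assoc, RingHom.comp_assoc, φ.comp_algebraMap, evalHat_comp_algebraMap, hF,
      ← RingHom.comp_assoc, evalHat_comp_algebraMap]
  · rw [glMap_comp, map_evalHat_genXhat, hg]
    rfl

/-- The endomorphism of a completed tensor product induced by a pair of `φ`-linear
endomorphisms. -/
theorem exists_cTensor_map {B C : Type} [CommRing B] [CommRing C] [Algebra (ZpUr p) B]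
    [Algebra (ZpUr p) C] {f : B →+* B} {g : C →+* C}
    (hf : f.comp (algebraMap (ZpUr p) B) = (algebraMap (ZpUr p) B).comp (frob p))
    (hg : g.comp (algebraMap (ZpUr p) C) = (algebraMap (ZpUr p) C).comp (frob p)) :
    ∃ F : CTensor p B C →+* CTensor p B C,
      F.comp (inFst p B C) = (inFst p B C).comp f ∧ F.comp (inSnd p B C) = (inSnd p B C).comp g ∧
      F.comp (algebraMap (ZpUr p) _) = (algebraMap (ZpUr p) _).comp (frob p) := by
  have h1 : ((inFst p B C).comp f).comp (algebraMap (ZpUr p) B) =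
      (algebraMap (ZpUr p) (CTensor p B C)).comp (frob p) := by
    rw [RingHom.comp_assoc, hf, ← RingHom.comp_assoc, inFst_comp_algebraMap]
  have h2 : ((inSnd p B C).comp g).comp (algebraMap (ZpUr p) C) =
      (algebraMap (ZpUr p) (CTensor p B C)).comp (frob p) := by
    rw [RingHom.comp_assoc, hg, ← RingHom.comp_assoc, inSnd_comp_algebraMap]
  obtain ⟨F, hF1, hF2⟩ := exists_cTensor_lift _ _ (h1.trans h2.symm)
  refine ⟨F, hF1, hF2, ?_⟩
  rw [← h1, ← hF1, RingHom.comp_assoc, inFst_comp_algebraMap]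

/-- On the generic point of a monomial subscheme, `φ_H` acts through `Φ`, and there `Φ` is the
entrywise power. -/
theorem glMap_comp_eq_powP (hp : p ≠ 2) (hφ : S.IsPhi p (genXhat p ι) φ.mat)
    {I : Ideal (OGL p ι)} (hI : Horizontal p φ I) {D : Type} [CommRing D]
    [IsAdicComplete (pIdeal p D) D] {e : OSubHat p I →+* D} {F : D →+* D}
    (h : F.comp e = e.comp (inducedHom p φ I hI))
    (hm : ColMonomial (Matrix.GeneralLinearGroup.map e (genSub I)).val) :
    Matrix.GeneralLinearGroup.map F (Matrix.GeneralLinearGroup.map e (genSub I)) =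
      powP p (Matrix.GeneralLinearGroup.map e (genSub I)) := by
  rw [← glMap_comp, h]
  exact IsPhi.unique hp (hφ.map (e.comp (Ideal.Quotient.mk _)))
    (isPhi_powP_of_colMonomial hp hm)

theorem glMap_comp_eq_map_mat {D : Type} [CommRing D] {e : OGLhat p ι →+* D} {F : D →+* D}
    (h : F.comp e = e.comp φ.toHom) :
    Matrix.GeneralLinearGroup.map F (Matrix.GeneralLinearGroup.map e (genXhat p ι)) =
      Matrix.GeneralLinearGroup.map e φ.mat := by
  rw [← glMap_comp, h]
  rfl

theorem mulLeftPull_eq (I : Ideal (OGL p ι)) :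
    mulLeftPull p I = evalHat p (algebraMap (ZpUr p) _)
      (Matrix.GeneralLinearGroup.map (inFst p (OSubHat p I) (OGLhat p ι)) (genSub I) *
        Matrix.GeneralLinearGroup.map (inSnd p (OSubHat p I) (OGLhat p ι)) (genXhat p ι)) := by
  simp only [mulLeftPull, glMap_comp, genSub]

theorem mulRightPull_eq (I : Ideal (OGL p ι)) :
    mulRightPull p I = evalHat p (algebraMap (ZpUr p) _)
      (Matrix.GeneralLinearGroup.map (inFst p (OGLhat p ι) (OSubHat p I)) (genXhat p ι) *
        Matrix.GeneralLinearGroup.map (inSnd p (OGLhat p ι) (OSubHat p I)) (genSub I)) := by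
  simp only [mulRightPull, glMap_comp, genSub]

theorem leftCompatible_of_colMonomial (hp : p ≠ 2) (hφ : S.IsPhi p (genXhat p ι) φ.mat)
    {I : Ideal (OGL p ι)} (hI : Horizontal p φ I)
    (hm : ColMonomial (genSub I : Matrix ι ι (OSubHat p I)))
    (hm' : ColMonomial (genSub I : Matrix ι ι (OSubHat p I))ᵀ)
    (hq : S.quad (genSub I) = S.q _) : LeftCompatible p φ I := by
  obtain ⟨F, h1, h2, h3⟩ :=
    exists_cTensor_map (inducedHom_comp_algebraMap hI) φ.comp_algebraMap
  refine ⟨hI, F, h1, h2, ?_⟩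
  rw [mulLeftPull_eq]
  refine comp_evalHat_eq h3 ?_
  -- `F` sends the product `h x` to `h^{(p)} Φ(x)`, which solves the equations for `Φ(h x)`.
  have key : ∀ {D : Type} [CommRing D] [Algebra (ZpUr p) D] [IsAdicComplete (pIdeal p D) D]
      {e : OSubHat p I →+* D} {e' : OGLhat p ι →+* D} {F : D →+* D},
      F.comp e = e.comp (inducedHom p φ I hI) → F.comp e' = e'.comp φ.toHom →
      S.IsPhi p (Matrix.GeneralLinearGroup.map e (genSub I) *
          Matrix.GeneralLinearGroup.map e' (genXhat p ι))
        (Matrix.GeneralLinearGroup.map F (Matrix.GeneralLinearGroup.map e (genSub I) *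
          Matrix.GeneralLinearGroup.map e' (genXhat p ι))) := by
    intro D _ _ _ e e' F h1 h2
    rw [map_mul, glMap_comp_eq_powP hp hφ hI h1 (hm.map _), glMap_comp_eq_map_mat h2]
    exact (hφ.map _).mul_left hp (hm.map _) (hm'.map _) (by rw [← glMap_quad, hq, glMap_q])
  exact IsPhi.unique hp (key h1 h2) (isPhi_evalHat hφ _ _)

theorem rightCompatible_of_colMonomial (hp : p ≠ 2) (hφ : S.IsPhi p (genXhat p ι) φ.mat)
    {I : Ideal (OGL p ι)} (hI : Horizontal p φ I)
    (hm : ColMonomial (genSub I : Matrix ι ι (OSubHat p I))) : RightCompatible p φ I := by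
  obtain ⟨F, h1, h2, h3⟩ :=
    exists_cTensor_map φ.comp_algebraMap (inducedHom_comp_algebraMap hI)
  refine ⟨hI, F, h1, h2, ?_⟩
  rw [mulRightPull_eq]
  refine comp_evalHat_eq h3 ?_
  have key : ∀ {D : Type} [CommRing D] [Algebra (ZpUr p) D] [IsAdicComplete (pIdeal p D) D]
      {e : OSubHat p I →+* D} {e' : OGLhat p ι →+* D} {F : D →+* D},
      F.comp e = e.comp (inducedHom p φ I hI) → F.comp e' = e'.comp φ.toHom →
      S.IsPhi p (Matrix.GeneralLinearGroup.map e' (genXhat p ι) *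
          Matrix.GeneralLinearGroup.map e (genSub I))
        (Matrix.GeneralLinearGroup.map F (Matrix.GeneralLinearGroup.map e' (genXhat p ι) *
          Matrix.GeneralLinearGroup.map e (genSub I))) := by
    intro D _ _ _ e e' F h1 h2
    rw [map_mul, glMap_comp_eq_powP hp hφ hI h1 (hm.map _), glMap_comp_eq_map_mat h2]
    exact (hφ.map _).mul_right (hm.map _)
  exact IsPhi.unique hp (key h2 h1) (isPhi_evalHat hφ _ _)

/-! ### The cocycle rule -/

theorem logDeriv_spec (a : GL ι (ZpUr p)) :
    (p : ZpUr p) • logDeriv p φ a =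
      ((frobGL p a * (PhiAt p φ a)⁻¹ : GL ι (ZpUr p)) : Matrix ι ι (ZpUr p)) - 1 :=
  (exists_logDeriv p φ a).choose_spec

/-- The law `+_δ` is multiplication transported through `α ↦ 1 + pα`. The claim is `φ(ab)Φ(ab)⁻¹ =
φ(a)(φ(b)Φ(b)⁻¹)φ(a)⁻¹ · φ(a)Φ(a)⁻¹`, divided by `p`, which is a nonzerodivisor in `R`. -/
theorem logDeriv_mul {a b : GL ι (ZpUr p)} (h : PhiAt p φ (a * b) = PhiAt p φ a * PhiAt p φ b) :
    logDeriv p φ (a * b) =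
      addDelta p (starDelta p a (logDeriv p φ b)) (logDeriv p φ a) := by
  have hp0 : (p : ZpUr p) ≠ 0 := WittVector.p_nonzero p _
  refine smul_right_injective _ hp0 ?_
  beta_reduce
  have h1 := eq_add_of_sub_eq (logDeriv_spec (φ := φ) a).symm
  have h2 := eq_add_of_sub_eq (logDeriv_spec (φ := φ) b).symm
  have h3 : frobGL p (a * b) * (PhiAt p φ (a * b))⁻¹ =
      frobGL p a * (frobGL p b * (PhiAt p φ b)⁻¹) * (frobGL p a)⁻¹ *
        (frobGL p a * (PhiAt p φ a)⁻¹) := by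
    rw [h, show frobGL p (a * b) = frobGL p a * frobGL p b from map_mul _ _ _]
    group
  rw [logDeriv_spec, h3, Units.val_mul, h1, Units.val_mul, Units.val_mul, h2, addDelta, starDelta,
    mul_add (frobGL p a : Matrix ι ι (ZpUr p)), mul_one, add_mul _ (frobGL p a : Matrix ι ι (ZpUr p)),
    Units.mul_inv, mul_smul_comm, smul_mul_assoc]
  generalize (frobGL p a : Matrix ι ι (ZpUr p)) * logDeriv p φ b *
    ((frobGL p a)⁻¹ : GL ι (ZpUr p)) = γ
  rw [add_mul, one_mul, mul_add, mul_one, smul_add, smul_add, smul_mul_smul_comm, ← mul_smul]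
  abel

theorem isPhi_phiAt (hφ : S.IsPhi p (genXhat p ι) φ.mat) (a : GL ι (ZpUr p)) :
    S.IsPhi p a (PhiAt p φ a) := by
  have h := isPhi_evalHat hφ (RingHom.id (ZpUr p)) a
  rw [FrobLift.mat, ← glMap_comp] at h
  exact h

theorem phiAt_of_colMonomial (hp : p ≠ 2) (hφ : S.IsPhi p (genXhat p ι) φ.mat)
    {m : GL ι (ZpUr p)} (hm : ColMonomial (m : Matrix ι ι (ZpUr p))) :
    PhiAt p φ m = powP p m :=
  IsPhi.unique hp (isPhi_phiAt hφ m) (isPhi_powP_of_colMonomial hp hm)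

theorem phiAt_mul_right (hp : p ≠ 2) (hφ : S.IsPhi p (genXhat p ι) φ.mat) (a : GL ι (ZpUr p))
    {m : GL ι (ZpUr p)} (hm : ColMonomial (m : Matrix ι ι (ZpUr p))) :
    PhiAt p φ (a * m) = PhiAt p φ a * PhiAt p φ m := by
  rw [phiAt_of_colMonomial hp hφ hm]
  exact IsPhi.unique hp (isPhi_phiAt hφ _) ((isPhi_phiAt hφ a).mul_right hm)

theorem phiAt_mul_left (hp : p ≠ 2) (hφ : S.IsPhi p (genXhat p ι) φ.mat) (b : GL ι (ZpUr p))
    {m : GL ι (ZpUr p)} (hm : ColMonomial (m : Matrix ι ι (ZpUr p)))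
    (hm' : ColMonomial (m : Matrix ι ι (ZpUr p))ᵀ) (hq : S.quad m = S.q _) :
    PhiAt p φ (m * b) = PhiAt p φ m * PhiAt p φ b := by
  rw [phiAt_of_colMonomial hp hφ hm]
  exact IsPhi.unique hp (isPhi_phiAt hφ _) ((isPhi_phiAt hφ b).mul_left hp hm hm' hq)

end

open ClassicalGroup

/-! ### Tori -/

/-- The group ring `R[ℤ^ι]`. -/
abbrev CharRing (p : ℕ) [Fact p.Prime] (ι : Type) : Type := AddMonoidAlgebra (ZpUr p) (ι → ℤ)

/-- The element of `R[ℤ^ι]` given by a character. -/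
def charUnit (p : ℕ) [Fact p.Prime] {ι : Type} (m : ι → ℤ) : (CharRing p ι)ˣ where
  val := AddMonoidAlgebra.single m 1
  inv := AddMonoidAlgebra.single (-m) 1
  val_inv := by simp [AddMonoidAlgebra.single_mul_single, AddMonoidAlgebra.one_def]
  inv_val := by simp [AddMonoidAlgebra.single_mul_single, AddMonoidAlgebra.one_def]

theorem charUnit_add (m n : ι → ℤ) : charUnit p (m + n) = charUnit p m * charUnit p n :=
  Units.ext (by simp [charUnit, AddMonoidAlgebra.single_mul_single])

/-- `m ↦ charUnit p m` as a homomorphism. -/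
def charUnitHom (p : ℕ) [Fact p.Prime] (ι : Type) [Fintype ι] [DecidableEq ι] :
    Multiplicative (ι → ℤ) →* (CharRing p ι)ˣ where
  toFun m := charUnit p m.toAdd
  map_one' := Units.ext rfl
  map_mul' _ _ := charUnit_add _ _

theorem charUnit_zsmul (m : ι → ℤ) (n : ℤ) : charUnit p (n • m) = charUnit p m ^ n :=
  map_zpow (charUnitHom p ι) (Multiplicative.ofAdd m) n

theorem charUnit_sum {κ : Type*} (s : Finset κ) (m : κ → ι → ℤ) :
    charUnit p (∑ k ∈ s, m k) = ∏ k ∈ s, charUnit p (m k) :=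
  map_prod (charUnitHom p ι) (fun k => Multiplicative.ofAdd (m k)) s

theorem exists_charRing_lift {D : Type*} [CommRing D] (h : ZpUr p →+* D)
    (g : Multiplicative (ι → ℤ) →* D) :
    ∃ F : CharRing p ι →+* D, F.comp (algebraMap (ZpUr p) (CharRing p ι)) = h ∧
      ∀ m, F (charUnit p m : CharRing p ι) = g (Multiplicative.ofAdd m) := by
  let _ : Algebra (ZpUr p) D := h.toAlgebra
  refine ⟨(AddMonoidAlgebra.lift (ZpUr p) D (ι → ℤ) g).toRingHom, ?_, fun m => ?_⟩
  · exact (AddMonoidAlgebra.lift (ZpUr p) D (ι → ℤ) g).comp_algebraMap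
  · change AddMonoidAlgebra.lift (ZpUr p) D (ι → ℤ) g (AddMonoidAlgebra.single m 1) = _
    rw [AddMonoidAlgebra.lift_single, one_smul]

/-- The diagonal point with entries the characters `ε i`. -/
def torusPoint (p : ℕ) [Fact p.Prime] {ι : Type} [Fintype ι] [DecidableEq ι] (ε : ι → ι → ℤ) :
    GL ι (CharRing p ι) :=
  diagGL fun i => charUnit p (ε i)

theorem diagGL_apply_ne {C : Type} [CommRing C] (d : ι → Cˣ) {i j : ι} (h : i ≠ j) :
    (diagGL d : Matrix ι ι C) i j = 0 :=
  Matrix.diagonal_apply_ne _ h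

theorem diagGL_apply_eq {C : Type} [CommRing C] (d : ι → Cˣ) (i : ι) :
    (diagGL d : Matrix ι ι C) i i = d i :=
  Matrix.diagonal_apply_eq _ i

theorem diag_of_torusIdeal_le {C : Type*} [CommRing C] {e : OGL p ι →+* C}
    (he : ∀ f ∈ torusIdeal p ι, e f = 0) {i j : ι} (h : i ≠ j) :
    (Matrix.GeneralLinearGroup.map e (genX p ι) : Matrix ι ι C) i j = 0 :=
  he _ (Ideal.subset_span ⟨i, j, h, rfl⟩)

theorem map_torusIdeal_eq_zero {C : Type*} [CommRing C] {e : OGL p ι →+* C}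
    (he : ∀ i j, i ≠ j → (Matrix.GeneralLinearGroup.map e (genX p ι) : Matrix ι ι C) i j = 0) :
    ∀ f ∈ torusIdeal p ι, e f = 0 := by
  have : torusIdeal p ι ≤ RingHom.ker e := by
    rw [torusIdeal, Ideal.span_le]
    rintro f ⟨i, j, h, rfl⟩
    exact he i j h
  exact fun f hf => this hf

theorem exists_units_of_diagonal {C : Type*} [CommRing C] (g : GL ι C)
    (hg : ∀ i j, i ≠ j → (g : Matrix ι ι C) i j = 0) :
    ∃ u : ι → Cˣ, ∀ i, (u i : C) = (g : Matrix ι ι C) i i := by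
  have h : ∀ i, IsUnit ((g : Matrix ι ι C) i i) := by
    intro i
    have h1 : ((g : Matrix ι ι C) * ((g⁻¹ : GL ι C) : Matrix ι ι C)) i i = 1 := by
      rw [Units.mul_inv, Matrix.one_apply_eq]
    rw [Matrix.mul_apply, Fintype.sum_eq_single i fun j hj => by rw [hg i j hj.symm, zero_mul]]
      at h1
    exact IsUnit.of_mul_eq_one _ h1
  exact ⟨fun i => (h i).unit, fun i => rfl⟩

/-- Horizontality of a diagonal subgroup whose coordinate ring is a retract of `R[ℤ^ι]`. -/
theorem horizontal_of_torus (hp : p ≠ 2) {S : ClassicalGroup ι} {φ : FrobLift p ι}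
    (hφ : S.IsPhi p (genXhat p ι) φ.mat) {J : Ideal (OGL p ι)} (hJ : torusIdeal p ι ≤ J)
    (ε : ι → ι → ℤ)
    (hJε : ∀ f ∈ J, evalGL p (algebraMap (ZpUr p) _) (torusPoint p ε) f = 0)
    (hu : ∀ u : ι → (OGL p ι ⧸ J)ˣ,
      (∀ i, (u i : OGL p ι ⧸ J) = Ideal.Quotient.mk J ((genX p ι : Matrix ι ι (OGL p ι)) i i)) →
      ∀ i, ∏ j, u j ^ ε i j = u i) : Horizontal p φ J := by
  have hJ0 : ∀ f ∈ torusIdeal p ι, Ideal.Quotient.mk J f = 0 := fun f hf =>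
    Ideal.Quotient.eq_zero_iff_mem.mpr (hJ hf)
  obtain ⟨u, hux⟩ := exists_units_of_diagonal
    (Matrix.GeneralLinearGroup.map (Ideal.Quotient.mk J) (genX p ι))
    fun i j hij => diag_of_torusIdeal_le hJ0 hij
  have huε := hu u hux
  -- A left inverse to evaluation at the torus point: `s` sends a character to the corresponding
  -- monomial in the diagonal entries. Only a retraction is needed, so `ℤ^ι` may be larger than the
  -- character lattice of the torus.
  obtain ⟨s, hsR, hs⟩ := exists_charRing_lift (p := p)
    ((Ideal.Quotient.mk J).comp (algebraMap (ZpUr p) (OGL p ι)))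
    ((Units.coeHom (OGL p ι ⧸ J)).comp
      { toFun := fun m : Multiplicative (ι → ℤ) => ∏ j, u j ^ m.toAdd j
        map_one' := by simp
        map_mul' := fun m n => by simp [zpow_add, Finset.prod_mul_distrib] })
  have hsec : s.comp (evalGL p (algebraMap (ZpUr p) _) (torusPoint p ε)) =
      Ideal.Quotient.mk J := by
    apply oGL_ringHom_ext
    · rw [RingHom.comp_assoc, evalGL_comp_algebraMap, hsR]
    · rw [glMap_comp, map_evalGL_genX]
      refine Units.ext (Matrix.ext fun i j => ?_)
      rcases eq_or_ne i j with rfl | hij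
      · change s ((torusPoint p ε).val i i) = Ideal.Quotient.mk J _
        rw [torusPoint, diagGL_apply_eq, hs]
        refine Eq.trans ?_ (hux i)
        rw [← huε i]
        rfl
      · rw [diag_of_torusIdeal_le hJ0 hij]
        change s ((torusPoint p ε).val i j) = 0
        rw [torusPoint, diagGL_apply_ne _ hij, map_zero]
  -- The semilinear endomorphism raising every character to its `p`-th power.
  obtain ⟨ψ, hψR, hψ⟩ := exists_charRing_lift (ι := ι)
    ((algebraMap (ZpUr p) (Hat p (CharRing p ι))).comp (frob p))
    { toFun := fun m : Multiplicative (ι → ℤ) =>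
        algebraMap (CharRing p ι) (Hat p (CharRing p ι)) (charUnitHom p ι m ^ p : _)
      map_one' := by simp
      map_mul' := fun m n => by simp [mul_pow] }
  refine horizontal_of_evalGL (torusPoint p ε) hJε ?_ ψ hψR ?_
  -- If `f` has value `pⁿ c` at the torus point, subtract `pⁿ` times a lift of `s c`; the retraction
  -- shows that the remainder lies in `J`.
  · intro n f hf
    rw [pIdeal, Ideal.span_singleton_pow, Ideal.mem_span_singleton] at hf
    obtain ⟨c, hc⟩ := hf
    obtain ⟨l, hl⟩ := Ideal.Quotient.mk_surjective (s c)
    refine ⟨f - p ^ n * l, ?_, ?_⟩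
    · rw [← Ideal.Quotient.eq_zero_iff_mem, ← hsec, RingHom.comp_apply, map_sub, hc, map_sub]
      have : s (evalGL p (algebraMap (ZpUr p) _) (torusPoint p ε) l) = s c :=
        (RingHom.congr_fun hsec l).trans hl
      simp [this]
    · rw [sub_sub_cancel, pIdeal, Ideal.span_singleton_pow]
      exact Ideal.mul_mem_right _ _ (Ideal.mem_span_singleton_self _)
  · have hd : ∀ i j, i ≠ j → (Matrix.GeneralLinearGroup.map (algebraMap (CharRing p ι)
        (Hat p (CharRing p ι))) (torusPoint p ε)).val i j = 0 := by
      intro i j hij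
      change algebraMap _ _ ((torusPoint p ε).val i j) = _
      rw [torusPoint, diagGL_apply_ne _ hij, map_zero]
    rw [IsPhi.unique hp (isPhi_evalHat hφ _ _)
      (isPhi_powP_of_colMonomial hp (colMonomial_of_diagonal hd))]
    refine Units.ext (Matrix.ext fun i j => ?_)
    rw [powP_apply]
    rcases eq_or_ne i j with rfl | hij
    · change ψ ((torusPoint p ε).val i i) =
        algebraMap _ _ ((torusPoint p ε).val i i) ^ p
      rw [torusPoint, diagGL_apply_eq, hψ]
      change algebraMap _ _ ((charUnit p (ε i) ^ p : (CharRing p ι)ˣ) : CharRing p ι) = _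
      rw [Units.val_pow_eq_pow_val, map_pow]
    · rw [hd i j hij, zero_pow (Fact.out : p.Prime).ne_zero]
      change ψ ((torusPoint p ε).val i j) = 0
      rw [torusPoint, diagGL_apply_ne _ hij, map_zero]

theorem prod_zpow_single {G : Type*} [CommGroup G] (u : ι → G) (i : ι) (n : ℤ) :
    ∏ j, u j ^ (Pi.single i n : ι → ℤ) j = u i ^ n := by
  rw [Fintype.prod_eq_single i fun j hj => by rw [Pi.single_eq_of_ne hj, zpow_zero],
    Pi.single_eq_same]

theorem horizontal_torusIdeal (hp : p ≠ 2) {S : ClassicalGroup ι} {φ : FrobLift p ι}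
    (hφ : S.IsPhi p (genXhat p ι) φ.mat) : Horizontal p φ (torusIdeal p ι) := by
  refine horizontal_of_torus hp hφ le_rfl (fun i => Pi.single i 1) ?_ ?_
  · refine map_torusIdeal_eq_zero fun i j hij => ?_
    rw [map_evalGL_genX]
    exact diagGL_apply_ne _ hij
  · intro u _ i
    exact (prod_zpow_single u i 1).trans (zpow_one _)

/-! ### The Weyl group -/

theorem permGL_apply (σ : Equiv.Perm ι) (i j : ι) :
    (permGL p σ : Matrix ι ι (ZpUr p)) i j = if σ i = j then 1 else 0 := by
  change σ.permMatrix (ZpUr p) i j = _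
  rw [Equiv.Perm.permMatrix, PEquiv.toMatrix_apply]
  simp

theorem mem_weylIdeal {f : OGL p ι} :
    f ∈ weylIdeal p ι ↔ ∀ σ, evalGL p (RingHom.id (ZpUr p)) (permGL p σ) f = 0 := by
  simp [weylIdeal, RingHom.mem_ker]

theorem colMonomial_of_weylIdeal {C : Type*} [CommRing C] {e : OGL p ι →+* C}
    (he : ∀ f ∈ weylIdeal p ι, e f = 0) :
    ColMonomial (Matrix.GeneralLinearGroup.map e (genX p ι) : Matrix ι ι C) ∧
      ColMonomial (Matrix.GeneralLinearGroup.map e (genX p ι) : Matrix ι ι C)ᵀ := by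
  constructor
  · intro j k l hkl
    change e _ * e _ = 0
    rw [← map_mul]
    refine he _ (mem_weylIdeal.mpr fun σ => ?_)
    rw [map_mul, evalGL_genX, evalGL_genX, permGL_apply, permGL_apply]
    split_ifs with h1 h2
    · exact absurd (σ.injective (h1.trans h2.symm)) hkl
    all_goals simp
  · intro j k l hkl
    change e _ * e _ = 0
    rw [← map_mul]
    refine he _ (mem_weylIdeal.mpr fun σ => ?_)
    rw [map_mul, evalGL_genX, evalGL_genX, permGL_apply, permGL_apply]
    split_ifs with h1 h2
    · exact absurd (h1.symm.trans h2) hkl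
    all_goals simp

/-- A function on `G` restricting to the idempotent of `O(W)` attached to `σ`. -/
def permIdem (p : ℕ) [Fact p.Prime] (σ : Equiv.Perm ι) : OGL p ι :=
  ∏ i, (genX p ι : Matrix ι ι (OGL p ι)) i (σ i)

theorem evalGL_permIdem (σ τ : Equiv.Perm ι) :
    evalGL p (RingHom.id (ZpUr p)) (permGL p τ) (permIdem p σ) = if τ = σ then 1 else 0 := by
  rw [permIdem, map_prod]
  simp only [evalGL_genX, permGL_apply]
  split_ifs with h
  · simp [h]
  · obtain ⟨i, hi⟩ := not_forall.mp fun h' => h (Equiv.ext h')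
    exact Finset.prod_eq_zero (Finset.mem_univ i) (if_neg hi)

theorem evalGL_sum_mul_permIdem (c : Equiv.Perm ι → OGL p ι) (τ : Equiv.Perm ι) :
    evalGL p (RingHom.id (ZpUr p)) (permGL p τ) (∑ σ, c σ * permIdem p σ) =
      evalGL p (RingHom.id (ZpUr p)) (permGL p τ) (c τ) := by
  simp [map_sum, evalGL_permIdem]

/-- Since `φ(r)` and `r` are associated, every ideal of `R` is `φ`-stable. -/
theorem frob_mem {J : Ideal (ZpUr p)} : J ≤ J.comap (frob p) := fun r hr =>
  Ideal.mem_of_dvd J (associated_frob p r).dvd hr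

theorem evalGL_id_surjective (g : GL ι (ZpUr p)) :
    Function.Surjective (evalGL p (RingHom.id (ZpUr p)) g) := fun r =>
  ⟨algebraMap _ _ r, evalGL_algebraMap p _ g r⟩

/-- `W` is a disjoint union of copies of `Spec R`, so cutting it by any `J` leaves `∏ R/K_σ`. On
this ring `φ` acts, and the coordinates, being `0` or `1`, are fixed by it and equal to their `p`-th
powers. As `J` is arbitrary, there is no need to know which permutations lie in `S`. -/
theorem horizontal_weylIdeal_sup (hp : p ≠ 2) {S : ClassicalGroup ι} {φ : FrobLift p ι}
    (hφ : S.IsPhi p (genXhat p ι) φ.mat) (J : Ideal (OGL p ι)) :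
    Horizontal p φ (weylIdeal p ι ⊔ J) := by
  let ev : Equiv.Perm ι → OGL p ι →+* ZpUr p := fun σ =>
    evalGL p (RingHom.id (ZpUr p)) (permGL p σ)
  let K : Equiv.Perm ι → Ideal (ZpUr p) := fun σ => J.map (ev σ)
  let B : Type := ∀ σ, ZpUr p ⧸ K σ
  let e : OGL p ι →+* B := RingHom.pi fun σ => (Ideal.Quotient.mk (K σ)).comp (ev σ)
  let b : GL ι B := Matrix.GeneralLinearGroup.map e (genX p ι)
  have heR : e.comp (algebraMap (ZpUr p) (OGL p ι)) = algebraMap (ZpUr p) B := by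
    refine RingHom.ext fun r => funext fun σ => ?_
    change Ideal.Quotient.mk (K σ) (ev σ (algebraMap _ _ r)) = Ideal.Quotient.mk (K σ) r
    rw [evalGL_algebraMap]
    rfl
  have he : evalGL p (algebraMap (ZpUr p) B) b = e :=
    oGL_ringHom_ext (by rw [evalGL_comp_algebraMap, heR]) (map_evalGL_genX _ _)
  have hew : ∀ f ∈ weylIdeal p ι, e f = 0 := by
    intro f hf
    refine funext fun σ => ?_
    change Ideal.Quotient.mk (K σ) (ev σ f) = 0
    rw [mem_weylIdeal.mp hf σ, map_zero]
  have hb : ∀ i j, (b : Matrix ι ι B) i j = fun σ => Ideal.Quotient.mk (K σ)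
      (if σ i = j then 1 else 0) := by
    intro i j
    refine funext fun σ => ?_
    change Ideal.Quotient.mk (K σ) (ev σ ((genX p ι : Matrix ι ι (OGL p ι)) i j)) = _
    rw [evalGL_genX, permGL_apply]
  let ψ : B →+* B := RingHom.pi fun σ =>
    (Ideal.quotientMap (K σ) (frob p) frob_mem).comp (Pi.evalRingHom _ σ)
  have hψ : ∀ i j, ψ ((b : Matrix ι ι B) i j) = (b : Matrix ι ι B) i j ^ p := by
    intro i j
    rw [hb]
    refine funext fun σ => ?_
    change Ideal.quotientMap (K σ) (frob p) frob_mem (Ideal.Quotient.mk (K σ) _) =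
      Ideal.Quotient.mk (K σ) _ ^ p
    rw [Ideal.quotientMap_mk, ← map_pow]
    split_ifs <;> simp [(Fact.out : p.Prime).ne_zero]
  refine horizontal_of_evalGL b ?_ ?_ ((algebraMap B (Hat p B)).comp ψ) ?_ ?_
  · rw [he]
    have h : weylIdeal p ι ⊔ J ≤ RingHom.ker e := by
      refine sup_le (fun f hf => hew f hf) fun f hf => ?_
      refine funext fun σ => ?_
      exact Ideal.Quotient.eq_zero_iff_mem.mpr (Ideal.mem_map_of_mem _ hf)
    exact fun f hf => h hf
  · intro n f hf
    rw [he, pIdeal, Ideal.span_singleton_pow, Ideal.mem_span_singleton] at hf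
    obtain ⟨c, hc⟩ := hf
    choose r hr using fun σ => Ideal.Quotient.mk_surjective (c σ)
    -- Evaluation at `σ` is onto, so each element of `K_σ` is the value of some element of `J`, not
    -- merely a combination of such values.
    have h1 : ∀ σ, ∃ g ∈ J, ev σ g = ev σ f - p ^ n * r σ := by
      intro σ
      rw [← Ideal.mem_map_iff_of_surjective (ev σ) (evalGL_id_surjective _),
        ← Ideal.Quotient.mk_eq_mk_iff_sub_mem]
      have := congrFun hc σ
      rw [map_mul, hr]
      refine Eq.trans this ?_
      rw [map_pow, map_natCast]
      rfl
    choose g hgJ hg using h1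
    -- The idempotents of `O(W)` glue the local quotients by `pⁿ`; below they glue the corrections
    -- `g σ` as well, leaving a function that vanishes on `W`.
    let q : OGL p ι := ∑ σ, algebraMap (ZpUr p) (OGL p ι) (r σ) * permIdem p σ
    refine ⟨f - p ^ n * q, ?_, ?_⟩
    · have h2 : f - p ^ n * q - ∑ σ, g σ * permIdem p σ ∈ weylIdeal p ι := by
        refine mem_weylIdeal.mpr fun τ => ?_
        have h3 := hg τ
        simp only [ev] at h3
        rw [map_sub, evalGL_sum_mul_permIdem, h3, map_sub, map_mul, evalGL_sum_mul_permIdem,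
          evalGL_algebraMap]
        simp
      have h4 : ∑ σ, g σ * permIdem p σ ∈ J :=
        sum_mem fun σ _ => Ideal.mul_mem_right _ _ (hgJ σ)
      rw [← sub_add_cancel (f - p ^ n * q) (∑ σ, g σ * permIdem p σ)]
      exact Submodule.add_mem_sup h2 h4
    · rw [sub_sub_cancel, pIdeal, Ideal.span_singleton_pow]
      exact Ideal.mul_mem_right _ _ (Ideal.mem_span_singleton_self _)
  · have h : ψ.comp (algebraMap (ZpUr p) B) = (algebraMap (ZpUr p) B).comp (frob p) :=
      RingHom.ext fun r => funext fun σ => rfl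
    rw [RingHom.comp_assoc, h, ← RingHom.comp_assoc, ← IsScalarTower.algebraMap_eq]
  · have hcol : ColMonomial (b : Matrix ι ι B) := (colMonomial_of_weylIdeal hew).1
    rw [IsPhi.unique hp (isPhi_evalHat hφ _ _)
      (isPhi_powP_of_colMonomial hp (hcol.map (algebraMap B (Hat p B))))]
    refine Units.ext (Matrix.ext fun i j => ?_)
    change algebraMap B (Hat p B) (ψ ((b : Matrix ι ι B) i j)) =
      algebraMap B (Hat p B) ((b : Matrix ι ι B) i j) ^ p
    rw [hψ, map_pow]

namespace ClassicalGroup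

/-! ### Weights of the standard representation -/

/-- The character of `T_S` by which it acts on the `i`-th basis vector. -/
def weight {ι : Type} [DecidableEq ι] : ClassicalGroup ι → ι → ι → ℤ
  | gl _ => fun i => Pi.single i 1
  | soEven _ => Sum.elim (fun k => Pi.single (Sum.inl k) 1) fun k => -Pi.single (Sum.inl k) 1
  | soOdd _ => Sum.elim 0 (Sum.elim (fun k => Pi.single (Sum.inr (Sum.inl k)) 1)
      fun k => -Pi.single (Sum.inr (Sum.inl k)) 1)
  | sp _ => Sum.elim (fun k => Pi.single (Sum.inl k) 1) fun k => -Pi.single (Sum.inl k) 1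

variable {S : ClassicalGroup ι}

theorem weight_of_isGL (hS : S.isGL = true) (i : ι) : S.weight i = Pi.single i 1 := by
  cases S with
  | gl n => simp only [weight]; congr!
  | soEven r => simp [isGL] at hS
  | soOdd r => simp [isGL] at hS
  | sp r => simp [isGL] at hS

theorem weight_of_isCoord {i : ι} (hi : S.IsCoord i) : S.weight i = Pi.single i 1 := by
  cases S with
  | gl n => simp only [weight]; congr!
  | soEven r => rcases i with i | i <;> simp_all [IsCoord, weight]; congr!
  | soOdd r => rcases i with i | i | i <;> simp_all [IsCoord, weight]; congr!
  | sp r => rcases i with i | i <;> simp_all [IsCoord, weight]; congr!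

theorem weight_partner (hS : ¬ S.isGL = true) (i : ι) :
    S.weight (S.partner i) = -S.weight i := by
  cases S with
  | gl n => simp [isGL] at hS
  | soEven r => rcases i with i | i <;> simp [partner, weight]
  | soOdd r => rcases i with i | i | i <;> simp [partner, weight]
  | sp r => rcases i with i | i <;> simp [partner, weight]

theorem isCoord_or (hS : ¬ S.isGL = true) (i : ι) :
    S.IsCoord i ∨ S.IsCoord (S.partner i) ∨
      (S.partner i = i ∧ S.weight i = 0 ∧ ∀ j, S.partner j = j → j = i) := by
  cases S with
  | gl n => simp [isGL] at hS
  | soEven r => rcases i with i | i <;> simp [partner, IsCoord]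
  | soOdd r => rcases i with i | i | i <;> simp [partner, weight, IsCoord]
  | sp r => rcases i with i | i <;> simp [partner, IsCoord]

/-! ### The ideal of `S` -/

theorem fibreIdeal_eq_zero_iff {C : Type} [CommRing C] {e : OGL p ι →+* C} :
    (∀ f ∈ S.fibreIdeal p, e f = 0) ↔
      S.quad (Matrix.GeneralLinearGroup.map e (genX p ι)) = S.q C := by
  rw [← glMap_quad, ← S.glMap_q e]
  constructor
  · intro h
    refine Units.ext (Matrix.ext fun i j => ?_)
    have := h _ (Ideal.subset_span ⟨i, j, rfl⟩)
    rwa [map_sub, sub_eq_zero] at this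
  · intro h
    have h1 : S.fibreIdeal p ≤ RingHom.ker e := by
      rw [fibreIdeal, Ideal.span_le]
      rintro f ⟨i, j, rfl⟩
      rw [SetLike.mem_coe, RingHom.mem_ker, map_sub, sub_eq_zero]
      exact congrArg (fun g : GL ι C => (g : Matrix ι ι C) i j) h
    exact fun f hf => h1 hf

theorem mem_identityPoint {f : OGL p ι} :
    f ∈ (identityPoint ι p).asIdeal ↔ evalGL p (RingHom.id (ZpUr p)) 1 f = 0 := Iff.rfl

theorem identityPoint_mem : identityPoint ι p ∈
    connectedComponentIn (PrimeSpectrum.zeroLocus (S.fibreIdeal p : Set (OGL p ι)))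
      (identityPoint ι p) := by
  refine mem_connectedComponentIn fun f hf => mem_identityPoint.mpr ?_
  refine fibreIdeal_eq_zero_iff.mpr ?_ f hf
  rw [map_evalGL_genX, quad_one]

theorem fibreIdeal_le_groupIdeal : S.fibreIdeal p ≤ S.groupIdeal p := by
  intro f hf
  rw [groupIdeal, PrimeSpectrum.mem_vanishingIdeal]
  exact fun x hx => connectedComponentIn_subset _ _ hx hf

theorem det_genX_sq_sub_one_mem (hS : ¬ S.isGL = true) :
    (genX p ι : Matrix ι ι (OGL p ι)).det * (genX p ι : Matrix ι ι (OGL p ι)).det - 1 ∈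
      S.fibreIdeal p := by
  rw [← Ideal.Quotient.mk_eq_mk_iff_sub_mem, map_mul, map_one]
  set g := Matrix.GeneralLinearGroup.map (Ideal.Quotient.mk (S.fibreIdeal p)) (genX p ι)
    with hgdef
  have hg : S.quad g = S.q _ :=
    fibreIdeal_eq_zero_iff.mp fun f hf => Ideal.Quotient.eq_zero_iff_mem.mpr hf
  have hdet : Ideal.Quotient.mk (S.fibreIdeal p) (genX p ι : Matrix ι ι (OGL p ι)).det =
      Matrix.GeneralLinearGroup.det g := by
    rw [RingHom.map_det]
    rfl
  have htr : Matrix.GeneralLinearGroup.det (transposeGL g) = Matrix.GeneralLinearGroup.det g :=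
    Units.ext (Matrix.det_transpose _)
  have h := congrArg Matrix.GeneralLinearGroup.det hg
  rw [quad_of_not_isGL hS, map_mul, map_mul, htr] at h
  have h' := congrArg Units.val h
  rw [Units.val_mul, Units.val_mul] at h'
  rw [hdet]
  refine (Units.isUnit (Matrix.GeneralLinearGroup.det (S.q _))).mul_right_cancel ?_
  rw [one_mul]
  exact (mul_right_comm _ _ _).trans h'

/-- On `ℋ⁻¹(q)` the determinant squares to `1`. The loci `det = 1` and `det = -1` are closed and
disjoint since `2` is a unit, so the connected component of the identity lies in the first. This
pins down the middle entry of the torus of `SO_{2r+1}`. -/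
theorem det_genX_sub_one_mem (hp : p ≠ 2) (hS : ¬ S.isGL = true) :
    (genX p ι : Matrix ι ι (OGL p ι)).det - 1 ∈ S.groupIdeal p := by
  set d := (genX p ι : Matrix ι ι (OGL p ι)).det with hd
  have h2 : IsUnit (2 : OGL p ι) := by
    have := (isUnit_two_of_isAdicComplete hp (ZpUr p)).map (algebraMap (ZpUr p) (OGL p ι))
    rwa [map_ofNat] at this
  have hd1 : evalGL p (RingHom.id (ZpUr p)) 1 d = 1 := by
    rw [hd, RingHom.map_det]
    change (Matrix.GeneralLinearGroup.map (evalGL p (RingHom.id (ZpUr p)) 1)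
      (genX p ι) : Matrix ι ι (ZpUr p)).det = 1
    rw [map_evalGL_genX, Units.val_one, Matrix.det_one]
  rw [groupIdeal, PrimeSpectrum.mem_vanishingIdeal]
  have hcl : ∀ f : OGL p ι, IsClosed {x : PrimeSpectrum (OGL p ι) | f ∈ x.asIdeal} := by
    intro f
    have := PrimeSpectrum.isClosed_zeroLocus ({f} : Set (OGL p ι))
    convert this using 1
    ext x
    simp [PrimeSpectrum.mem_zeroLocus]
  have hpre := isPreconnected_iff_subset_of_disjoint_closed.mp
    (isPreconnected_connectedComponentIn (x := identityPoint ι p)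
      (F := PrimeSpectrum.zeroLocus (S.fibreIdeal p : Set (OGL p ι)))) _ _
    (hcl (d - 1)) (hcl (d + 1))
  have hcover : connectedComponentIn (PrimeSpectrum.zeroLocus (S.fibreIdeal p : Set (OGL p ι)))
      (identityPoint ι p) ⊆ {x | d - 1 ∈ x.asIdeal} ∪ {x | d + 1 ∈ x.asIdeal} := by
    intro x hx
    refine x.isPrime.mem_or_mem ?_
    rw [show (d - 1) * (d + 1) = d * d - 1 by ring]
    exact connectedComponentIn_subset _ _ hx (det_genX_sq_sub_one_mem (p := p) hS)
  have hdisj : connectedComponentIn (PrimeSpectrum.zeroLocus (S.fibreIdeal p : Set (OGL p ι)))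
      (identityPoint ι p) ∩ ({x | d - 1 ∈ x.asIdeal} ∩ {x | d + 1 ∈ x.asIdeal}) = ∅ := by
    rw [Set.eq_empty_iff_forall_notMem]
    rintro x ⟨-, hx1, hx2⟩
    refine x.isPrime.ne_top (Ideal.eq_top_of_isUnit_mem _ ?_ h2)
    rw [show (2 : OGL p ι) = d + 1 - (d - 1) by ring]
    exact sub_mem hx2 hx1
  rcases hpre hcover hdisj with h | h
  · exact fun x hx => h hx
  · have h3 := mem_identityPoint.mp (h identityPoint_mem)
    rw [map_add, map_one, hd1, one_add_one_eq_two] at h3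
    exact absurd h3 (isUnit_two_of_isAdicComplete hp (ZpUr p)).ne_zero

/-- `Spec L` is connected, and its image contains the identity point because `g` specializes to `1`
under `c`; hence it stays in the component. Vanishing at the generic point of the domain `L` means
being zero. -/
theorem evalGL_groupIdeal {L : Type} [CommRing L] [IsDomain L] [Algebra (ZpUr p) L] {g : GL ι L}
    (hg : S.quad g = S.q L) (c : L →+* ZpUr p)
    (hc : c.comp (algebraMap (ZpUr p) L) = RingHom.id _)
    (hcg : Matrix.GeneralLinearGroup.map c g = 1) :
    ∀ f ∈ S.groupIdeal p, evalGL p (algebraMap (ZpUr p) L) g f = 0 := by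
  intro f hf
  set e := evalGL p (algebraMap (ZpUr p) L) g with he
  have hce : c.comp e = evalGL p (RingHom.id (ZpUr p)) 1 := by
    apply oGL_ringHom_ext
    · rw [RingHom.comp_assoc, evalGL_comp_algebraMap, evalGL_comp_algebraMap, hc]
    · rw [glMap_comp, map_evalGL_genX, map_evalGL_genX, hcg]
  have hrange : Set.range (PrimeSpectrum.comap e) ⊆
      connectedComponentIn (PrimeSpectrum.zeroLocus (S.fibreIdeal p : Set (OGL p ι)))
        (identityPoint ι p) := by
    refine IsPreconnected.subset_connectedComponentIn ?_ ?_ ?_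
    · exact isPreconnected_range (PrimeSpectrum.continuous_comap e)
    · refine ⟨PrimeSpectrum.comap c ⟨⊥, Ideal.isPrime_bot⟩, ?_⟩
      rw [← PrimeSpectrum.comap_comp_apply, hce]
      rfl
    · rintro _ ⟨x, rfl⟩ f hf
      rw [SetLike.mem_coe, PrimeSpectrum.comap_asIdeal, Ideal.mem_comap,
        fibreIdeal_eq_zero_iff.mpr (by rw [he, map_evalGL_genX, hg]) f hf]
      exact zero_mem _
  have := (PrimeSpectrum.mem_vanishingIdeal _ _).mp hf _ (hrange ⟨⟨⊥, Ideal.isPrime_bot⟩, rfl⟩)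
  exact this

/-! ### The torus and the Weyl group of `S` -/

theorem quad_diagGL_apply (hS : ¬ S.isGL = true) {C : Type} [CommRing C] (d : ι → Cˣ) (i j : ι) :
    (S.quad (diagGL d) : Matrix ι ι C) i j = d i * S.qMatrix i j * d j := by
  rw [quad_of_not_isGL hS]
  change ((Matrix.diagonal fun i => (d i : C))ᵀ * (S.q C : Matrix ι ι C) *
    Matrix.diagonal fun i => (d i : C)) i j = _
  rw [Matrix.diagonal_transpose, Matrix.mul_diagonal, Matrix.diagonal_mul]
  rfl

theorem quad_diagGL_eq_iff (hS : ¬ S.isGL = true) {C : Type} [CommRing C] (d : ι → Cˣ) :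
    S.quad (diagGL d) = S.q C ↔ ∀ i, d i * d (S.partner i) = 1 := by
  constructor
  · intro h i
    have h1 := congrArg (fun g : GL ι C => (g : Matrix ι ι C) i (S.partner i)) h
    simp only [quad_diagGL_apply hS, q_apply] at h1
    refine Units.ext ?_
    rcases S.qMatrix_partner i with hq | hq
    · simpa [hq] using h1
    · simpa [hq] using h1
  · intro h
    refine Units.ext (Matrix.ext fun i j => ?_)
    rw [quad_diagGL_apply hS, q_apply]
    by_cases hj : j = S.partner i
    · subst hj
      rw [mul_right_comm, ← Units.val_mul, h, Units.val_one, one_mul]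
    · rw [S.qMatrix_of_ne hj]
      simp

theorem quad_torusPoint : S.quad (torusPoint p S.weight) = S.q (CharRing p ι) := by
  by_cases hS : S.isGL = true
  · rw [quad_of_isGL hS, q_of_isGL hS]
  · rw [torusPoint, quad_diagGL_eq_iff hS]
    intro i
    rw [← charUnit_add, weight_partner hS, add_neg_cancel]
    exact Units.ext rfl

theorem torusPoint_mem : torusPoint p S.weight ∈ points p (S.torusS p) (CharRing p ι) := by
  -- Sending all characters to `1` specializes the generic torus point to the identity.
  obtain ⟨c, hcR, hc⟩ := exists_charRing_lift (p := p) (ι := ι) (RingHom.id _) 1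
  have h1 : S.torusS p ≤ RingHom.ker
      (evalGL p (algebraMap (ZpUr p) _) (torusPoint p S.weight)) := by
    refine sup_le ?_ ?_
    · refine fun f hf => map_torusIdeal_eq_zero (fun i j hij => ?_) f hf
      rw [map_evalGL_genX]
      exact diagGL_apply_ne _ hij
    · refine fun f hf => evalGL_groupIdeal quad_torusPoint c hcR ?_ f hf
      refine Units.ext (Matrix.ext fun i j => ?_)
      change c ((torusPoint p S.weight).val i j) = (1 : Matrix ι ι (ZpUr p)) i j
      rcases eq_or_ne i j with rfl | hij
      · rw [torusPoint, diagGL_apply_eq, hc, Matrix.one_apply_eq]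
        rfl
      · rw [torusPoint, diagGL_apply_ne _ hij, map_zero, Matrix.one_apply_ne hij]
  exact fun f hf => h1 hf

/-- The retraction hypothesis of `horizontal_of_torus` for `T_S`: every diagonal entry is a monomial
in the coordinate ones. -/
theorem prod_zpow_weight (hp : p ≠ 2) (u : ι → (OGL p ι ⧸ S.torusS p)ˣ)
    (hu : ∀ i, (u i : OGL p ι ⧸ S.torusS p) =
      Ideal.Quotient.mk (S.torusS p) ((genX p ι : Matrix ι ι (OGL p ι)) i i)) (i : ι) :
    ∏ j, u j ^ S.weight i j = u i := by
  by_cases hS : S.isGL = true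
  · rw [weight_of_isGL hS]
    exact (prod_zpow_single u i 1).trans (zpow_one _)
  have hdiag : Matrix.GeneralLinearGroup.map (Ideal.Quotient.mk (S.torusS p)) (genX p ι) =
      diagGL u := by
    refine Units.ext (Matrix.ext fun i j => ?_)
    rcases eq_or_ne i j with rfl | hij
    · rw [diagGL_apply_eq, hu]
      rfl
    · rw [diagGL_apply_ne _ hij, diag_of_torusIdeal_le (fun f hf => ?_) hij]
      exact Ideal.Quotient.eq_zero_iff_mem.mpr (Ideal.mem_sup_left hf)
  have hpair : ∀ i, u i * u (S.partner i) = 1 := by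
    rw [← quad_diagGL_eq_iff hS, ← hdiag]
    exact fibreIdeal_eq_zero_iff.mp fun f hf => Ideal.Quotient.eq_zero_iff_mem.mpr
      (Ideal.mem_sup_right (fibreIdeal_le_groupIdeal hf))
  rcases isCoord_or hS i with h | h | ⟨h, hw, hfix⟩
  · rw [weight_of_isCoord h]
    exact (prod_zpow_single u i 1).trans (zpow_one _)
  · have hw : S.weight i = Pi.single (S.partner i) (-1) := by
      rw [← neg_neg (S.weight i), ← weight_partner hS, weight_of_isCoord h, Pi.single_neg]
    rw [hw, prod_zpow_single u, zpow_neg_one]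
    exact inv_eq_of_mul_eq_one_left (hpair i)
  · have hdet : ∏ j, u j = 1 := by
      have h1 : Ideal.Quotient.mk (S.torusS p) ((genX p ι : Matrix ι ι (OGL p ι)).det - 1) = 0 :=
        Ideal.Quotient.eq_zero_iff_mem.mpr (Ideal.mem_sup_right (det_genX_sub_one_mem hp hS))
      rw [map_sub, map_one, sub_eq_zero, RingHom.map_det] at h1
      change (Matrix.GeneralLinearGroup.map (Ideal.Quotient.mk (S.torusS p))
        (genX p ι)).val.det = 1 at h1
      rw [hdiag] at h1
      change (Matrix.diagonal fun i => (u i : OGL p ι ⧸ S.torusS p)).det = 1 at h1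
      rw [Matrix.det_diagonal] at h1
      exact Units.ext (by simpa using h1)
    -- The other entries cancel in pairs of partners, so determinant `1` leaves the middle entry
    -- equal to `1`.
    have h1 : ∏ j ∈ Finset.univ.erase i, u j = 1 := by
      refine Finset.prod_involution (fun j _ => S.partner j) (fun j _ => hpair j) ?_ ?_ ?_
      · intro j hj _ hjj
        exact Finset.ne_of_mem_erase hj (hfix j hjj)
      · intro j hj
        refine Finset.mem_erase.mpr ⟨fun hji => Finset.ne_of_mem_erase hj ?_, Finset.mem_univ _⟩
        rw [← S.partner_partner j, hji, h]
      · exact fun j _ => S.partner_partner j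
    rw [← Finset.mul_prod_erase _ _ (Finset.mem_univ i), h1, mul_one] at hdet
    rw [hw, hdet]
    simp

theorem horizontal_torusS (hp : p ≠ 2) {φ : FrobLift p ι}
    (hφ : S.IsPhi p (genXhat p ι) φ.mat) : Horizontal p φ (S.torusS p) :=
  horizontal_of_torus hp hφ le_sup_left S.weight torusPoint_mem (prod_zpow_weight hp)

/-- The common properties of points of `T_S` and of `W_S`. -/
theorem colMonomial_of_torusS {C : Type} [CommRing C] {e : OGL p ι →+* C}
    (he : ∀ f ∈ S.torusS p, e f = 0) :
    ColMonomial (Matrix.GeneralLinearGroup.map e (genX p ι) : Matrix ι ι C) ∧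
      ColMonomial (Matrix.GeneralLinearGroup.map e (genX p ι) : Matrix ι ι C)ᵀ ∧
        S.quad (Matrix.GeneralLinearGroup.map e (genX p ι)) = S.q C := by
  have hd : ∀ i j, i ≠ j → (Matrix.GeneralLinearGroup.map e (genX p ι) : Matrix ι ι C) i j = 0 :=
    fun i j hij => diag_of_torusIdeal_le (fun f hf => he f (Ideal.mem_sup_left hf)) hij
  refine ⟨colMonomial_of_diagonal hd, colMonomial_of_diagonal fun i j hij => hd j i hij.symm,
    fibreIdeal_eq_zero_iff.mp fun f hf => he f ?_⟩
  exact Ideal.mem_sup_right (fibreIdeal_le_groupIdeal hf)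

theorem colMonomial_of_weylS {C : Type} [CommRing C] {e : OGL p ι →+* C}
    (he : ∀ f ∈ S.weylS p, e f = 0) :
    ColMonomial (Matrix.GeneralLinearGroup.map e (genX p ι) : Matrix ι ι C) ∧
      ColMonomial (Matrix.GeneralLinearGroup.map e (genX p ι) : Matrix ι ι C)ᵀ ∧
        S.quad (Matrix.GeneralLinearGroup.map e (genX p ι)) = S.q C := by
  have h := colMonomial_of_weylIdeal fun f hf => he f (Ideal.mem_sup_left hf)
  refine ⟨h.1, h.2, fibreIdeal_eq_zero_iff.mp fun f hf => he f ?_⟩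
  exact Ideal.mem_sup_right (fibreIdeal_le_groupIdeal hf)

theorem map_mk_algebraMap_eq_zero {I : Ideal (OGL p ι)} :
    ∀ f ∈ I, ((Ideal.Quotient.mk (I.map (algebraMap (OGL p ι) (OGLhat p ι)))).comp
      (algebraMap (OGL p ι) (OGLhat p ι))) f = 0 := fun _ hf =>
  Ideal.Quotient.eq_zero_iff_mem.mpr (Ideal.mem_map_of_mem _ hf)

theorem compatible (hp : p ≠ 2) {φ : FrobLift p ι} (hφ : S.IsPhi p (genXhat p ι) φ.mat) :
    RightCompatible p φ (torusIdeal p ι) ∧ RightCompatible p φ (weylIdeal p ι) ∧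
      LeftCompatible p φ (S.torusS p) ∧ LeftCompatible p φ (S.weylS p) := by
  refine ⟨?_, ?_, ?_, ?_⟩
  · exact rightCompatible_of_colMonomial hp hφ (horizontal_torusIdeal hp hφ)
      (colMonomial_of_diagonal fun i j hij => diag_of_torusIdeal_le map_mk_algebraMap_eq_zero hij)
  · have h := horizontal_weylIdeal_sup hp hφ ⊥
    rw [sup_bot_eq] at h
    exact rightCompatible_of_colMonomial hp hφ h
      (colMonomial_of_weylIdeal map_mk_algebraMap_eq_zero).1
  · have h := colMonomial_of_torusS (S := S) (p := p) map_mk_algebraMap_eq_zero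
    exact leftCompatible_of_colMonomial hp hφ (horizontal_torusS hp hφ) h.1 h.2.1 h.2.2
  · have h := colMonomial_of_weylS (S := S) (p := p) map_mk_algebraMap_eq_zero
    exact leftCompatible_of_colMonomial hp hφ (horizontal_weylIdeal_sup hp hφ _) h.1 h.2.1 h.2.2

theorem logDeriv_mul_left (hp : p ≠ 2) {φ : FrobLift p ι} (hφ : S.IsPhi p (genXhat p ι) φ.mat)
    {t w : GL ι (ZpUr p)} (ht : t ∈ points p (S.torusS p) (ZpUr p))
    (hw : w ∈ points p (S.weylS p) (ZpUr p)) (b : GL ι (ZpUr p)) :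
    logDeriv p φ (t * w * b) =
      addDelta p (starDelta p (t * w) (logDeriv p φ b)) (logDeriv p φ (t * w)) := by
  have ht' := colMonomial_of_torusS ht
  have hw' := colMonomial_of_weylS hw
  rw [map_evalGL_genX] at ht' hw'
  refine logDeriv_mul ?_
  rw [mul_assoc, phiAt_mul_left hp hφ _ ht'.1 ht'.2.1 ht'.2.2,
    phiAt_mul_left hp hφ _ hw'.1 hw'.2.1 hw'.2.2,
    phiAt_mul_left hp hφ _ ht'.1 ht'.2.1 ht'.2.2, mul_assoc]

theorem logDeriv_mul_right (hp : p ≠ 2) {φ : FrobLift p ι} (hφ : S.IsPhi p (genXhat p ι) φ.mat)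
    (a : GL ι (ZpUr p)) {t w : GL ι (ZpUr p)} (ht : t ∈ points p (torusIdeal p ι) (ZpUr p))
    (hw : w ∈ points p (weylIdeal p ι) (ZpUr p)) :
    logDeriv p φ (a * (t * w)) =
      addDelta p (starDelta p a (logDeriv p φ (t * w))) (logDeriv p φ a) := by
  have ht' : ColMonomial (t : Matrix ι ι (ZpUr p)) := by
    have := fun i j => diag_of_torusIdeal_le (i := i) (j := j) ht
    rw [map_evalGL_genX] at this
    exact colMonomial_of_diagonal this
  have hw' := (colMonomial_of_weylIdeal hw).1
  rw [map_evalGL_genX] at hw'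
  refine logDeriv_mul ?_
  rw [← mul_assoc, phiAt_mul_right hp hφ _ hw', phiAt_mul_right hp hφ _ ht',
    phiAt_mul_right hp hφ _ hw', mul_assoc]


/-! ### Root groups -/

theorem weight_dotProduct_of_isGL (hS : S.isGL = true) (i j : ι) :
    S.weight i ⬝ᵥ S.weight j = if i = j then 1 else 0 := by
  rw [weight_of_isGL hS, weight_of_isGL hS, single_dotProduct, one_mul, Pi.single_apply]

/-- Weights are signed orthonormal vectors, opposite at partners; at the middle index the two terms
cancel and the weight is `0`. The formula makes the root combinatorics uniform in the type of `S`.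
-/
theorem weight_dotProduct (hS : ¬ S.isGL = true) (i j : ι) :
    S.weight i ⬝ᵥ S.weight j = (if i = j then 1 else 0) - if S.partner i = j then 1 else 0 := by
  have hc : ∀ i j, S.IsCoord i → S.IsCoord j →
      S.weight i ⬝ᵥ S.weight j = if i = j then 1 else 0 := by
    intro i j hi hj
    rw [weight_of_isCoord hi, weight_of_isCoord hj, single_dotProduct, one_mul, Pi.single_apply]
  have hne : ∀ i, S.IsCoord i → ¬ S.IsCoord (S.partner i) := by
    intro i
    cases S with
    | gl n => simp [isGL] at hS
    | soEven r => rcases i with i | i <;> simp [partner, IsCoord]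
    | soOdd r => rcases i with i | i | i <;> simp [partner, IsCoord]
    | sp r => rcases i with i | i <;> simp [partner, IsCoord]
  have hinj : ∀ {i j}, S.partner i = S.partner j → i = j := by
    intro i j h
    rw [← S.partner_partner i, h, S.partner_partner]
  have hcp : ∀ i j, S.IsCoord i → S.IsCoord (S.partner j) →
      S.weight i ⬝ᵥ S.weight j = (if i = j then 1 else 0) -
        if S.partner i = j then 1 else 0 := by
    intro i j hi hj
    have h := hc i _ hi hj
    rw [weight_partner hS, dotProduct_neg] at h
    rw [← neg_neg (S.weight i ⬝ᵥ S.weight j), h, if_neg (c := i = j) (fun hij => hne i hi (hij ▸ hj)), zero_sub]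
    congr 2
    refine propext ⟨fun h' => ?_, fun h' => ?_⟩
    · rw [h', S.partner_partner]
    · rw [← h', S.partner_partner]
  rcases isCoord_or hS i with hi | hi | ⟨hi, hwi, -⟩
  · rcases isCoord_or hS j with hj | hj | ⟨hj, hwj, -⟩
    · rw [hc i j hi hj, if_neg (c := S.partner i = j) (fun h => hne i hi (h ▸ hj)), sub_zero]
    · exact hcp i j hi hj
    · rw [hwj, dotProduct_zero]
      have : S.partner i = j ↔ i = j := by
        nth_rw 1 [← hj]
        exact ⟨hinj, congrArg _⟩
      simp [this]
  · rw [← neg_neg (S.weight i), ← weight_partner hS, neg_dotProduct]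
    rcases isCoord_or hS j with hj | hj | ⟨hj, hwj, -⟩
    · rw [hc _ _ hi hj, if_neg (c := i = j) (fun h => hne j hj (h ▸ hi)), zero_sub]
    · rw [hcp _ _ hi hj, S.partner_partner, neg_sub]
    · rw [hwj, dotProduct_zero]
      have : S.partner i = j ↔ i = j := by
        nth_rw 1 [← hj]
        exact ⟨hinj, congrArg _⟩
      simp [this]
  · rw [hwi, zero_dotProduct, hi, sub_self]

/-! ### Lengths of roots and differences of weights -/

theorem sum_sq_eq_dotProduct (χ : ι → ℤ) : ∑ i, χ i ^ 2 = χ ⬝ᵥ χ :=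
  Finset.sum_congr rfl fun _ _ => sq _

theorem dotProduct_weight_sub (i j : ι) :
    (S.weight i - S.weight j) ⬝ᵥ (S.weight i - S.weight j) =
      S.weight i ⬝ᵥ S.weight i + S.weight j ⬝ᵥ S.weight j - 2 * S.weight i ⬝ᵥ S.weight j := by
  rw [sub_dotProduct, dotProduct_sub, dotProduct_sub, dotProduct_comm (S.weight j) (S.weight i)]
  ring

theorem dotProduct_weight_sub_le (i j : ι) :
    (S.weight i - S.weight j) ⬝ᵥ (S.weight i - S.weight j) ≤ 4 := by
  rw [dotProduct_weight_sub]
  by_cases hS : S.isGL = true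
  · simp only [weight_dotProduct_of_isGL hS]
    split_ifs <;> simp
  · simp only [weight_dotProduct hS]
    split_ifs <;> simp

/-- A difference of two weights that is not a short root of an odd orthogonal group has length at
least `√2`. -/
theorem two_le_dotProduct {χ : ι → ℤ} (hχ : S.IsRoot p χ)
    (hn : ¬ (S.IsOddOrthogonal ∧ S.IsShortestRoot p χ)) {i j : ι}
    (hij : S.weight i - S.weight j = χ) : 2 ≤ χ ⬝ᵥ χ := by
  have hpos : ∀ χ : ι → ℤ, χ ≠ 0 → 1 ≤ χ ⬝ᵥ χ := by
    intro χ h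
    have h1 : χ ⬝ᵥ χ ≠ 0 := fun h' => h (dotProduct_self_eq_zero.mp h')
    have h2 : 0 ≤ χ ⬝ᵥ χ := Finset.sum_nonneg fun i _ => mul_self_nonneg _
    omega
  by_cases ho : S.IsOddOrthogonal
  · by_contra hlt
    -- A nonzero integer vector has squared length at least `1`, so a root of squared length below
    -- `2` is a shortest one.
    refine hn ⟨ho, hχ, fun χ' hχ' => ?_⟩
    rw [sum_sq_eq_dotProduct, sum_sq_eq_dotProduct]
    have := hpos χ' hχ'.2.1
    omega
  · have hne : i ≠ j := by
      rintro rfl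
      exact hχ.2.1 (by rw [← hij, sub_self])
    rw [← hij, dotProduct_weight_sub]
    by_cases hS : S.isGL = true
    · simp [weight_dotProduct_of_isGL hS, hne]
    · have hp : ∀ i, S.partner i ≠ i := by
        intro i
        cases S with
        | gl n => simp [isGL] at hS
        | soEven r => rcases i with i | i <;> simp [partner]
        | soOdd r => simp [IsOddOrthogonal] at ho
        | sp r => rcases i with i | i <;> simp [partner]
      simp only [weight_dotProduct hS, if_neg (hp _), if_neg hne]
      split_ifs <;> simp

/-- The pairs of weights with a given difference. -/
theorem eq_or_eq_of_weight_sub_eq {χ : ι → ℤ} (hχ : 2 ≤ χ ⬝ᵥ χ) {a b i j : ι}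
    (hab : S.weight a - S.weight b = χ) (hij : S.weight i - S.weight j = χ) :
    (i = a ∧ j = b) ∨ (¬ S.isGL = true ∧ i = S.partner b ∧ j = S.partner a) := by
  have hχ' := hχ
  rw [← hab, dotProduct_weight_sub] at hχ'
  have hne : a ≠ b := by
    rintro rfl
    rw [sub_self] at hab
    rw [← hab, zero_dotProduct] at hχ
    omega
  have hdot : ∀ c, S.weight c ⬝ᵥ S.weight i - S.weight c ⬝ᵥ S.weight j =
      S.weight c ⬝ᵥ S.weight a - S.weight c ⬝ᵥ S.weight b := by
    intro c
    rw [← dotProduct_sub, ← dotProduct_sub, hij, hab]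
  by_cases hS : S.isGL = true
  · left
    have ha := hdot a
    have hb := hdot b
    simp only [weight_dotProduct_of_isGL hS, if_true, if_neg hne, if_neg hne.symm] at ha hb
    have hai : a = i := by
      by_contra h
      rw [if_neg h] at ha
      split_ifs at ha <;> simp at ha
    have hbj : b = j := by
      by_contra h
      rw [if_neg h] at hb
      split_ifs at hb <;> simp at hb
    exact ⟨hai.symm, hbj.symm⟩
  · have hda := weight_dotProduct hS a
    -- `a` is not the middle index: its weight would be `0`, and `χ` would have squared length at
    -- most `1`. The same holds for `b`.
    have hpa : S.partner a ≠ a := by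
      intro h
      simp only [hda, weight_dotProduct hS b b, h, if_true] at hχ'
      split_ifs at hχ' <;> simp at hχ'
    have hpb : S.partner b ≠ b := by
      intro h
      have h1 : S.weight a ⬝ᵥ S.weight b = 0 := by
        rw [dotProduct_comm, weight_dotProduct hS, h, sub_self]
      simp only [h1, weight_dotProduct hS b b, weight_dotProduct hS a a, h, if_true] at hχ'
      split_ifs at hχ' <;> simp at hχ'
    -- Away from the middle index, an index is determined by its weight.
    have hw : ∀ {c d}, S.partner c ≠ c → S.weight c = S.weight d → c = d := by
      intro c d hc h
      have h1 := weight_dotProduct hS c d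
      rw [← h, weight_dotProduct hS, if_pos rfl, if_neg hc] at h1
      by_contra hcd
      rw [if_neg hcd] at h1
      split_ifs at h1 <;> simp at h1
    have ha := hdot a
    simp only [hda, if_true, if_neg hpa, if_neg hne] at ha
    by_cases hai : a = i
    · left
      refine ⟨hai.symm, (hw hpb ?_).symm⟩
      rw [← hai, ← hab] at hij
      exact (sub_right_injective hij).symm
    · right
      -- Pairing the difference with the weight of `a` gives at least `1`, which requires `i = a` or
      -- `j = S.partner a`.
      have haj : S.partner a = j := by
        by_contra h
        rw [if_neg hai, if_neg h] at ha
        split_ifs at ha <;> simp at ha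
      refine ⟨hS, (hw ?_ ?_).symm, haj.symm⟩
      · rw [S.partner_partner]
        exact hpb.symm
      · rw [weight_partner hS]
        rw [← haj, weight_partner hS, ← hab] at hij
        have := congrArg (fun v => v - S.weight a) hij
        simpa using this.symm

/-! ### Roots and root groups tested at the generic point of the torus -/

theorem charValue_charUnit {χ : ι → ℤ} (hχ : S.IsCharacter χ) :
    charValue χ (fun i => charUnit p (S.weight i)) = charUnit p χ := by
  rw [charValue]
  simp only [← charUnit_zsmul]
  rw [← charUnit_sum]
  congr 1
  conv_rhs => rw [← Finset.univ_sum_single χ]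
  refine Finset.sum_congr rfl fun i _ => ?_
  by_cases hi : S.IsCoord i
  · rw [weight_of_isCoord hi, ← Pi.single_smul, smul_eq_mul, mul_one]
  · rw [hχ i hi, zero_smul, Pi.single_zero]

theorem diagGL_conj_apply {C : Type} [CommRing C] (d : ι → Cˣ) (M : Matrix ι ι C) (i j : ι) :
    ((diagGL d : Matrix ι ι C) * M * ((diagGL d)⁻¹ : GL ι C)) i j =
      d i * M i j * ((d j)⁻¹ : Cˣ) := by
  change ((Matrix.diagonal fun i => (d i : C)) * M *
    Matrix.diagonal fun i => (((d i)⁻¹ : Cˣ) : C)) i j = _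
  rw [Matrix.mul_diagonal, Matrix.diagonal_mul]

theorem charUnit_conj (r : ZpUr p) (m n : ι → ℤ) :
    (charUnit p m : CharRing p ι) * algebraMap (ZpUr p) (CharRing p ι) r *
      ((charUnit p n)⁻¹ : (CharRing p ι)ˣ) = AddMonoidAlgebra.single (m - n) r := by
  change AddMonoidAlgebra.single m 1 * AddMonoidAlgebra.single 0 r *
    AddMonoidAlgebra.single (-n) 1 = _
  rw [AddMonoidAlgebra.single_mul_single, AddMonoidAlgebra.single_mul_single, add_zero, one_mul,
    mul_one, sub_eq_add_neg]

/-- At the generic torus point, the equation for a nonzero entry `a i j` compares two monomials of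
`R[ℤ^ι]`, so their exponents agree. -/
theorem IsRoot.exists_weight_sub {χ : ι → ℤ} (hχ : S.IsRoot p χ) :
    ∃ i j, S.weight i - S.weight j = χ := by
  obtain ⟨hc, -, a, -, ha, h⟩ := hχ
  obtain ⟨i, j, hij⟩ : ∃ i j, a i j ≠ 0 := by
    by_contra! hall
    exact ha (Matrix.ext hall)
  refine ⟨i, j, ?_⟩
  have h1 := congrFun (congrFun (h (CharRing p ι) _ torusPoint_mem) i) j
  rw [diagGL_conj_apply, Matrix.map_apply, charUnit_conj, charValue_charUnit hc,
    Matrix.smul_apply, Matrix.map_apply, smul_eq_mul] at h1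
  change _ = AddMonoidAlgebra.single χ 1 * AddMonoidAlgebra.single 0 (a i j) at h1
  rw [AddMonoidAlgebra.single_mul_single, add_zero, one_mul] at h1
  exact (AddMonoidAlgebra.single_left_inj hij).mp h1

/-- The coefficients of a parametrization of a root group are supported at weights that are
multiples of the root. -/
theorem weight_sub_eq_of_coeff_ne_zero {χ : ι → ℤ} (hc : S.IsCharacter χ) (h0 : χ ≠ 0)
    {u : GL ι (ZpUr p)[X]}
    (hu : ∀ (C : Type) [CommRing C] [Algebra (ZpUr p) C] (d : ι → Cˣ) (c : C),
      diagGL d ∈ points p (S.torusS p) C →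
      diagGL d * evalParam p u c * (diagGL d)⁻¹ = evalParam p u ((charValue χ d : C) * c))
    {i j : ι} {k : ℕ} (hk : ((u : Matrix ι ι (ZpUr p)[X]) i j).coeff k ≠ 0) :
    S.weight i - S.weight j = k • χ := by
  -- At the generic torus point with parameter `1`, the left side is a single monomial of exponent
  -- `S.weight i - S.weight j`, and the right side has the coefficients of `u i j` at the multiples
  -- `l • χ`. These are distinct because `χ ≠ 0`.
  have h1 := congrArg (fun g : GL ι (CharRing p ι) => g.val i j)
    (hu (CharRing p ι) _ 1 torusPoint_mem)
  beta_reduce at h1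
  rw [Units.val_mul, Units.val_mul, diagGL_conj_apply, charValue_charUnit hc, mul_one] at h1
  change _ * Polynomial.aeval (1 : CharRing p ι) ((u : Matrix ι ι (ZpUr p)[X]) i j) * _ =
    Polynomial.aeval (AddMonoidAlgebra.single χ 1 : CharRing p ι)
      ((u : Matrix ι ι (ZpUr p)[X]) i j) at h1
  set f := (u : Matrix ι ι (ZpUr p)[X]) i j
  rw [← map_one (algebraMap (ZpUr p) (CharRing p ι)), Polynomial.aeval_algebraMap_apply,
    charUnit_conj] at h1
  generalize Polynomial.aeval (1 : ZpUr p) f = r at h1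
  rw [Polynomial.aeval_eq_sum_range] at h1
  by_contra hne
  have h2 := congrArg (fun x => AddMonoidAlgebra.coeff x (k • χ)) h1
  simp only [AddMonoidAlgebra.single_pow, AddMonoidAlgebra.coeff_sum, one_pow,
    AddMonoidAlgebra.coeff_single, AddMonoidAlgebra.coeff_smul, Finsupp.finsetSum_apply,
    Finsupp.smul_apply, Finsupp.single_apply, smul_eq_mul, if_neg hne] at h2
  rw [Finset.sum_eq_single k] at h2
  · rw [if_pos rfl, mul_one] at h2
    exact hk h2.symm
  · intro l _ hl
    rw [if_neg, mul_zero]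
    intro h
    have : ((l : ℤ) - k) • χ = 0 := by
      rw [sub_smul, natCast_zsmul, natCast_zsmul, h, sub_self]
    rcases smul_eq_zero.mp this with h3 | h3
    · omega
    · exact h0 h3
  · intro hl
    rw [Polynomial.coeff_eq_zero_of_natDegree_lt (by simpa using hl), zero_mul]

theorem coeff_zero_eq_one {u : GL ι (ZpUr p)[X]}
    (hu : ∀ (C : Type) [CommRing C] [Algebra (ZpUr p) C] (b c : C),
      evalParam p u (b + c) = evalParam p u b * evalParam p u c) (i j : ι) :
    ((u : Matrix ι ι (ZpUr p)[X]) i j).coeff 0 = (1 : Matrix ι ι (ZpUr p)) i j := by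
  have h := hu (ZpUr p) 0 0
  rw [add_zero, eq_comm, mul_eq_left] at h
  have h1 := congrArg (fun g : GL ι (ZpUr p) => g.val i j) h
  rw [Polynomial.coeff_zero_eq_aeval_zero]
  exact h1

theorem map_coeff_zero_mul {R : Type*} [CommRing R] (M N : Matrix ι ι R[X]) :
    (M * N).map (fun f => f.coeff 0) = M.map (fun f => f.coeff 0) * N.map (fun f => f.coeff 0) := by
  ext i j
  rw [Matrix.map_apply, Matrix.mul_apply, Polynomial.finsetSum_coeff, Matrix.mul_apply]
  exact Finset.sum_congr rfl fun k _ => Polynomial.mul_coeff_zero _ _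

theorem map_coeff_one_mul {R : Type*} [CommRing R] (M N : Matrix ι ι R[X]) :
    (M * N).map (fun f => f.coeff 1) = M.map (fun f => f.coeff 0) * N.map (fun f => f.coeff 1) +
      M.map (fun f => f.coeff 1) * N.map (fun f => f.coeff 0) := by
  ext i j
  rw [Matrix.map_apply, Matrix.mul_apply, Polynomial.finsetSum_coeff, Matrix.add_apply,
    Matrix.mul_apply, Matrix.mul_apply, ← Finset.sum_add_distrib]
  exact Finset.sum_congr rfl fun k _ => Polynomial.mul_coeff_one _ _

/-- The derivative at the identity of a one-parameter subgroup of `S` lies in the Lie algebra. -/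
theorem qMatrix_mul_add_eq_zero (hS : ¬ S.isGL = true) {u : GL ι (ZpUr p)[X]}
    (hq : S.quad u = S.q _) (h0 : u.val.map (fun f => f.coeff 0) = 1) (a b : ι) :
    (S.qMatrix (S.partner a) a : ZpUr p) * (u.val a b).coeff 1 +
      (u.val (S.partner b) (S.partner a)).coeff 1 * (S.qMatrix (S.partner b) b : ZpUr p) = 0 := by
  rw [quad_of_not_isGL hS] at hq
  have h := congrArg (fun g : GL ι (ZpUr p)[X] => g.val.map (fun f => f.coeff 1)) hq
  have hq1 : (S.q (ZpUr p)[X]).val.map (fun f => f.coeff 1) = 0 := by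
    ext i j
    rw [Matrix.map_apply, q_apply, ← Polynomial.C_eq_intCast,
      Polynomial.coeff_C_of_ne_zero one_ne_zero, Matrix.zero_apply]
  have hq0 : (S.q (ZpUr p)[X]).val.map (fun f => f.coeff 0) =
      S.qMatrix.map (Int.cast : ℤ → ZpUr p) := by
    ext i j
    rw [Matrix.map_apply, q_apply, ← Polynomial.C_eq_intCast, Polynomial.coeff_C_zero,
      Matrix.map_apply]
  have ht0 : (transposeGL u).val.map (fun f => f.coeff 0) = 1 := by
    change (u.val.map (fun f => f.coeff 0))ᵀ = 1
    rw [h0, Matrix.transpose_one]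
  simp only [Units.val_mul, map_coeff_one_mul, map_coeff_zero_mul, hq1, hq0, h0, ht0, one_mul,
    mul_one, zero_add] at h
  -- This is `qN + Nᵗq = 0` for the linear coefficient `N`; in each product one summand survives,
  -- since `q` is a signed permutation matrix.
  have h2 := congrFun (congrFun h (S.partner a)) b
  rw [Matrix.add_apply, Matrix.mul_apply, Matrix.mul_apply,
    Fintype.sum_eq_single a fun k hk => ?_, Fintype.sum_eq_single (S.partner b) fun k hk => ?_]
    at h2
  · exact h2
  · have : S.qMatrix.map (Int.cast : ℤ → ZpUr p) k b = 0 := by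
      rw [Matrix.map_apply, S.qMatrix_of_ne, Int.cast_zero]
      intro hb
      exact hk (by rw [hb, S.partner_partner])
    rw [this, mul_zero]
  · have : S.qMatrix.map (Int.cast : ℤ → ZpUr p) (S.partner a) k = 0 := by
      rw [Matrix.map_apply, S.qMatrix_of_ne, Int.cast_zero]
      rwa [S.partner_partner]
    rw [this, zero_mul]


theorem quad_eq_q_of_mem_points {C : Type} [CommRing C] [Algebra (ZpUr p) C] {g : GL ι C}
    (hg : g ∈ points p (S.groupIdeal p) C) : S.quad g = S.q C := by
  have h := fibreIdeal_eq_zero_iff.mp fun f hf => hg f (fibreIdeal_le_groupIdeal hf)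
  rwa [map_evalGL_genX] at h

/-- Such a coefficient would sit at a weight `kχ` of squared length at least `4 · 2 = 8`, while
differences of weights have squared length at most `4`. A root of squared length `1` would permit `k
= 2`. -/
theorem coeff_eq_zero_of_two_le {χ : ι → ℤ} (hχ : S.IsRoot p χ)
    (hn : ¬ (S.IsOddOrthogonal ∧ S.IsShortestRoot p χ)) {u : GL ι (ZpUr p)[X]}
    (hu : ∀ (C : Type) [CommRing C] [Algebra (ZpUr p) C] (d : ι → Cˣ) (c : C),
      diagGL d ∈ points p (S.torusS p) C →
      diagGL d * evalParam p u c * (diagGL d)⁻¹ = evalParam p u ((charValue χ d : C) * c))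
    (i j : ι) {k : ℕ} (hk : 2 ≤ k) : (u.val i j).coeff k = 0 := by
  by_contra h
  have h1 := dotProduct_weight_sub_le (S := S) i j
  rw [weight_sub_eq_of_coeff_ne_zero hχ.1 hχ.2.1 hu h, smul_dotProduct, dotProduct_smul,
    nsmul_eq_mul, nsmul_eq_mul] at h1
  obtain ⟨a, b, hab⟩ := hχ.exists_weight_sub
  have h2 := two_le_dotProduct hχ hn hab
  have h3 : (2 : ℤ) ≤ k := by exact_mod_cast hk
  have h4 : (2 : ℤ) * (2 * 2) ≤ k * (k * (χ ⬝ᵥ χ)) := by gcongr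
  omega

/-- The entries of the linear coefficient of a parametrization of a root group agree up to sign. -/
theorem exists_coeff_one_eq {χ : ι → ℤ} (hχ : S.IsRoot p χ)
    (hn : ¬ (S.IsOddOrthogonal ∧ S.IsShortestRoot p χ)) {u : GL ι (ZpUr p)[X]}
    (hu : ∀ (C : Type) [CommRing C] [Algebra (ZpUr p) C] (d : ι → Cˣ) (c : C),
      diagGL d ∈ points p (S.torusS p) C →
      diagGL d * evalParam p u c * (diagGL d)⁻¹ = evalParam p u ((charValue χ d : C) * c))
    (hq : S.quad u = S.q _) (h0 : u.val.map (fun f => f.coeff 0) = 1) :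
    ∃ c : ZpUr p, ∀ i j, (u.val i j).coeff 1 = 0 ∨ (u.val i j).coeff 1 = c ∨
      (u.val i j).coeff 1 = -c := by
  by_cases hall : ∀ i j, (u.val i j).coeff 1 = 0
  · exact ⟨0, fun i j => Or.inl (hall i j)⟩
  push Not at hall
  obtain ⟨a, b, hab⟩ := hall
  refine ⟨(u.val a b).coeff 1, fun i j => ?_⟩
  by_cases hij : (u.val i j).coeff 1 = 0
  · exact Or.inl hij
  right
  have hw : ∀ {i j}, (u.val i j).coeff 1 ≠ 0 → S.weight i - S.weight j = χ := fun h => by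
    rw [weight_sub_eq_of_coeff_ne_zero hχ.1 hχ.2.1 hu h, one_smul]
  rcases eq_or_eq_of_weight_sub_eq (two_le_dotProduct hχ hn (hw hab)) (hw hab) (hw hij) with
    ⟨rfl, rfl⟩ | ⟨hS, rfl, rfl⟩
  · exact Or.inl rfl
  -- The second possible position is the partner one, tied to the first by the Lie algebra equation
  -- up to the signs in `q`.
  · have h := qMatrix_mul_add_eq_zero hS hq h0 a b
    have hqp : ∀ i, S.qMatrix (S.partner i) i = 1 ∨ S.qMatrix (S.partner i) i = -1 := fun i => by
      simpa only [partner_partner] using S.qMatrix_partner (S.partner i)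
    rcases hqp a with ha | ha <;> rcases hqp b with hb | hb <;> rw [ha, hb] at h <;>
      push_cast at h
    · exact Or.inr (by linear_combination h)
    · exact Or.inl (by linear_combination -h)
    · exact Or.inl (by linear_combination h)
    · exact Or.inr (by linear_combination -h)

/-- The root groups are horizontal, apart from those of the short roots of the odd orthogonal
groups. -/
theorem horizontal_of_isRootGroup (hp : p ≠ 2) {φ : FrobLift p ι}
    (hφ : S.IsPhi p (genXhat p ι) φ.mat) {χ : ι → ℤ} {U : Ideal (OGL p ι)} (hχ : S.IsRoot p χ)
    (hU : S.IsRootGroup p χ U) (hn : ¬ (S.IsOddOrthogonal ∧ S.IsShortestRoot p χ)) :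
    Horizontal p φ U := by
  obtain ⟨u, hsurj, rfl, hmem, hadd, htor⟩ := hU
  have hp' : p.Prime := Fact.out
  have hodd : Odd p := hp'.odd_of_ne_two hp
  have hq : S.quad u = S.q _ := quad_eq_q_of_mem_points hmem
  have h0 : u.val.map (fun f => f.coeff 0) = 1 := Matrix.ext fun i j => coeff_zero_eq_one hadd i j
  obtain ⟨c, hc⟩ := exists_coeff_one_eq hχ hn htor hq h0
  -- The parametrization is `1 + sN` with zero diagonal in `N`: a nonzero diagonal coefficient would
  -- have weight `0 = χ`.
  have hN : ∀ i j, u.val i j = if i = j then 1 else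
      Polynomial.C ((u.val i j).coeff 1) * Polynomial.X := by
    intro i j
    refine Polynomial.ext fun k => ?_
    rcases k with _ | _ | k
    · rw [coeff_zero_eq_one hadd, Matrix.one_apply]
      split_ifs <;> simp
    · split_ifs with h
      · subst h
        by_contra h1
        refine hχ.2.1 ?_
        rw [Polynomial.coeff_one] at h1
        have := weight_sub_eq_of_coeff_ne_zero hχ.1 hχ.2.1 htor (k := 1) h1
        rw [sub_self, one_smul] at this
        exact this.symm
      · simp
    · rw [coeff_eq_zero_of_two_le hχ hn htor i j (by omega)]
      split_ifs
      · rw [Polynomial.coeff_one, if_neg (by omega)]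
      · rw [Polynomial.coeff_C_mul, Polynomial.coeff_X, if_neg (by omega), mul_zero]
  -- Substituting `c^(p-1) s^p` for `s` turns each entry `±c s` into its `p`-th power, `p` being
  -- odd. So `u^{(p)}` is a reparametrization of `u` and still satisfies `ℋ = q`.
  set θ : (ZpUr p)[X] →+* (ZpUr p)[X] :=
    Polynomial.eval₂RingHom Polynomial.C (Polynomial.C (c ^ (p - 1)) * Polynomial.X ^ p) with hθ
  have hθu : ∀ i j, θ (u.val i j) = u.val i j ^ p := by
    intro i j
    rw [hN i j]
    split_ifs
    · rw [map_one, one_pow]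
    · rw [hθ, map_mul, Polynomial.coe_eval₂RingHom, Polynomial.eval₂_C, Polynomial.eval₂_X,
        mul_pow, ← mul_assoc, ← Polynomial.C_mul, ← Polynomial.C_pow]
      congr 2
      rcases hc i j with h | h | h <;> rw [h]
      · rw [zero_mul, zero_pow hp'.ne_zero]
      · rw [mul_pow_sub_one hp'.ne_zero]
      · rw [neg_mul, mul_pow_sub_one hp'.ne_zero, hodd.neg_pow]
  -- The entries of the semilinear image carry `φ(c)` instead of `c`. It is associated to `c`, hence
  -- divides `c^p`, and `v` compensates without knowing that `c` is a unit.
  obtain ⟨v, hv⟩ : ∃ v, frob p c * v = c ^ p :=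
    ⟨_, ((associated_frob p c).symm.dvd.trans (dvd_pow_self c hp'.ne_zero)).choose_spec.symm⟩
  set ψ : (ZpUr p)[X] →+* (ZpUr p)[X] := Polynomial.eval₂RingHom (Polynomial.C.comp (frob p))
    (Polynomial.C v * Polynomial.X ^ p) with hψ
  have hψu : ∀ i j, ψ (u.val i j) = u.val i j ^ p := by
    intro i j
    rw [hN i j]
    split_ifs
    · rw [map_one, one_pow]
    · rw [hψ, map_mul, Polynomial.coe_eval₂RingHom, Polynomial.eval₂_C, Polynomial.eval₂_X,
        mul_pow, ← mul_assoc, RingHom.comp_apply, ← Polynomial.C_mul, ← Polynomial.C_pow]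
      congr 2
      rcases hc i j with h | h | h <;> rw [h]
      · rw [map_zero, zero_mul, zero_pow hp'.ne_zero]
      · exact hv
      · rw [map_neg, neg_mul, hv, hodd.neg_pow]
  set b := Matrix.GeneralLinearGroup.map (algebraMap (ZpUr p)[X] (Hat p (ZpUr p)[X])) u
  have hqb : S.quad b = S.q _ := by rw [← glMap_quad, hq, glMap_q]
  have hpow : ∀ {η : (ZpUr p)[X] →+* (ZpUr p)[X]}, (∀ i j, η (u.val i j) = u.val i j ^ p) →
      Matrix.GeneralLinearGroup.map ((algebraMap (ZpUr p)[X] (Hat p (ZpUr p)[X])).comp η) u =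
        powP p b := fun {η} h => Units.ext <| Matrix.ext fun i j => by
    change algebraMap _ (Hat p (ZpUr p)[X]) (η (u.val i j)) =
      algebraMap _ (Hat p (ZpUr p)[X]) (u.val i j) ^ p
    rw [h, map_pow]
  have hqp : S.quad (powP p b) = S.q _ := by rw [← hpow hθu, ← glMap_quad, hq, glMap_q]
  refine horizontal_of_evalGL u (fun f hf => hf) ?_
    ((algebraMap (ZpUr p)[X] (Hat p (ZpUr p)[X])).comp ψ) ?_ ?_
  -- Saturation holds because the parametrization is a closed immersion: the quotient of the value
  -- by `pⁿ` lifts to `O(G)`.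
  · intro n f hf
    rw [pIdeal, Ideal.span_singleton_pow, Ideal.mem_span_singleton] at hf
    obtain ⟨g, hg⟩ := hf
    obtain ⟨l, rfl⟩ := hsurj g
    refine ⟨f - (p : OGL p ι) ^ n * l, ?_, ?_⟩
    · rw [RingHom.mem_ker, map_sub, hg, map_mul, map_pow, map_natCast, sub_self]
    · rw [sub_sub_cancel, pIdeal, Ideal.span_singleton_pow, Ideal.mem_span_singleton]
      exact dvd_mul_right _ _
  · ext1 r
    change algebraMap _ _ (ψ (Polynomial.C r)) = algebraMap _ _ (frob p r)
    rw [hψ, Polynomial.coe_eval₂RingHom, Polynomial.eval₂_C,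
      IsScalarTower.algebraMap_apply (ZpUr p) (ZpUr p)[X] (Hat p (ZpUr p)[X])]
    rfl
  · rw [hpow hψu]
    exact (isPhi_powP_of_quad hp hqb hqp).unique hp (isPhi_evalHat hφ _ b)

end ClassicalGroup

end

end DeltaFlow

theorem mainTheorem10 (p : ℕ) [Fact p.Prime] (hp : p ≠ 2) {ι : Type} [Fintype ι] [DecidableEq ι]
    (S : DeltaFlow.ClassicalGroup ι) :
    -- symmetry and horizontality
    (∃! φ : DeltaFlow.FrobLift p ι,
      S.QuadHorizontal p φ (DeltaFlow.phiZero p ι) ∧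
        S.QuadSymmetric p φ (DeltaFlow.phiZero p ι)) ∧
    ∀ φ : DeltaFlow.FrobLift p ι,
      S.QuadHorizontal p φ (DeltaFlow.phiZero p ι) →
      S.QuadSymmetric p φ (DeltaFlow.phiZero p ι) →
      -- compatibility with the torus and the Weyl group
      (DeltaFlow.RightCompatible p φ (DeltaFlow.torusIdeal p ι) ∧
        DeltaFlow.RightCompatible p φ (DeltaFlow.weylIdeal p ι) ∧
        DeltaFlow.LeftCompatible p φ (S.torusS p) ∧
        DeltaFlow.LeftCompatible p φ (S.weylS p)) ∧
      -- the cocycle rule for `a ∈ T_S W_S`, `b ∈ GL(R)`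
      (∀ t ∈ DeltaFlow.points p (S.torusS p) (DeltaFlow.ZpUr p),
        ∀ w ∈ DeltaFlow.points p (S.weylS p) (DeltaFlow.ZpUr p),
        ∀ b : GL ι (DeltaFlow.ZpUr p),
          DeltaFlow.logDeriv p φ (t * w * b) =
            DeltaFlow.addDelta p (DeltaFlow.starDelta p (t * w) (DeltaFlow.logDeriv p φ b))
              (DeltaFlow.logDeriv p φ (t * w))) ∧
      -- the cocycle rule for `a ∈ GL(R)`, `b ∈ T W`
      (∀ a : GL ι (DeltaFlow.ZpUr p),
        ∀ t ∈ DeltaFlow.points p (DeltaFlow.torusIdeal p ι) (DeltaFlow.ZpUr p),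
        ∀ w ∈ DeltaFlow.points p (DeltaFlow.weylIdeal p ι) (DeltaFlow.ZpUr p),
          DeltaFlow.logDeriv p φ (a * (t * w)) =
            DeltaFlow.addDelta p (DeltaFlow.starDelta p a (DeltaFlow.logDeriv p φ (t * w)))
              (DeltaFlow.logDeriv p φ a)) ∧
      -- compatibility with root groups
      (∀ (χ : ι → ℤ) (U : Ideal (DeltaFlow.OGL p ι)),
        S.IsRoot p χ → S.IsRootGroup p χ U →
        ¬ (S.IsOddOrthogonal ∧ S.IsShortestRoot p χ) →
        DeltaFlow.Horizontal p φ U) := by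
  refine ⟨DeltaFlow.existsUnique_frobLift hp S, fun φ hH hS => ?_⟩
  have hφ := DeltaFlow.isPhi_mat_iff.mpr ⟨hH, hS⟩
  exact ⟨DeltaFlow.ClassicalGroup.compatible hp hφ,
    fun t ht w hw b => DeltaFlow.ClassicalGroup.logDeriv_mul_left hp hφ ht hw b,
    fun a t ht w hw => DeltaFlow.ClassicalGroup.logDeriv_mul_right hp hφ a ht hw,
    fun χ U hχ hU hn => DeltaFlow.ClassicalGroup.horizontal_of_isRootGroup hp hφ hχ hU hn⟩
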